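/- **Setting.** All functions are real valued. Let $\langle x\rangle=(1+|x|^2)^{1/2}$ on $\mathbb{R}^2$, let $\chi\in C^\infty(\mathbb{R}^2,[0,1])$ be a radial cut-off function with $\chi(x)=0$ for $|x|<1$ and $\chi(x)=1$ for $|x|>2$, and let $m(|x|)=|x|(1-\chi(x))+\chi(x)$, so that $m(r)=r$ for $r<1$ and $m(r)=1$ for $r>2$. For an integer $k\ge 0$ and $\gamma\in\mathbb{R}$, $H^k_{\gamma}(\mathbb{R}^2)$ is the space of functions all of whose weak derivatives on $\mathbb{R}^2$ of order at most $k$ satisfy $\langle x\rangle^{\gamma}D^\alpha f\in L^2(\mathbb{R}^2)$. For $\gamma,\sigma\in\mathbb{R}$, $H^k_{r,\gamma,\sigma}(\mathbb{R}^2)$ is the space of radially symmetric functions $u$ on $\mathbb{R}^2\setminus\{0\}$ with weak derivatives of order at most $k$ there and finite norm $$\|u\|_{H^k_{r,\gamma,\sigma}}=\sum_{|\alpha|\le k}\big\|m(|x|)^{\sigma+|\alpha|}\,\langle x\rangle^{\gamma}\,D^\alpha u\big\|_{L^2(\mathbb{R}^2)}$$ (the radial part of the closure of $C_c^\infty(\mathbb{R}^2\setminus\{0\})$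 in this norm). A bounded linear operator is Fredholm if it has closed range and finite-dimensional kernel and cokernel; its index is $\dim\mathrm{Ker}-\dim\mathrm{coKer}$. **Lemma.** Let $s\ge 1$ be an integer, $\gamma\in\mathbb{R}$, $\sigma\in\mathbb{R}\setminus\{0\}$, $\lambda>0$, $\kappa>0$ and $\tilde\gamma\in(-\tfrac12,1)$. Let $\phi_0=\phi_0(r)$ be differentiable on $(0,\infty)$ and such that * $\partial_r\phi_0\to\kappa$ as $r\to\infty$, * $\partial_r\phi_0-\kappa=\mathrm{O}(1/r)$ as $r\to\infty$, * $\partial_r\phi_0-\kappa$, as a radial function on $\mathbb{R}^2$, belongs to $H^{\max(3,\,s-1)}_{\tilde\gamma}(\mathbb{R}^2)$ (that is, to $H^3_{\tilde\gamma}(\mathbb{R}^2)$ when $s\le 4$). Then $$\mathcal{L}_\phi u=\partial_r u+\frac1r u-\lambda\,\partial_r\phi_0\,u$$ defines a bounded operator $\mathcal{L}_\phi:H^s_{r,\gamma,\sigma}(\mathbb{R}^2)\to H^{s-1}_{r,\gamma,\sigma+1}(\mathbb{R}^2)$, and this operator is Fredholm. If moreover $\phi_0(r)\to c\in\mathbb{R}$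 as $r\to0^+$, then: 1. if $\sigma<0$, $\mathcal{L}_\phi$ is injective, has index $-1$, and its cokernel is spanned by $e^{-\lambda\phi_0}$: the functional $\ell(f)=\int_{\mathbb{R}^2}f(x)\,e^{-\lambda\phi_0(|x|)}\,dx$ is given by an absolutely convergent integral, is bounded and nonzero on $H^{s-1}_{r,\gamma,\sigma+1}(\mathbb{R}^2)$, it spans the kernel of the adjoint of $\mathcal{L}_\phi$, and $f$ is in the range of $\mathcal{L}_\phi$ if and only if $\ell(f)=0$; 2. if $\sigma>0$, $\mathcal{L}_\phi$ has index $0$ and is invertible with bounded inverse. -/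

import Mathlib

open MeasureTheory Filter Topology Asymptotics
open scoped ContDiff Distributions LineDeriv

noncomputable section

/-- The Euclidean plane `ℝ²`. -/
abbrev Plane : Type := EuclideanSpace ℝ (Fin 2)

/-- The radial profile of a smooth radial cut-off function on `ℝ²` that vanishes for `|x| < 1` and
equals `1` for `|x| > 2`; the cut-off itself is `x ↦ χ ‖x‖`. -/
structure IsRadialCutoff (χ : ℝ → ℝ) : Prop where
  contDiff : ContDiff ℝ ∞ χ
  nonneg : ∀ r, 0 ≤ χ r
  le_one : ∀ r, χ r ≤ 1
  eq_zero : ∀ r, r < 1 → χ r = 0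
  eq_one : ∀ r, 2 < r → χ r = 1

/-- `m(r) = r (1 - χ(r)) + χ(r)`: equal to `r` near the origin and to `1` in the far field. -/
def originWeight (χ : ℝ → ℝ) (r : ℝ) : ℝ := r * (1 - χ r) + χ r

/-- `⟨x⟩ = (1 + |x|²)^{1/2}`. -/
def japaneseBracket (x : Plane) : ℝ := Real.sqrt (1 + ‖x‖ ^ 2)

/-- The double weight `m(|x|)^σ ⟨x⟩^γ`. -/
def doubleWeight (χ : ℝ → ℝ) (γ σ : ℝ) (x : Plane) : ℝ :=
  originWeight χ ‖x‖ ^ σ * japaneseBracket x ^ γ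

/-- The `i`-th standard basis vector of `ℝ²`. -/
def basisVec (i : Fin 2) : Plane := EuclideanSpace.single i (1 : ℝ)

/-- The classical partial derivative `D^α` of a test function. -/
def testDeriv {Ω : TopologicalSpace.Opens Plane} (α : Fin 2 → ℕ) (η : 𝓓(Ω, ℝ)) : 𝓓(Ω, ℝ) :=
  (fun ζ : 𝓓(Ω, ℝ) => ∂_{basisVec 0} ζ)^[α 0] ((fun ζ : 𝓓(Ω, ℝ) => ∂_{basisVec 1} ζ)^[α 1] η)

/-- `v` is the weak derivative `D^α u` on the open set `Ω ⊆ ℝ²`. -/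
structure HasWeakDeriv (Ω : TopologicalSpace.Opens Plane) (α : Fin 2 → ℕ) (u v : Plane → ℝ) :
    Prop where
  left : LocallyIntegrableOn u Ω volume
  right : LocallyIntegrableOn v Ω volume
  eq : ∀ η : 𝓓(Ω, ℝ),
    ∫ x, testDeriv α η x * u x = (-1) ^ (∑ i, α i) * ∫ x, η x * v x

/-- `f ∈ H^k_γ(ℝ²)`: all weak derivatives `D^α f` with `|α| ≤ k` exist on `ℝ²` and satisfy
`⟨x⟩^γ D^α f ∈ L²(ℝ²)`. -/
def MemWeightedSobolev (k : ℕ) (γ : ℝ) (f : Plane → ℝ) : Prop :=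
  ∀ α : Fin 2 → ℕ, ∑ i, α i ≤ k →
    ∃ g : Plane → ℝ, HasWeakDeriv ⊤ α f g ∧
      MemLp (fun x => japaneseBracket x ^ γ * g x) 2 volume

/-- The punctured plane `ℝ² \ {0}`. -/
def puncturedPlane : TopologicalSpace.Opens Plane := ⟨{0}ᶜ, isOpen_compl_singleton⟩

/-- Multi-indices `α ∈ ℕ²` with `|α| ≤ s`. -/
abbrev MultiIndex (s : ℕ) : Type := {α : Fin 2 → ℕ // ∑ i, α i ≤ s}

instance multiIndexFinite (s : ℕ) : Finite (MultiIndex s) := by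
  refine Finite.of_injective
    (fun α : MultiIndex s => fun i : Fin 2 => (⟨α.1 i, ?_⟩ : Fin (s + 1))) ?_
  · exact Nat.lt_succ_of_le
      ((Finset.single_le_sum (fun j _ => Nat.zero_le (α.1 j)) (Finset.mem_univ i)).trans α.2)
  · intro α β h
    apply Subtype.ext
    funext i
    exact congrArg Fin.val (congrFun h i)

instance multiIndexFintype (s : ℕ) : Fintype (MultiIndex s) := Fintype.ofFinite _

/-- The multi-index `0`. -/
def zeroIndex (s : ℕ) : MultiIndex s := ⟨0, by simp⟩

/-- The multi-index `e_i` of the first-order derivative `∂_i`. -/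
def unitIndex {s : ℕ} (hs : 1 ≤ s) (i : Fin 2) : MultiIndex s :=
  ⟨Pi.single i 1, by rw [Finset.sum_pi_single']; simpa using hs⟩

/-- Families `(G_α)_{|α| ≤ s}` in `L²(ℝ²)` with the norm `∑_α ‖G_α‖_{L²}`. -/
abbrev SobolevData (s : ℕ) : Type :=
  PiLp 1 (fun _ : MultiIndex s => Lp ℝ 2 (volume : Measure Plane))

/-- The function `D^α u` encoded by `G_α = m^{σ+|α|} ⟨x⟩^γ D^α u`. -/
def SobolevData.component {s : ℕ} (χ : ℝ → ℝ) (γ σ : ℝ) (G : SobolevData s) (α : MultiIndex s) :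
    Plane → ℝ :=
  fun x => G α x / doubleWeight χ γ (σ + ((∑ i, α.1 i : ℕ) : ℝ)) x

lemma SobolevData.component_zero {s : ℕ} (χ : ℝ → ℝ) (γ σ : ℝ) (α : MultiIndex s) :
    SobolevData.component χ γ σ (0 : SobolevData s) α =ᵐ[volume] 0 := by
  have h : ((0 : SobolevData s) α : Plane → ℝ) =ᵐ[volume] 0 :=
    Lp.coeFn_zero ℝ 2 (volume : Measure Plane)
  filter_upwards [h] with x hx
  simp only [SobolevData.component, Pi.zero_apply] at hx ⊢
  rw [hx, zero_div]

lemma SobolevData.component_add {s : ℕ} (χ : ℝ → ℝ) (γ σ : ℝ) (G H : SobolevData s)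
    (α : MultiIndex s) :
    SobolevData.component χ γ σ (G + H) α =ᵐ[volume]
      SobolevData.component χ γ σ G α + SobolevData.component χ γ σ H α := by
  have h : ((G + H) α : Plane → ℝ) =ᵐ[volume] G α + H α := Lp.coeFn_add (G α) (H α)
  filter_upwards [h] with x hx
  simp only [SobolevData.component, Pi.add_apply] at hx ⊢
  rw [hx, add_div]

lemma SobolevData.component_smul {s : ℕ} (χ : ℝ → ℝ) (γ σ : ℝ) (c : ℝ) (G : SobolevData s)
    (α : MultiIndex s) :
    SobolevData.component χ γ σ (c • G) α =ᵐ[volume] c • SobolevData.component χ γ σ G α := by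
  have h : ((c • G) α : Plane → ℝ) =ᵐ[volume] c • G α := Lp.coeFn_smul c (G α)
  filter_upwards [h] with x hx
  simp only [SobolevData.component, Pi.smul_apply, smul_eq_mul] at hx ⊢
  rw [hx, mul_div_assoc]

lemma HasWeakDeriv.congr {Ω : TopologicalSpace.Opens Plane} {α : Fin 2 → ℕ}
    {u v u' v' : Plane → ℝ} (h : HasWeakDeriv Ω α u v) (hu : u' =ᵐ[volume] u)
    (hv : v' =ᵐ[volume] v) : HasWeakDeriv Ω α u' v' := by
  refine ⟨?_, ?_, fun η => ?_⟩
  · exact h.left.congr (ae_restrict_of_ae hu.symm)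
  · exact h.right.congr (ae_restrict_of_ae hv.symm)
  · rw [integral_congr_ae (g := fun x => testDeriv α η x * u x), h.eq η,
      integral_congr_ae (g := fun x => η x * v' x)]
    · filter_upwards [hv] with x hx using by rw [hx]
    · filter_upwards [hu] with x hx using by rw [hx]

lemma HasWeakDeriv.add {Ω : TopologicalSpace.Opens Plane} {α : Fin 2 → ℕ}
    {u v u' v' : Plane → ℝ} (h : HasWeakDeriv Ω α u v) (h' : HasWeakDeriv Ω α u' v') :
    HasWeakDeriv Ω α (u + u') (v + v') := by
  have key : ∀ {w : Plane → ℝ} (_ : LocallyIntegrableOn w Ω volume) (η : 𝓓(Ω, ℝ)),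
      Integrable (fun x => η x * w x) volume := fun hw η =>
    TestFunction.integrable_bilin (ContinuousLinearMap.mul ℝ ℝ) hw η
  refine ⟨h.left.add h'.left, h.right.add h'.right, fun η => ?_⟩
  simp only [Pi.add_apply, mul_add]
  rw [integral_add (key h.left _) (key h'.left _), integral_add (key h.right _) (key h'.right _),
    h.eq η, h'.eq η, mul_add]

lemma HasWeakDeriv.smul {Ω : TopologicalSpace.Opens Plane} {α : Fin 2 → ℕ}
    {u v : Plane → ℝ} (c : ℝ) (h : HasWeakDeriv Ω α u v) : HasWeakDeriv Ω α (c • u) (c • v) := by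
  refine ⟨h.left.smul c, h.right.smul c, fun η => ?_⟩
  simp only [Pi.smul_apply, smul_eq_mul, mul_left_comm _ c]
  rw [integral_const_mul, integral_const_mul, h.eq η]
  ring

lemma HasWeakDeriv.zero (Ω : TopologicalSpace.Opens Plane) (α : Fin 2 → ℕ) :
    HasWeakDeriv Ω α 0 0 :=
  ⟨locallyIntegrableOn_zero, locallyIntegrableOn_zero, fun η => by simp⟩

/-- The space `H^s_{r,γ,σ}(ℝ²)` of real-valued radial functions `u` on `ℝ² \ {0}` whose weak
derivatives satisfy `m^{σ+|α|} ⟨x⟩^γ D^α u ∈ L²(ℝ²)` for all `|α| ≤ s`, normed by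
`∑_{|α| ≤ s} ‖m^{σ+|α|} ⟨x⟩^γ D^α u‖_{L²}`. The function `u` is encoded, isometrically for this norm,
by the family `(m^{σ+|α|} ⟨x⟩^γ D^α u)_{|α| ≤ s}`. -/
def RadialSobolev (χ : ℝ → ℝ) (s : ℕ) (γ σ : ℝ) : Submodule ℝ (SobolevData s) where
  carrier := {G |
    (∃ g : ℝ → ℝ, G.component χ γ σ (zeroIndex s) =ᵐ[volume] fun x => g ‖x‖) ∧
    ∀ α : MultiIndex s, HasWeakDeriv puncturedPlane α.1
      (G.component χ γ σ (zeroIndex s)) (G.component χ γ σ α)}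
  zero_mem' := ⟨⟨0, SobolevData.component_zero χ γ σ _⟩, fun α =>
    (HasWeakDeriv.zero _ _).congr (SobolevData.component_zero χ γ σ _)
      (SobolevData.component_zero χ γ σ _)⟩
  add_mem' := by
    rintro G H ⟨⟨g, hg⟩, hG⟩ ⟨⟨h, hh⟩, hH⟩
    refine ⟨⟨g + h, ?_⟩, fun α => ((hG α).add (hH α)).congr
      (SobolevData.component_add χ γ σ G H _) (SobolevData.component_add χ γ σ G H _)⟩
    exact (SobolevData.component_add χ γ σ G H _).trans (hg.add hh)
  smul_mem' := by
    rintro c G ⟨⟨g, hg⟩, hG⟩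
    refine ⟨⟨c • g, ?_⟩, fun α => ((hG α).smul c).congr
      (SobolevData.component_smul χ γ σ c G _) (SobolevData.component_smul χ γ σ c G _)⟩
    exact (SobolevData.component_smul χ γ σ c G _).trans (hg.const_smul c)

namespace RadialSobolev

variable {χ : ℝ → ℝ} {s : ℕ} {γ σ : ℝ}

/-- The underlying function `u : ℝ² → ℝ` of an element of `H^s_{r,γ,σ}(ℝ²)`. -/
def toFun (u : RadialSobolev χ s γ σ) : Plane → ℝ :=
  u.1.component χ γ σ (zeroIndex s)

/-- The weak radial derivative `∂_r u = (x / |x|) · ∇u`. -/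
def radialDeriv (hs : 1 ≤ s) (u : RadialSobolev χ s γ σ) : Plane → ℝ :=
  fun x => ∑ i, x i / ‖x‖ * u.1.component χ γ σ (unitIndex hs i) x

/-- `∂_r u + u / r - lam (∂_r φ₀) u`. -/
def phaseOperator (hs : 1 ≤ s) (lam : ℝ) (φ₀ : ℝ → ℝ) (u : RadialSobolev χ s γ σ) : Plane → ℝ :=
  fun x => radialDeriv hs u x + toFun u x / ‖x‖ - lam * deriv φ₀ ‖x‖ * toFun u x

end RadialSobolev

/-- The index `dim ker T - dim coker T` (meaningful for a Fredholm operator `T`). -/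
def fredholmIndex {X Y : Type*} [NormedAddCommGroup X] [NormedSpace ℝ X]
    [NormedAddCommGroup Y] [NormedSpace ℝ Y] (T : X →L[ℝ] Y) : ℤ :=
  (Module.finrank ℝ T.ker : ℤ) - (Module.finrank ℝ (Y ⧸ T.range) : ℤ)

/-- The cokernel of `T : X → H^k_{r,γ,σ}(ℝ²)` is spanned by the function `w`: pairing with `w` in
`L²(ℝ²)` is a nonzero continuous linear functional on `H^k_{r,γ,σ}(ℝ²)`, it spans the kernel of the
adjoint of `T`, and `f` lies in the range of `T` exactly when `∫ f w = 0`. -/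
def CokernelSpannedBy {X : Type*} [NormedAddCommGroup X] [NormedSpace ℝ X]
    {χ : ℝ → ℝ} {k : ℕ} {γ σ : ℝ} (T : X →L[ℝ] RadialSobolev χ k γ σ) (w : Plane → ℝ) : Prop :=
  ∃ ℓ : StrongDual ℝ (RadialSobolev χ k γ σ),
    (∀ f, Integrable (fun x => RadialSobolev.toFun f x * w x) volume ∧
      ℓ f = ∫ x, RadialSobolev.toFun f x * w x) ∧
    ℓ ≠ 0 ∧
    (∀ η : StrongDual ℝ (RadialSobolev χ k γ σ), η ∘L T = 0 ↔ η ∈ Submodule.span ℝ {ℓ}) ∧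
    (∀ f, f ∈ T.range ↔ ℓ f = 0)

end

/-! ### Weak derivatives -/

section WeakDeriv

variable {Ω : TopologicalSpace.Opens Plane}

/-! For u(x) = g(|x|) the operator is the first-order expression g' + V g on the half-line, with V =
1/r - λ φ₀'. Put e = exp(-λ φ₀). Then r e(r) is an integrating factor: g' + V g = f means (r e g)' =
r e f. Since φ₀' → κ > 0 and λ > 0, the weight e decays exponentially; the Sobolev hypothesis on φ₀'
- κ keeps φ₀ bounded near the origin, so e is bounded above and below there
(`PhaseProfile.isDecayingWeight`). The homogeneous solution 1/(r e) therefore grows exponentially at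
infinity and is comparable to 1/r at the origin.

Infinity decides uniqueness. For g in the weighted space, r e g is integrable at infinity and has a
limit, which must be 0; hence r e g = -∫_r^∞ t e f dt (`IsDecayingWeight.eq_neg_integral`), and the
operator is injective for every σ.

The origin decides solvability. If σ > 0, the singularity 1/r is square integrable for r^{2σ} r dr
near 0, so this formula always gives an admissible solution. If σ < 0 it is not, and the coefficient
of 1/r, namely ∫_0^∞ t e f dt, has to vanish; in polar coordinates this is a multiple of ∫ f e^{-λ
φ₀} dx. The L² bounds come from the Schur test with an exponential kernel at infinity and a Hardy
kernel at the origin (`IsSchurKernel.memLp`, `IsDecayingWeight.exists_solution`). Higher derivatives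
follow by bootstrapping the equation (`RadialReg.of_phase_equation`): multiplication by φ₀' - κ
costs one power of r, exactly the loss that the target weight σ + 1 allows.

The remaining work is a dictionary between the spaces defined by weak derivatives on the punctured
plane and regularity of profiles on the half-line (`RadialSobolev.exists_profile`,
`RadialSobolev.exists_of_profile`). Boundedness of the operator is the closed graph theorem; the
Fredholm property and the index are read off from injectivity and the description of the range. -/

lemma TestFunction.lineDeriv_apply_eq_fderiv (η : 𝓓(Ω, ℝ)) (v x : Plane) :
    (∂_{v} η : 𝓓(Ω, ℝ)) x = fderiv ℝ η x v := by
  rw [TestFunction.lineDerivOp_eq_lineDerivCLM ℝ, TestFunction.lineDerivCLM_apply_of_le (by simp)]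
  exact (η.contDiff.differentiable (by simp)).differentiableAt.lineDeriv_eq_fderiv

/-- `testDeriv` differentiates in a fixed order. Symmetry of the second derivative makes the order
irrelevant, and so multi-indices add in `testDeriv_add`. -/
lemma TestFunction.lineDeriv_comm (η : 𝓓(Ω, ℝ)) (v w : Plane) :
    (∂_{v} (∂_{w} η : 𝓓(Ω, ℝ)) : 𝓓(Ω, ℝ)) = ∂_{w} (∂_{v} η : 𝓓(Ω, ℝ)) := by
  ext x
  have h2 : ContDiff ℝ 2 η := contDiff_infty.1 η.contDiff 2
  have hd : DifferentiableAt ℝ (fderiv ℝ η) x :=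
    ((h2.fderiv_right (m := 1) (by norm_num)).differentiable (by simp)).differentiableAt
  have key : ∀ a b : Plane, (∂_{a} (∂_{b} η : 𝓓(Ω, ℝ)) : 𝓓(Ω, ℝ)) x
      = fderiv ℝ (fderiv ℝ η) x a b := by
    intro a b
    rw [lineDeriv_apply_eq_fderiv]
    have : (⇑(∂_{b} η : 𝓓(Ω, ℝ)) : Plane → ℝ) = fun y => fderiv ℝ η y b :=
      funext fun y => lineDeriv_apply_eq_fderiv η b y
    rw [this, fderiv_clm_apply hd (differentiableAt_const _)]
    simp
  rw [key, key]
  have hs : IsSymmSndFDerivAt ℝ (⇑η) x :=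
    h2.contDiffAt.isSymmSndFDerivAt (by simp)
  exact hs v w

lemma TestFunction.coe_lineDeriv_congr {Ω' : TopologicalSpace.Opens Plane} {η : 𝓓(Ω, ℝ)}
    {η' : 𝓓(Ω', ℝ)} (h : (⇑η : Plane → ℝ) = ⇑η') (v : Plane) :
    (⇑(∂_{v} η : 𝓓(Ω, ℝ)) : Plane → ℝ) = ⇑(∂_{v} η' : 𝓓(Ω', ℝ)) := by
  ext x
  rw [lineDeriv_apply_eq_fderiv, lineDeriv_apply_eq_fderiv, h]

lemma testDeriv_coe_congr {Ω' : TopologicalSpace.Opens Plane} {η : 𝓓(Ω, ℝ)}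
    {η' : 𝓓(Ω', ℝ)} (h : (⇑η : Plane → ℝ) = ⇑η') (α : Fin 2 → ℕ) :
    (⇑(testDeriv α η) : Plane → ℝ) = ⇑(testDeriv α η') := by
  have iter : ∀ (v : Plane) (n : ℕ) (ζ : 𝓓(Ω, ℝ)) (ζ' : 𝓓(Ω', ℝ)),
      (⇑ζ : Plane → ℝ) = ⇑ζ' →
      (⇑((fun ζ : 𝓓(Ω, ℝ) => ∂_{v} ζ)^[n] ζ) : Plane → ℝ) =
        ⇑((fun ζ : 𝓓(Ω', ℝ) => ∂_{v} ζ)^[n] ζ') := by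
    intro v n
    induction n with
    | zero => exact fun ζ ζ' h => h
    | succ n ih =>
      intro ζ ζ' h
      rw [Function.iterate_succ_apply, Function.iterate_succ_apply]
      exact ih _ _ (TestFunction.coe_lineDeriv_congr h v)
  exact iter _ _ _ _ (iter _ _ _ _ h)

lemma testDeriv_zero (η : 𝓓(Ω, ℝ)) : testDeriv 0 η = η := rfl

lemma testDeriv_single (i : Fin 2) (η : 𝓓(Ω, ℝ)) :
    testDeriv (Pi.single i 1) η = ∂_{basisVec i} η := by
  fin_cases i <;> rfl

lemma testDeriv_add (α β : Fin 2 → ℕ) (η : 𝓓(Ω, ℝ)) :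
    testDeriv (α + β) η = testDeriv α (testDeriv β η) := by
  have hc : Function.Commute (fun ζ : 𝓓(Ω, ℝ) => (∂_{basisVec 1} ζ : 𝓓(Ω, ℝ)))
      (fun ζ : 𝓓(Ω, ℝ) => (∂_{basisVec 0} ζ : 𝓓(Ω, ℝ))) :=
    fun ζ => TestFunction.lineDeriv_comm ζ _ _
  simp only [testDeriv, Pi.add_apply, Function.iterate_add_apply]
  rw [(hc.iterate_iterate (α 1) (β 0)).eq]

lemma sum_single_one (i : Fin 2) : ∑ j, (Pi.single i 1 : Fin 2 → ℕ) j = 1 := by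
  rw [Finset.sum_pi_single']; simp

lemma HasWeakDeriv.refl {u : Plane → ℝ} (h : LocallyIntegrableOn u Ω volume) :
    HasWeakDeriv Ω 0 u u :=
  ⟨h, h, fun η => by simp [testDeriv_zero, mul_comm]⟩

lemma HasWeakDeriv.trans {α β : Fin 2 → ℕ} {u v w : Plane → ℝ}
    (h : HasWeakDeriv Ω α u v) (h' : HasWeakDeriv Ω β v w) : HasWeakDeriv Ω (α + β) u w := by
  refine ⟨h.left, h'.right, fun η => ?_⟩
  rw [testDeriv_add, h.eq, h'.eq]
  simp only [Pi.add_apply, Finset.sum_add_distrib, pow_add, mul_assoc]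

/-- Testing the identity for α against D^β η eliminates u, and the common sign cancels. This is how
a family of derivatives of one function is read as a chain of first-order derivatives. -/
lemma HasWeakDeriv.of_add {α β : Fin 2 → ℕ} {u v w : Plane → ℝ}
    (h : HasWeakDeriv Ω α u v) (h' : HasWeakDeriv Ω (α + β) u w) : HasWeakDeriv Ω β v w := by
  refine ⟨h.right, h'.right, fun η => ?_⟩
  have h1 := h.eq (testDeriv β η)
  have h2 := h'.eq η
  rw [testDeriv_add] at h2
  simp only [Pi.add_apply, Finset.sum_add_distrib, pow_add, mul_assoc] at h2
  exact mul_left_cancel₀ (pow_ne_zero (∑ i, α i) (by norm_num : (-1 : ℝ) ≠ 0)) (h1.symm.trans h2)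

lemma TestFunction.integrable_mul {w : Plane → ℝ} (hw : LocallyIntegrableOn w Ω volume)
    (η : 𝓓(Ω, ℝ)) : Integrable (fun x => η x * w x) volume :=
  TestFunction.integrable_bilin (ContinuousLinearMap.mul ℝ ℝ) hw η

/-- The fundamental lemma of the calculus of variations on Ω, applied to the difference. -/
lemma HasWeakDeriv.unique {α : Fin 2 → ℕ} {u v v' : Plane → ℝ} (h : HasWeakDeriv Ω α u v)
    (h' : HasWeakDeriv Ω α u v') : ∀ᵐ x, x ∈ Ω → v x = v' x := by
  have := Ω.isOpen.ae_eq_zero_of_integral_contDiff_smul_eq_zero (μ := volume) (f := v - v')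
    (h.right.sub h'.right) (fun g hg hc hs => by
      let η : 𝓓(Ω, ℝ) := ⟨g, hg, hc, hs⟩
      have e := (h.eq η).symm.trans (h'.eq η)
      have e' := mul_left_cancel₀ (pow_ne_zero (∑ i, α i) (by norm_num : (-1 : ℝ) ≠ 0)) e
      have i1 := TestFunction.integrable_mul h.right η
      have i2 := TestFunction.integrable_mul h'.right η
      have : ∫ x, (η x * v x - η x * v' x) = 0 := by
        rw [integral_sub i1 i2, e', sub_self]
      rw [← this]
      refine integral_congr_ae (Eventually.of_forall fun x => ?_)
      change η x * (v x - v' x) = _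
      ring)
  filter_upwards [this] with x hx hxΩ
  exact sub_eq_zero.1 (hx hxΩ)

lemma HasWeakDeriv.mono {Ω' : TopologicalSpace.Opens Plane} (hΩ : Ω' ≤ Ω) {α : Fin 2 → ℕ}
    {u v : Plane → ℝ} (h : HasWeakDeriv Ω α u v) : HasWeakDeriv Ω' α u v := by
  refine ⟨h.left.mono_set hΩ, h.right.mono_set hΩ, fun η => ?_⟩
  let η' : 𝓓(Ω, ℝ) := ⟨η, η.contDiff, η.hasCompactSupport, η.tsupport_subset.trans hΩ⟩
  have e : (⇑η : Plane → ℝ) = ⇑η' := rfl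
  rw [testDeriv_coe_congr e]
  exact h.eq η'

/-- The product of a test function with a function that is smooth on the domain. -/
noncomputable def TestFunction.mulContDiffOn (η : 𝓓(Ω, ℝ)) (p : Plane → ℝ) (hp : ContDiffOn ℝ ∞ p Ω) :
    𝓓(Ω, ℝ) where
  toFun x := η x * p x
  contDiff' := by
    rw [contDiff_iff_contDiffAt]
    intro x
    by_cases hx : x ∈ tsupport η
    · exact η.contDiff.contDiffAt.mul
        (hp.contDiffAt (Ω.isOpen.mem_nhds (η.tsupport_subset hx)))
    · have : (fun x => η x * p x) =ᶠ[𝓝 x] fun _ => 0 := by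
        filter_upwards [notMem_tsupport_iff_eventuallyEq.1 hx] with y hy
        simp [hy]
      exact contDiffAt_const.congr_of_eventuallyEq this
  hasCompactSupport' := η.hasCompactSupport.mul_right
  tsupport_subset' := (tsupport_mul_subset_left).trans η.tsupport_subset

lemma TestFunction.lineDeriv_mulContDiffOn (η : 𝓓(Ω, ℝ)) (p : Plane → ℝ)
    (hp : ContDiffOn ℝ ∞ p Ω) (v x : Plane) :
    (∂_{v} (η.mulContDiffOn p hp) : 𝓓(Ω, ℝ)) x =
      (∂_{v} η : 𝓓(Ω, ℝ)) x * p x + η x * fderiv ℝ p x v := by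
  rw [lineDeriv_apply_eq_fderiv, lineDeriv_apply_eq_fderiv]
  change fderiv ℝ (fun y => η y * p y) x v = _
  by_cases hx : x ∈ tsupport η
  · have hpx : DifferentiableAt ℝ p x :=
      (hp.contDiffAt (Ω.isOpen.mem_nhds (η.tsupport_subset hx))).differentiableAt (by simp)
    rw [fderiv_fun_mul (η.contDiff.differentiable (by simp)).differentiableAt hpx]
    simp
    ring
  · have h0 := notMem_tsupport_iff_eventuallyEq.1 hx
    have : (fun x => η x * p x) =ᶠ[𝓝 x] fun _ => 0 := by
      filter_upwards [h0] with y hy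
      simp [hy]
    rw [this.fderiv_eq, h0.fderiv_eq, h0.eq_of_nhds]
    simp

lemma HasWeakDeriv.mul_contDiffOn {i : Fin 2} {v w p : Plane → ℝ}
    (h : HasWeakDeriv Ω (Pi.single i 1) v w) (hp : ContDiffOn ℝ ∞ p Ω) :
    HasWeakDeriv Ω (Pi.single i 1) (fun x => p x * v x)
      (fun x => fderiv ℝ p x (basisVec i) * v x + p x * w x) := by
  have hlc : IsLocallyClosed (Ω : Set Plane) := Ω.isOpen.isLocallyClosed
  have hp' : ContinuousOn (fun x => fderiv ℝ p x (basisVec i)) Ω :=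
    (hp.continuousOn_fderiv_of_isOpen Ω.isOpen (by simp)).clm_apply continuousOn_const
  have l1 : LocallyIntegrableOn (fun x => p x * v x) Ω volume :=
    h.left.continuousOn_mul hp.continuousOn hlc
  have l2 : LocallyIntegrableOn (fun x => fderiv ℝ p x (basisVec i) * v x) Ω volume :=
    h.left.continuousOn_mul hp' hlc
  have l3 : LocallyIntegrableOn (fun x => p x * w x) Ω volume :=
    h.right.continuousOn_mul hp.continuousOn hlc
  refine ⟨l1, l2.add l3, fun η => ?_⟩
  have e := h.eq (η.mulContDiffOn p hp)
  rw [testDeriv_single, sum_single_one] at e ⊢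
  have i1 := TestFunction.integrable_mul l1 (∂_{basisVec i} η)
  have i2 := TestFunction.integrable_mul l2 η
  have i3 := TestFunction.integrable_mul l3 η
  have e1 : ∫ x, (∂_{basisVec i} (η.mulContDiffOn p hp) : 𝓓(Ω, ℝ)) x * v x =
      (∫ x, (∂_{basisVec i} η : 𝓓(Ω, ℝ)) x * (p x * v x)) +
        ∫ x, η x * (fderiv ℝ p x (basisVec i) * v x) := by
    rw [← integral_add i1 i2]
    refine integral_congr_ae (Eventually.of_forall fun x => ?_)
    change (∂_{basisVec i} (η.mulContDiffOn p hp) : 𝓓(Ω, ℝ)) x * v x = _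
    rw [TestFunction.lineDeriv_mulContDiffOn]
    ring
  have e2 : ∫ x, (η.mulContDiffOn p hp) x * w x = ∫ x, η x * (p x * w x) := by
    refine integral_congr_ae (Eventually.of_forall fun x => ?_)
    change (η x * p x) * w x = _
    ring
  simp only [mul_add]
  rw [integral_add i2 i3]
  rw [e1, e2] at e
  linarith

/-- A continuously differentiable function on the domain has its classical partial derivatives as
weak derivatives. -/
lemma HasWeakDeriv.of_hasFDerivAt {i : Fin 2} {g w : Plane → ℝ}
    {g' : Plane → Plane →L[ℝ] ℝ} (hg : ∀ x ∈ Ω, HasFDerivAt g (g' x) x)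
    (hw : ∀ x ∈ Ω, g' x (basisVec i) = w x) (hc : ContinuousOn w Ω) :
    HasWeakDeriv Ω (Pi.single i 1) g w := by
  have hgc : ContinuousOn g Ω := fun x hx => (hg x hx).continuousAt.continuousWithinAt
  have l1 : LocallyIntegrableOn g Ω volume :=
    hgc.locallyIntegrableOn Ω.isOpen.measurableSet
  have l2 : LocallyIntegrableOn w Ω volume :=
    hc.locallyIntegrableOn Ω.isOpen.measurableSet
  refine ⟨l1, l2, fun η => ?_⟩
  rw [testDeriv_single, sum_single_one]
  have key := integral_bilinear_hasLineDerivAt_right_eq_neg_left_of_integrable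
    (μ := (volume : Measure Plane)) (f := ⇑η) (f' := ⇑(∂_{basisVec i} η : 𝓓(Ω, ℝ)))
    (g := g) (g' := w) (v := basisVec i) (B := ContinuousLinearMap.mul ℝ ℝ)
    (TestFunction.integrable_mul l1 _) (TestFunction.integrable_mul l2 _)
    (TestFunction.integrable_mul l1 _)
    (fun x _ => by
      rw [TestFunction.lineDeriv_apply_eq_fderiv]
      exact (η.contDiff.differentiable (by simp)).differentiableAt.hasFDerivAt.hasLineDerivAt _)
    (fun x hx => by
      rw [← hw x (η.tsupport_subset hx)]
      exact (hg x (η.tsupport_subset hx)).hasLineDerivAt _)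
  simp only [ContinuousLinearMap.mul_apply'] at key
  linarith

end WeakDeriv

/-! ### The weights -/

section Weights

variable {χ : ℝ → ℝ}

lemma originWeight_le_self (hχ : IsRadialCutoff χ) (r : ℝ) :
    originWeight χ r ≤ r := by
  unfold originWeight
  rcases lt_or_ge r 1 with h | h
  · simp [hχ.eq_zero r h]
  · nlinarith [hχ.nonneg r, hχ.le_one r]

lemma originWeight_le_two (hχ : IsRadialCutoff χ) (r : ℝ) :
    originWeight χ r ≤ 2 := by
  rcases lt_or_ge 2 r with h | h
  · simp [originWeight, hχ.eq_one r h]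
  · exact (originWeight_le_self hχ r).trans h

lemma min_le_originWeight (hχ : IsRadialCutoff χ) {r : ℝ} : min r 1 ≤ originWeight χ r := by
  unfold originWeight
  rcases le_total r 1 with h | h
  · rw [min_eq_left h]; nlinarith [hχ.nonneg r, hχ.le_one r]
  · rw [min_eq_right h]; nlinarith [hχ.nonneg r, hχ.le_one r]

lemma originWeight_pos (hχ : IsRadialCutoff χ) {r : ℝ} (hr : 0 < r) : 0 < originWeight χ r :=
  (lt_min hr one_pos).trans_le (min_le_originWeight hχ)

lemma one_le_japaneseBracket (x : Plane) : 1 ≤ japaneseBracket x := by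
  unfold japaneseBracket
  rw [Real.one_le_sqrt]
  nlinarith [sq_nonneg ‖x‖]

lemma japaneseBracket_pos (x : Plane) : 0 < japaneseBracket x :=
  one_pos.trans_le (one_le_japaneseBracket x)

lemma doubleWeight_pos (hχ : IsRadialCutoff χ) (γ σ : ℝ) {x : Plane} (hx : x ≠ 0) :
    0 < doubleWeight χ γ σ x :=
  mul_pos (Real.rpow_pos_of_pos (originWeight_pos hχ (norm_pos_iff.2 hx)) _)
    (Real.rpow_pos_of_pos (japaneseBracket_pos x) _)

lemma doubleWeight_add (hχ : IsRadialCutoff χ) (γ σ τ : ℝ) {x : Plane} (hx : x ≠ 0) :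
    doubleWeight χ γ (σ + τ) x = originWeight χ ‖x‖ ^ τ * doubleWeight χ γ σ x := by
  unfold doubleWeight
  rw [Real.rpow_add (originWeight_pos hχ (norm_pos_iff.2 hx))]
  ring

lemma continuousOn_doubleWeight (hχ : IsRadialCutoff χ) (γ σ : ℝ) :
    ContinuousOn (doubleWeight χ γ σ) puncturedPlane := by
  have hc : Continuous χ := hχ.contDiff.continuous
  have h1 : Continuous fun x : Plane => originWeight χ ‖x‖ := by
    unfold originWeight; fun_prop
  have h2 : Continuous japaneseBracket := by unfold japaneseBracket; fun_prop
  refine ContinuousOn.mul ?_ ?_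
  · exact h1.continuousOn.rpow_const fun x hx =>
      Or.inl (originWeight_pos hχ (norm_pos_iff.2 hx)).ne'
  · exact h2.continuousOn.rpow_const fun x _ => Or.inl (japaneseBracket_pos x).ne'

lemma ae_ne_zero_plane : ∀ᵐ x : Plane, x ≠ 0 := by
  rw [ae_iff]; simp

lemma aestronglyMeasurable_of_continuousOn_punctured {p : Plane → ℝ}
    (hp : ContinuousOn p puncturedPlane) : AEStronglyMeasurable p volume := by
  have h := hp.aestronglyMeasurable (μ := volume) puncturedPlane.isOpen.measurableSet
  have e : (volume : Measure Plane).restrict (puncturedPlane : Set Plane) = volume :=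
    Measure.restrict_eq_self_of_ae_mem (ae_ne_zero_plane.mono fun x hx => hx)
  rwa [e] at h

lemma continuousOn_doubleWeight_inv (hχ : IsRadialCutoff χ) (γ σ : ℝ) :
    ContinuousOn (fun x => (doubleWeight χ γ σ x)⁻¹) puncturedPlane :=
  (continuousOn_doubleWeight hχ γ σ).inv₀ fun _ hx => (doubleWeight_pos hχ γ σ hx).ne'

lemma aestronglyMeasurable_of_doubleWeight_mul (hχ : IsRadialCutoff χ) {γ σ : ℝ} {v : Plane → ℝ}
    (h : AEStronglyMeasurable (fun x => doubleWeight χ γ σ x * v x) volume) :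
    AEStronglyMeasurable v volume := by
  refine ((aestronglyMeasurable_of_continuousOn_punctured
    (continuousOn_doubleWeight_inv hχ γ σ)).mul h).congr ?_
  filter_upwards [ae_ne_zero_plane] with x hx
  have := (doubleWeight_pos hχ γ σ hx).ne'
  simp only [Pi.mul_apply]
  field_simp

lemma locallyIntegrableOn_of_doubleWeight_mul (hχ : IsRadialCutoff χ) {γ σ : ℝ} {v : Plane → ℝ}
    (h : MemLp (fun x => doubleWeight χ γ σ x * v x) 2 volume) :
    LocallyIntegrableOn v puncturedPlane volume := by
  have h1 : LocallyIntegrableOn (fun x => doubleWeight χ γ σ x * v x) puncturedPlane volume :=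
    (h.locallyIntegrable (by norm_num)).locallyIntegrableOn _
  refine (h1.continuousOn_mul (continuousOn_doubleWeight_inv hχ γ σ)
    puncturedPlane.isOpen.isLocallyClosed).congr ?_
  refine ae_restrict_of_ae ?_
  filter_upwards [ae_ne_zero_plane] with x hx
  have := (doubleWeight_pos hχ γ σ hx).ne'
  field_simp

end Weights

/-! ### Homogeneous symbols -/

/-- Linear combinations of the functions `x₀ᵃ x₁ᵇ |x|^{-(a+b+k)}`, homogeneous of degree `-k`. -/
inductive IsSymbol : ℕ → (Plane → ℝ) → Prop
  | mono (a b k : ℕ) : IsSymbol k (fun x => x 0 ^ a * x 1 ^ b * ‖x‖⁻¹ ^ (a + b + k))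
  | add {k : ℕ} {p q : Plane → ℝ} : IsSymbol k p → IsSymbol k q → IsSymbol k (fun x => p x + q x)
  | smul {k : ℕ} {p : Plane → ℝ} (c : ℝ) : IsSymbol k p → IsSymbol k (fun x => c * p x)

section Symbols

lemma contDiff_coord (i : Fin 2) : ContDiff ℝ ∞ (fun x : Plane => x i) :=
  (EuclideanSpace.proj (𝕜 := ℝ) i).contDiff

lemma hasFDerivAt_norm_inv {x : Plane} (hx : x ≠ 0) :
    HasFDerivAt (fun y : Plane => ‖y‖⁻¹) (-(‖x‖⁻¹ ^ 3) • innerSL ℝ x) x := by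
  have hn : ‖x‖ ≠ 0 := norm_ne_zero_iff.2 hx
  have h1 : HasFDerivAt (fun y : Plane => ‖y‖ ^ 2) (2 • innerSL ℝ x) x :=
    (hasStrictFDerivAt_norm_sq x).hasFDerivAt
  have h2 := (h1.sqrt (pow_ne_zero 2 hn))
  have h3 : HasFDerivAt (fun y : Plane => ‖y‖) ((1 / (2 * ‖x‖)) • (2 • innerSL ℝ x)) x := by
    have e : (fun y : Plane => √(‖y‖ ^ 2)) = fun y => ‖y‖ := by
      ext y; exact Real.sqrt_sq (norm_nonneg y)
    rw [e, Real.sqrt_sq (norm_nonneg x)] at h2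
    exact h2
  have h4 := (hasDerivAt_inv hn).comp_hasFDerivAt x h3
  refine h4.congr_fderiv ?_
  ext v
  simp
  field_simp

lemma IsSymbol.contDiffOn {k : ℕ} {p : Plane → ℝ} (h : IsSymbol k p) :
    ContDiffOn ℝ ∞ p puncturedPlane := by
  induction h with
  | mono a b k =>
    intro x hx
    have hx' : x ≠ 0 := hx
    have hn : ContDiffAt ℝ ∞ (fun y : Plane => ‖y‖⁻¹) x :=
      (contDiffAt_norm ℝ hx').inv (norm_ne_zero_iff.2 hx')
    exact ((((contDiff_coord 0).contDiffAt.pow a).mul ((contDiff_coord 1).contDiffAt.pow b)).mul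
      (hn.pow (a + b + k))).contDiffWithinAt
  | add _ _ h1 h2 => exact h1.add h2
  | smul c _ h1 => exact contDiffOn_const.mul h1

lemma abs_coord_le_norm (x : Plane) (i : Fin 2) : |x i| ≤ ‖x‖ := PiLp.norm_apply_le x i

lemma IsSymbol.exists_bound {k : ℕ} {p : Plane → ℝ} (h : IsSymbol k p) :
    ∃ C, 0 ≤ C ∧ ∀ x, x ≠ 0 → |p x| ≤ C * ‖x‖⁻¹ ^ k := by
  induction h with
  | mono a b k =>
    refine ⟨1, zero_le_one, fun x hx => ?_⟩
    have hn : 0 < ‖x‖ := norm_pos_iff.2 hx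
    have h0 := abs_coord_le_norm x 0
    have h1 := abs_coord_le_norm x 1
    rw [abs_mul, abs_mul, abs_pow, abs_pow, abs_of_nonneg (a := ‖x‖⁻¹ ^ (a + b + k)) (by positivity)]
    calc |x 0| ^ a * |x 1| ^ b * ‖x‖⁻¹ ^ (a + b + k)
        ≤ ‖x‖ ^ a * ‖x‖ ^ b * ‖x‖⁻¹ ^ (a + b + k) := by gcongr
      _ = 1 * ‖x‖⁻¹ ^ k := by
        rw [pow_add, pow_add]
        simp only [inv_pow]
        field_simp
  | add _ _ h1 h2 =>
    obtain ⟨C, hC, h1⟩ := h1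
    obtain ⟨D, hD, h2⟩ := h2
    refine ⟨C + D, by positivity, fun x hx => (abs_add_le _ _).trans ?_⟩
    rw [add_mul]
    exact add_le_add (h1 x hx) (h2 x hx)
  | smul c _ h1 =>
    obtain ⟨C, hC, h1⟩ := h1
    refine ⟨|c| * C, by positivity, fun x hx => ?_⟩
    rw [abs_mul, mul_assoc]
    exact mul_le_mul_of_nonneg_left (h1 x hx) (abs_nonneg c)

lemma basisVec_apply (i j : Fin 2) : basisVec i j = if j = i then 1 else 0 := by
  simp [basisVec]

lemma inner_basisVec (x : Plane) (i : Fin 2) : inner ℝ x (basisVec i) = x i := by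
  simp [basisVec, EuclideanSpace.inner_single_right]

/-- Differentiating a monomial either lowers the exponent of a coordinate or brings down a multiple
of x_i |x|^{-2}; both results are again monomials, now of degree -(k+1). -/
lemma IsSymbol.exists_fderiv {k : ℕ} {p : Plane → ℝ} (h : IsSymbol k p) (i : Fin 2) :
    ∃ q, IsSymbol (k + 1) q ∧ ∀ x, x ≠ 0 → fderiv ℝ p x (basisVec i) = q x := by
  have hd : ∀ {k : ℕ} {p : Plane → ℝ}, IsSymbol k p → ∀ {x : Plane}, x ≠ 0 →
      DifferentiableAt ℝ p x := fun h x hx =>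
    (h.contDiffOn.contDiffAt (puncturedPlane.isOpen.mem_nhds hx)).differentiableAt (by simp)
  induction h with
  | mono a b k =>
    have hform : ∀ x : Plane, x ≠ 0 →
        fderiv ℝ (fun x : Plane => x 0 ^ a * x 1 ^ b * ‖x‖⁻¹ ^ (a + b + k)) x (basisVec i) =
        (a * x 0 ^ (a - 1) * (if (0 : Fin 2) = i then 1 else 0) * x 1 ^ b
          + x 0 ^ a * (b * x 1 ^ (b - 1) * (if (1 : Fin 2) = i then 1 else 0)))
            * ‖x‖⁻¹ ^ (a + b + k)
          - (a + b + k : ℕ) * (x 0 ^ a * x 1 ^ b * x i * ‖x‖⁻¹ ^ (a + b + k + 2)) := by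
      intro x hx
      have h0 : HasFDerivAt (fun y : Plane => y 0) (EuclideanSpace.proj (𝕜 := ℝ) (0 : Fin 2)) x :=
        (EuclideanSpace.proj (𝕜 := ℝ) (0 : Fin 2)).hasFDerivAt
      have h1 : HasFDerivAt (fun y : Plane => y 1) (EuclideanSpace.proj (𝕜 := ℝ) (1 : Fin 2)) x :=
        (EuclideanSpace.proj (𝕜 := ℝ) (1 : Fin 2)).hasFDerivAt
      have h := ((h0.pow a).mul (h1.pow b)).mul ((hasFDerivAt_norm_inv hx).pow (a + b + k))
      have e : fderiv ℝ (fun x : Plane => x 0 ^ a * x 1 ^ b * ‖x‖⁻¹ ^ (a + b + k)) x = _ := h.fderiv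
      rw [e]
      -- The power rule produces the truncated exponent `a + b + k - 1`, so the constant monomial is
      -- treated separately.
      rcases Nat.eq_zero_or_pos (a + b + k) with hN | hN
      · have ha : a = 0 := by omega
        have hb : b = 0 := by omega
        have hk : k = 0 := by omega
        subst ha hb hk
        simp
      · obtain ⟨N, hN⟩ : ∃ N, a + b + k = N + 1 := ⟨a + b + k - 1, by omega⟩
        rw [hN]
        simp [basisVec_apply, inner_basisVec]
        split_ifs <;> ring
    fin_cases i
    · refine ⟨_, ((IsSymbol.mono (a - 1) b (k + 1)).smul a).add
        ((IsSymbol.mono (a + 1) b (k + 1)).smul (-(a + b + k : ℕ))), fun x hx => ?_⟩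
      refine (hform x hx).trans ?_
      have e2 : a + 1 + b + (k + 1) = a + b + k + 2 := by ring
      -- For `a = 0` the truncated `a - 1` spoils the exponent of the norm, but that term carries
      -- the coefficient 0.
      rcases Nat.eq_zero_or_pos a with ha | ha
      · subst ha
        rw [e2]; simp; ring
      · have e1 : a - 1 + b + (k + 1) = a + b + k := by omega
        rw [e1, e2]
        simp; ring
    · refine ⟨_, ((IsSymbol.mono a (b - 1) (k + 1)).smul b).add
        ((IsSymbol.mono a (b + 1) (k + 1)).smul (-(a + b + k : ℕ))), fun x hx => ?_⟩
      refine (hform x hx).trans ?_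
      have e2 : a + (b + 1) + (k + 1) = a + b + k + 2 := by ring
      rcases Nat.eq_zero_or_pos b with hb | hb
      · subst hb
        rw [e2]; simp; ring
      · have e1 : a + (b - 1) + (k + 1) = a + b + k := by omega
        rw [e1, e2]
        simp; ring
  | @add k p q hp hq h1 h2 =>
    obtain ⟨p', hp', h1⟩ := h1
    obtain ⟨q', hq', h2⟩ := h2
    refine ⟨_, hp'.add hq', fun x hx => ?_⟩
    rw [fderiv_fun_add (hd hp hx) (hd hq hx)]
    simp [h1 x hx, h2 x hx]
  | smul c hp h1 =>
    obtain ⟨p', hp', h1⟩ := h1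
    refine ⟨_, hp'.smul c, fun x hx => ?_⟩
    rw [fderiv_const_mul (hd hp hx)]
    simp [h1 x hx]

/-- The components of `x / |x|`. -/
lemma IsSymbol.direction (i : Fin 2) : IsSymbol 0 (fun x => x i / ‖x‖) := by
  fin_cases i
  · convert IsSymbol.mono 1 0 0 using 2 with x
    simp [div_eq_mul_inv]
  · convert IsSymbol.mono 0 1 0 using 2 with x
    simp [div_eq_mul_inv]

end Symbols

/-! ### Weighted Sobolev regularity on the punctured plane -/

/-- `v` has weak derivatives up to order `n` on the punctured plane, obtained by successive
differentiation, with `m^{τ+|α|} ⟨x⟩^γ D^α v ∈ L²`. -/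
def PuncturedSobolev (χ : ℝ → ℝ) (γ : ℝ) : ℕ → ℝ → (Plane → ℝ) → Prop
  | 0, τ, v => MemLp (fun x => doubleWeight χ γ τ x * v x) 2 volume
  | n + 1, τ, v => MemLp (fun x => doubleWeight χ γ τ x * v x) 2 volume ∧
      ∀ i : Fin 2, ∃ w, HasWeakDeriv puncturedPlane (Pi.single i 1) v w ∧
        PuncturedSobolev χ γ n (τ + 1) w

namespace PuncturedSobolev

variable {χ : ℝ → ℝ} {γ τ : ℝ} {n : ℕ} {v v' : Plane → ℝ}

lemma memLp (h : PuncturedSobolev χ γ n τ v) :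
    MemLp (fun x => doubleWeight χ γ τ x * v x) 2 volume := by
  cases n with
  | zero => exact h
  | succ n => exact h.1

lemma congr (h : PuncturedSobolev χ γ n τ v) (e : v' =ᵐ[volume] v) :
    PuncturedSobolev χ γ n τ v' := by
  have hm : MemLp (fun x => doubleWeight χ γ τ x * v' x) 2 volume :=
    h.memLp.ae_eq (e.symm.mono fun x hx => by simp [hx])
  cases n with
  | zero => exact hm
  | succ n =>
    refine ⟨hm, fun i => ?_⟩
    obtain ⟨w, hw, hw'⟩ := h.2 i
    exact ⟨w, hw.congr e EventuallyEq.rfl, hw'⟩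

lemma of_succ (h : PuncturedSobolev χ γ (n + 1) τ v) : PuncturedSobolev χ γ n τ v := by
  induction n generalizing τ v with
  | zero => exact h.memLp
  | succ n ih =>
    refine ⟨h.1, fun i => ?_⟩
    obtain ⟨w, hw, hw'⟩ := h.2 i
    exact ⟨w, hw, ih hw'⟩

lemma add (h : PuncturedSobolev χ γ n τ v) (h' : PuncturedSobolev χ γ n τ v') :
    PuncturedSobolev χ γ n τ (v + v') := by
  have hm : ∀ {n : ℕ} {τ : ℝ} {v v' : Plane → ℝ}, PuncturedSobolev χ γ n τ v →
      PuncturedSobolev χ γ n τ v' →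
      MemLp (fun x => doubleWeight χ γ τ x * (v + v') x) 2 volume := fun h h' =>
    (h.memLp.add h'.memLp).ae_eq (Eventually.of_forall fun x => by simp [mul_add])
  induction n generalizing τ v v' with
  | zero => exact hm h h'
  | succ n ih =>
    refine ⟨hm h h', fun i => ?_⟩
    obtain ⟨w, hw, hs⟩ := h.2 i
    obtain ⟨w', hw', hs'⟩ := h'.2 i
    exact ⟨_, hw.add hw', ih hs hs'⟩

lemma locallyIntegrableOn (hχ : IsRadialCutoff χ) (h : PuncturedSobolev χ γ n τ v) :
    LocallyIntegrableOn v puncturedPlane volume :=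
  locallyIntegrableOn_of_doubleWeight_mul hχ h.memLp

/-- A symbol of order k is O(|x|^{-k}) and m(r) ≤ r, so the extra weight m^k absorbs it. A
derivative falls either on the symbol, raising its order by one, or on v, raising its weight by one;
both terms land in weight τ + k + 1. -/
lemma symbol_mul (hχ : IsRadialCutoff χ) {k : ℕ} {p : Plane → ℝ} (hp : IsSymbol k p)
    (h : PuncturedSobolev χ γ n τ v) :
    PuncturedSobolev χ γ n (τ + k) (fun x => p x * v x) := by
  have hm : ∀ {n k : ℕ} {τ : ℝ} {p v : Plane → ℝ}, IsSymbol k p → PuncturedSobolev χ γ n τ v →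
      MemLp (fun x => doubleWeight χ γ (τ + k) x * (p x * v x)) 2 volume := by
    intro n k τ p v hp h
    obtain ⟨C, hC, hb⟩ := hp.exists_bound
    refine h.memLp.of_le_mul (c := C) ?_ ?_
    · exact (aestronglyMeasurable_of_continuousOn_punctured
        (continuousOn_doubleWeight hχ γ (τ + k))).mul
        ((aestronglyMeasurable_of_continuousOn_punctured hp.contDiffOn.continuousOn).mul
          (aestronglyMeasurable_of_doubleWeight_mul hχ h.memLp.1))
    · filter_upwards [ae_ne_zero_plane] with x hx
      have hn : 0 < ‖x‖ := norm_pos_iff.2 hx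
      have hm0 := originWeight_pos hχ hn
      rw [doubleWeight_add hχ γ τ k hx, Real.rpow_natCast, norm_mul, norm_mul, norm_mul, norm_mul,
        Real.norm_of_nonneg (pow_pos hm0 k).le]
      have h1 : originWeight χ ‖x‖ ^ k * ‖p x‖ ≤ C := by
        calc originWeight χ ‖x‖ ^ k * ‖p x‖ ≤ ‖x‖ ^ k * (C * ‖x‖⁻¹ ^ k) := by
              gcongr
              · exact originWeight_le_self hχ _
              · exact hb x hx
          _ = C := by simp only [inv_pow]; field_simp
      calc originWeight χ ‖x‖ ^ k * ‖doubleWeight χ γ τ x‖ * (‖p x‖ * ‖v x‖)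
          = (originWeight χ ‖x‖ ^ k * ‖p x‖) * (‖doubleWeight χ γ τ x‖ * ‖v x‖) := by ring
        _ ≤ C * (‖doubleWeight χ γ τ x‖ * ‖v x‖) := by gcongr
  induction n generalizing τ v k p with
  | zero => exact hm hp h
  | succ n ih =>
    refine ⟨hm hp h, fun i => ?_⟩
    obtain ⟨w, hw, hs⟩ := h.2 i
    obtain ⟨q, hq, hqe⟩ := hp.exists_fderiv i
    refine ⟨_, hw.mul_contDiffOn hp.contDiffOn, ?_⟩
    have h1 := ih hq h.of_succ
    have h2 := ih hp hs
    have e : τ + 1 + (k : ℝ) = τ + k + 1 := by ring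
    have e' : τ + ((k + 1 : ℕ) : ℝ) = τ + k + 1 := by push_cast; ring
    rw [e] at h2
    rw [e'] at h1
    refine (h1.add h2).congr ?_
    filter_upwards [ae_ne_zero_plane] with x hx
    simp [hqe x hx]

lemma of_family {D : (Fin 2 → ℕ) → Plane → ℝ}
    (hD : ∀ α : Fin 2 → ℕ, ∑ i, α i ≤ n → HasWeakDeriv puncturedPlane α v (D α))
    (hm : ∀ α : Fin 2 → ℕ, ∑ i, α i ≤ n →
      MemLp (fun x => doubleWeight χ γ (τ + (∑ i, α i : ℕ)) x * D α x) 2 volume)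
    (h0 : D 0 =ᵐ[volume] v) : PuncturedSobolev χ γ n τ v := by
  have hbase : ∀ {n : ℕ} {τ : ℝ} {v : Plane → ℝ} {D : (Fin 2 → ℕ) → Plane → ℝ},
      (∀ α : Fin 2 → ℕ, ∑ i, α i ≤ n →
        MemLp (fun x => doubleWeight χ γ (τ + (∑ i, α i : ℕ)) x * D α x) 2 volume) →
      D 0 =ᵐ[volume] v → MemLp (fun x => doubleWeight χ γ τ x * v x) 2 volume := by
    intro n τ v D hm h0
    refine (hm 0 (by simp)).ae_eq ?_
    filter_upwards [h0] with x hx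
    simp [hx]
  induction n generalizing τ v D with
  | zero => exact hbase hm h0
  | succ n ih =>
    refine ⟨hbase hm h0, fun i => ⟨D (Pi.single i 1), hD _ (by rw [sum_single_one]; omega), ?_⟩⟩
    -- The shifted family consists of the derivatives of the first-order derivative of v in
    -- direction i.
    refine ih (D := fun β => D (Pi.single i 1 + β)) (fun β hβ => ?_) (fun β hβ => ?_)
      (by simp)
    · have hs : ∑ j, (Pi.single i 1 + β : Fin 2 → ℕ) j ≤ n + 1 := by
        simp only [Pi.add_apply, Finset.sum_add_distrib, sum_single_one]; omega
      exact (hD _ (by rw [sum_single_one]; omega)).of_add (hD _ hs)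
    · have hs : ∑ j, (Pi.single i 1 + β : Fin 2 → ℕ) j = 1 + ∑ j, β j := by
        simp only [Pi.add_apply, Finset.sum_add_distrib, sum_single_one]
      have := hm (Pi.single i 1 + β) (by rw [hs]; omega)
      rw [hs] at this
      have e : τ + ((1 + ∑ j, β j : ℕ) : ℝ) = τ + 1 + (∑ j, β j : ℕ) := by push_cast; ring
      rwa [e] at this

lemma exists_weakDeriv (hχ : IsRadialCutoff χ) (h : PuncturedSobolev χ γ n τ v)
    (α : Fin 2 → ℕ) (hα : ∑ i, α i ≤ n) :
    ∃ w, HasWeakDeriv puncturedPlane α v w ∧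
      MemLp (fun x => doubleWeight χ γ (τ + (∑ i, α i : ℕ)) x * w x) 2 volume := by
  by_cases h0 : α = 0
  · subst h0
    exact ⟨v, HasWeakDeriv.refl (h.locallyIntegrableOn hχ), by simpa using h.memLp⟩
  induction n generalizing τ v α with
  | zero =>
    refine absurd (funext fun i => ?_) h0
    exact Finset.sum_eq_zero_iff.1 (Nat.le_zero.1 hα) i (Finset.mem_univ i)
  | succ n ih =>
    obtain ⟨i, hi⟩ : ∃ i, α i ≠ 0 := Function.ne_iff.1 h0
    obtain ⟨β, rfl⟩ : ∃ β : Fin 2 → ℕ, α = Pi.single i 1 + β := by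
      refine ⟨α - Pi.single i 1, funext fun j => ?_⟩
      by_cases hj : j = i
      · subst hj; simp; omega
      · simp [hj]
    obtain ⟨w, hw, hs⟩ := h.2 i
    have hsum : ∑ j, (Pi.single i 1 + β : Fin 2 → ℕ) j = 1 + ∑ j, β j := by
      simp only [Pi.add_apply, Finset.sum_add_distrib, sum_single_one]
    have e : τ + ((1 + ∑ j, β j : ℕ) : ℝ) = τ + 1 + (∑ j, β j : ℕ) := by push_cast; ring
    rw [hsum] at hα
    rw [hsum, e]
    by_cases hβ : β = 0
    · subst hβ
      refine ⟨w, by simpa using hw, by simpa using hs.memLp⟩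
    · obtain ⟨w', hw', hm'⟩ := ih hs β (by omega) hβ
      exact ⟨w', hw.trans hw', hm'⟩

end PuncturedSobolev

/-- Unweighted derivatives near the origin suffice for the weights `m^{|α|}`. -/
lemma MemWeightedSobolev.puncturedSobolev {χ : ℝ → ℝ} (hχ : IsRadialCutoff χ) {k : ℕ} {γ : ℝ}
    {f : Plane → ℝ} (h : MemWeightedSobolev k γ f) : PuncturedSobolev χ γ k 0 f := by
  choose! D hD hm using h
  have hlo : ∀ α : Fin 2 → ℕ, ∑ i, α i ≤ k → HasWeakDeriv puncturedPlane α f (D α) :=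
    fun α hα => (hD α hα).mono le_top
  refine PuncturedSobolev.of_family hlo (fun α hα => ?_) ?_
  · refine (hm α hα).of_le_mul (c := 2 ^ (∑ i, α i)) ?_ ?_
    · refine (aestronglyMeasurable_of_continuousOn_punctured
        (continuousOn_doubleWeight hχ γ _)).mul ?_
      have := (hlo α hα).right.aestronglyMeasurable
      have e : (volume : Measure Plane).restrict (puncturedPlane : Set Plane) = volume :=
        Measure.restrict_eq_self_of_ae_mem (ae_ne_zero_plane.mono fun x hx => hx)
      rwa [e] at this
    · filter_upwards [ae_ne_zero_plane] with x hx
      have hm0 := originWeight_pos hχ (norm_pos_iff.2 hx)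
      rw [doubleWeight, zero_add, Real.rpow_natCast, norm_mul, norm_mul, norm_mul, mul_assoc,
        Real.norm_of_nonneg (pow_pos hm0 _).le]
      gcongr
      exact originWeight_le_two hχ _
  · have := HasWeakDeriv.unique (hlo 0 (by simp)) (HasWeakDeriv.refl (hlo 0 (by simp)).left)
    filter_upwards [this, ae_ne_zero_plane] with x hx hx0 using hx hx0

/-! ### Primitives on the half-line -/

/-- `g` is a primitive of the locally integrable function `h` on `(0, ∞)`. -/
structure IsPrimitive (g h : ℝ → ℝ) : Prop where
  locallyIntegrableOn : LocallyIntegrableOn h (Set.Ioi 0) volume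
  sub_eq : ∀ a b : ℝ, 0 < a → 0 < b → g b - g a = ∫ t in a..b, h t

lemma uIcc_subset_Ioi {a b : ℝ} (ha : 0 < a) (hb : 0 < b) : Set.uIcc a b ⊆ Set.Ioi 0 :=
  fun _ hx => (lt_min ha hb).trans_le hx.1

lemma LocallyIntegrableOn.intervalIntegrable_Ioi {h : ℝ → ℝ}
    (hl : LocallyIntegrableOn h (Set.Ioi 0) volume) {a b : ℝ} (ha : 0 < a) (hb : 0 < b) :
    IntervalIntegrable h volume a b :=
  (hl.integrableOn_compact_subset (uIcc_subset_Ioi ha hb) isCompact_uIcc).intervalIntegrable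

namespace IsPrimitive

variable {g h g' h' : ℝ → ℝ}

lemma intervalIntegrable (hg : IsPrimitive g h) {a b : ℝ} (ha : 0 < a) (hb : 0 < b) :
    IntervalIntegrable h volume a b :=
  LocallyIntegrableOn.intervalIntegrable_Ioi hg.locallyIntegrableOn ha hb

lemma continuousOn (hg : IsPrimitive g h) : ContinuousOn g (Set.Ioi 0) := by
  intro x hx
  have hx : 0 < x := hx
  have hc : ContinuousOn (fun y => ∫ t in (x / 2)..y, h t) (Set.uIcc (x / 2) (2 * x)) :=
    intervalIntegral.continuousOn_primitive_interval'
      (hg.intervalIntegrable (by positivity) (by positivity)) Set.left_mem_uIcc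
  have hmem : Set.uIcc (x / 2) (2 * x) ∈ 𝓝 x := by
    rw [Set.uIcc_of_le (by linarith)]
    exact Icc_mem_nhds (by linarith) (by linarith)
  have h1 : ContinuousAt (fun y => g (x / 2) + ∫ t in (x / 2)..y, h t) x :=
    continuousAt_const.add (hc.continuousAt hmem)
  refine (h1.congr ?_).continuousWithinAt
  filter_upwards [lt_mem_nhds hx] with y hy
  rw [← hg.sub_eq (x / 2) y (by positivity) hy]
  ring

lemma add (hg : IsPrimitive g h) (hg' : IsPrimitive g' h') :
    IsPrimitive (fun r => g r + g' r) (fun r => h r + h' r) := by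
  refine ⟨hg.locallyIntegrableOn.add hg'.locallyIntegrableOn, fun a b ha hb => ?_⟩
  rw [intervalIntegral.integral_add (hg.intervalIntegrable ha hb) (hg'.intervalIntegrable ha hb),
    ← hg.sub_eq a b ha hb, ← hg'.sub_eq a b ha hb]
  ring

lemma const_mul (c : ℝ) (hg : IsPrimitive g h) :
    IsPrimitive (fun r => c * g r) (fun r => c * h r) := by
  refine ⟨hg.locallyIntegrableOn.smul c, fun a b ha hb => ?_⟩
  rw [intervalIntegral.integral_const_mul, ← hg.sub_eq a b ha hb]
  ring

lemma congr (hg : IsPrimitive g h) (eg : Set.EqOn g' g (Set.Ioi 0))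
    (eh : h' =ᵐ[volume.restrict (Set.Ioi 0)] h) : IsPrimitive g' h' := by
  refine ⟨hg.locallyIntegrableOn.congr eh.symm, fun a b ha hb => ?_⟩
  rw [eg ha, eg hb, hg.sub_eq a b ha hb]
  refine intervalIntegral.integral_congr_ae ?_
  have := (ae_restrict_iff' measurableSet_Ioi).1 eh
  filter_upwards [this] with x hx hxab
  exact (hx (uIcc_subset_Ioi ha hb (Set.uIoc_subset_uIcc hxab))).symm

lemma of_hasDerivAt (hd : ∀ r, 0 < r → HasDerivAt g (h r) r)
    (hl : LocallyIntegrableOn h (Set.Ioi 0) volume) : IsPrimitive g h := by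
  refine ⟨hl, fun a b ha hb => ?_⟩
  exact (intervalIntegral.integral_eq_sub_of_hasDerivAt
    (fun x hx => hd x (uIcc_subset_Ioi ha hb hx))
    (LocallyIntegrableOn.intervalIntegrable_Ioi hl ha hb)).symm

lemma of_locallyIntegrableOn (c : ℝ) (hl : LocallyIntegrableOn h (Set.Ioi 0) volume) :
    IsPrimitive (fun r => c + ∫ t in (1 : ℝ)..r, h t) h := by
  refine ⟨hl, fun a b ha hb => ?_⟩
  rw [← intervalIntegral.integral_interval_sub_left
    (LocallyIntegrableOn.intervalIntegrable_Ioi hl one_pos hb)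
    (LocallyIntegrableOn.intervalIntegrable_Ioi hl one_pos ha)]
  ring

/-- The derivatives are only locally integrable, so this is integration by parts for absolutely
continuous functions. It is applied to the indefinite integrals based at a, which agree with the two
primitives on the interval. -/
lemma mul (hg : IsPrimitive g h) (hg' : IsPrimitive g' h') :
    IsPrimitive (fun r => g r * g' r) (fun r => h r * g' r + g r * h' r) := by
  have hlc : IsLocallyClosed (Set.Ioi (0 : ℝ)) := isOpen_Ioi.isLocallyClosed
  refine ⟨(hg.locallyIntegrableOn.mul_continuousOn hg'.continuousOn hlc).add
    (hg'.locallyIntegrableOn.continuousOn_mul hg.continuousOn hlc), fun a b ha hb => ?_⟩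
  have aux : ∀ {g h : ℝ → ℝ}, IsPrimitive g h →
      AbsolutelyContinuousOnInterval ((fun _ => g a) + fun x => ∫ t in a..x, h t) a b ∧
      (∀ᵐ x, x ∈ Set.uIcc a b →
        deriv ((fun _ => g a) + fun x => ∫ t in a..x, h t) x = h x) ∧
      ∀ x ∈ Set.uIcc a b, ((fun _ => g a) + fun x => ∫ t in a..x, h t : ℝ → ℝ) x = g x := by
    intro g h hg
    have hi := hg.intervalIntegrable ha hb
    refine ⟨?_, ?_, fun x hx => ?_⟩
    · exact (contDiffOn_const.absolutelyContinuousOnInterval).add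
        (hi.absolutelyContinuousOnInterval_intervalIntegral Set.left_mem_uIcc)
    · filter_upwards [hi.ae_hasDerivAt_integral] with x hx hxm
      have := ((hasDerivAt_const x (g a)).add (hx hxm a Set.left_mem_uIcc)).deriv
      rwa [zero_add] at this
    · have := hg.sub_eq a x ha (uIcc_subset_Ioi ha hb hx)
      simp only [Pi.add_apply]
      linarith
  obtain ⟨h1, h2, h3⟩ := aux hg
  obtain ⟨h1', h2', h3'⟩ := aux hg'
  have key := AbsolutelyContinuousOnInterval.integral_deriv_mul_eq_sub h1 h1'
  rw [h3 b Set.right_mem_uIcc, h3' b Set.right_mem_uIcc, h3 a Set.left_mem_uIcc,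
    h3' a Set.left_mem_uIcc] at key
  rw [← key]
  refine intervalIntegral.integral_congr_ae ?_
  filter_upwards [h2, h2'] with x hx hx' hxm
  have hxm := Set.uIoc_subset_uIcc hxm
  rw [hx hxm, hx' hxm, h3 x hxm, h3' x hxm]

lemma inv_pow (k : ℕ) :
    IsPrimitive (fun r => r⁻¹ ^ k) (fun r => -(k : ℝ) * r⁻¹ ^ (k + 1)) := by
  refine of_hasDerivAt (fun r hr => ?_) (ContinuousOn.locallyIntegrableOn ?_ measurableSet_Ioi)
  · refine ((hasDerivAt_inv hr.ne').pow k).congr_deriv ?_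
    rcases Nat.eq_zero_or_pos k with hk | hk
    · simp [hk]
    · obtain ⟨j, rfl⟩ : ∃ j, k = j + 1 := ⟨k - 1, by omega⟩
      simp only [Nat.add_sub_cancel, _root_.inv_pow]
      field_simp
      ring
  · refine continuousOn_const.mul (ContinuousOn.pow ?_ _)
    exact continuousOn_id.inv₀ fun x hx => ne_of_gt hx

lemma rpow (p : ℝ) : IsPrimitive (fun r => r ^ p) (fun r => p * r ^ (p - 1)) := by
  refine of_hasDerivAt (fun r hr => ?_) (ContinuousOn.locallyIntegrableOn ?_ measurableSet_Ioi)
  · exact Real.hasDerivAt_rpow_const (Or.inl hr.ne')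
  · exact continuousOn_const.mul
      (continuousOn_id.rpow_const fun x hx => Or.inl (ne_of_gt hx))

end IsPrimitive

/-! ### Weighted square integrability of radial profiles -/

/-- The profile `g` is square integrable on `(0, 1]` with weight `r^{2τ} r dr` and on `(1, ∞)` with
weight `r^{2γ} r dr`. -/
def MemRadialL2 (γ τ : ℝ) (g : ℝ → ℝ) : Prop :=
  MemLp (fun r => r ^ (τ + 1 / 2) * g r) 2 (volume.restrict (Set.Ioc 0 1)) ∧
    MemLp (fun r => r ^ (γ + 1 / 2) * g r) 2 (volume.restrict (Set.Ioi 1))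

lemma aestronglyMeasurable_rpow (p : ℝ) (μ : Measure ℝ) :
    AEStronglyMeasurable (fun r : ℝ => r ^ p) μ :=
  (measurable_id.pow_const p).aestronglyMeasurable

lemma aestronglyMeasurable_of_rpow_mul {p : ℝ} {g : ℝ → ℝ} {s : Set ℝ} (hs : MeasurableSet s)
    (h0 : s ⊆ Set.Ioi 0)
    (h : AEStronglyMeasurable (fun r => r ^ p * g r) (volume.restrict s)) :
    AEStronglyMeasurable g (volume.restrict s) := by
  refine ((aestronglyMeasurable_rpow (-p) _).mul h).congr ?_
  filter_upwards [ae_restrict_mem hs] with r hr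
  have hr : 0 < r := h0 hr
  simp only [Pi.mul_apply]
  rw [← mul_assoc, ← Real.rpow_add hr]
  simp

namespace MemRadialL2

variable {γ γ' τ σ : ℝ} {g g' h : ℝ → ℝ}

lemma aesm_near (hg : MemRadialL2 γ τ g) :
    AEStronglyMeasurable g (volume.restrict (Set.Ioc 0 1)) :=
  aestronglyMeasurable_of_rpow_mul measurableSet_Ioc (fun _ h => h.1) hg.1.1

lemma aesm_far (hg : MemRadialL2 γ τ g) :
    AEStronglyMeasurable g (volume.restrict (Set.Ioi 1)) :=
  aestronglyMeasurable_of_rpow_mul measurableSet_Ioi (Set.Ioi_subset_Ioi zero_le_one) hg.2.1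

lemma congr_ae (hg : MemRadialL2 γ τ g) (e : g' =ᵐ[volume.restrict (Set.Ioi 0)] g) :
    MemRadialL2 γ τ g' := by
  have e1 : g' =ᵐ[volume.restrict (Set.Ioc 0 1)] g :=
    ae_restrict_of_ae_restrict_of_subset Set.Ioc_subset_Ioi_self e
  have e2 : g' =ᵐ[volume.restrict (Set.Ioi 1)] g :=
    ae_restrict_of_ae_restrict_of_subset (Set.Ioi_subset_Ioi zero_le_one) e
  exact ⟨hg.1.ae_eq (e1.symm.mono fun x hx => by simp [hx]),
    hg.2.ae_eq (e2.symm.mono fun x hx => by simp [hx])⟩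

lemma add (hg : MemRadialL2 γ τ g) (hg' : MemRadialL2 γ τ g') :
    MemRadialL2 γ τ (fun r => g r + g' r) :=
  ⟨(hg.1.add hg'.1).ae_eq (Eventually.of_forall fun x => by simp [mul_add]),
    (hg.2.add hg'.2).ae_eq (Eventually.of_forall fun x => by simp [mul_add])⟩

/-- Multiplication by a function of size `O(r^{-q})` near the origin and bounded far away. -/
lemma mul_of_bound (hg : MemRadialL2 γ τ g) {C q : ℝ}
    (hm : AEStronglyMeasurable h (volume.restrict (Set.Ioi 0)))
    (h1 : ∀ r, 0 < r → r ≤ 1 → r ^ q * |h r| ≤ C) (h2 : ∀ r, 1 < r → |h r| ≤ C) :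
    MemRadialL2 γ (τ + q) (fun r => h r * g r) := by
  have m1 : AEStronglyMeasurable h (volume.restrict (Set.Ioc 0 1)) :=
    hm.mono_measure (Measure.restrict_mono Set.Ioc_subset_Ioi_self le_rfl)
  have m2 : AEStronglyMeasurable h (volume.restrict (Set.Ioi 1)) :=
    hm.mono_measure (Measure.restrict_mono (Set.Ioi_subset_Ioi zero_le_one) le_rfl)
  constructor
  · refine hg.1.of_le_mul (c := C) ((aestronglyMeasurable_rpow _ _).mul (m1.mul hg.aesm_near)) ?_
    filter_upwards [ae_restrict_mem measurableSet_Ioc] with r hr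
    have hr0 : 0 < r := hr.1
    have e : τ + q + 1 / 2 = q + (τ + 1 / 2) := by ring
    rw [e, Real.rpow_add hr0, norm_mul, norm_mul, norm_mul, norm_mul,
      Real.norm_of_nonneg (Real.rpow_nonneg hr0.le q)]
    calc r ^ q * ‖r ^ (τ + 1 / 2)‖ * (‖h r‖ * ‖g r‖)
        = (r ^ q * |h r|) * (‖r ^ (τ + 1 / 2)‖ * ‖g r‖) := by rw [Real.norm_eq_abs (h r)]; ring
      _ ≤ C * (‖r ^ (τ + 1 / 2)‖ * ‖g r‖) := by gcongr; exact h1 r hr.1 hr.2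
  · refine hg.2.of_le_mul (c := C) ((aestronglyMeasurable_rpow _ _).mul (m2.mul hg.aesm_far)) ?_
    filter_upwards [ae_restrict_mem measurableSet_Ioi] with r hr
    rw [norm_mul, norm_mul, norm_mul]
    calc ‖r ^ (γ + 1 / 2)‖ * (‖h r‖ * ‖g r‖)
        = |h r| * (‖r ^ (γ + 1 / 2)‖ * ‖g r‖) := by rw [Real.norm_eq_abs (h r)]; ring
      _ ≤ C * (‖r ^ (γ + 1 / 2)‖ * ‖g r‖) := by gcongr; exact h2 r hr

lemma weight_succ (hg : MemRadialL2 γ τ g) : MemRadialL2 γ (τ + 1) g := by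
  have := hg.mul_of_bound (h := fun _ => 1) (C := 1) (q := 1) aestronglyMeasurable_const
    (fun r hr hr1 => by simpa using hr1) (fun r hr => by simp)
  simpa using this

lemma const_mul (c : ℝ) (hg : MemRadialL2 γ τ g) : MemRadialL2 γ τ (fun r => c * g r) := by
  have := hg.mul_of_bound (h := fun _ => c) (C := |c|) (q := 0) aestronglyMeasurable_const
    (fun r hr hr1 => by simp) (fun r hr => le_rfl)
  simpa using this

lemma inv_pow_mul (k : ℕ) (hg : MemRadialL2 γ τ g) :
    MemRadialL2 γ (τ + k) (fun r => r⁻¹ ^ k * g r) := by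
  refine hg.mul_of_bound (C := 1) (q := k) ?_ (fun r hr hr1 => ?_) (fun r hr => ?_)
  · exact (measurable_id.inv.pow_const k).aestronglyMeasurable
  · rw [Real.rpow_natCast, abs_of_nonneg (by positivity), inv_pow,
      mul_inv_cancel₀ (by positivity)]
  · rw [abs_of_nonneg (by positivity)]
    exact pow_le_one₀ (by positivity) (inv_le_one_of_one_le₀ hr.le)

/-- Pointwise bounds from one weighted derivative. -/
lemma exists_bound (hg : MemRadialL2 γ τ g) (hp : IsPrimitive g h)
    (hh : MemRadialL2 γ (τ + 1) h) :
    ∃ C, (∀ r, 0 < r → r ≤ 1 → r ^ (τ + 1) * |g r| ≤ C) ∧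
      ∀ r, 1 < r → r ^ (γ + 1 / 2) * |g r| ≤ C := by
  -- The derivative of r^{2p} g² is 2p r^{2p-1} g² + 2 r^{2p} g h. If both terms are integrable on
  -- s, then integrating from 1 bounds r^{2p} g². Near the origin p = τ + 1 matches the weights
  -- exactly; far away p = γ + 1/2, and there r^{2γ} ≤ r^{2γ+1} leaves room in the first term.
  have main : ∀ (p : ℝ) (s : Set ℝ), MeasurableSet s → s ⊆ Set.Ioi 0 →
      (∀ r ∈ s, Set.uIoc 1 r ⊆ s) →
      IntegrableOn (fun r => r ^ (2 * p - 1) * g r ^ 2) s →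
      IntegrableOn (fun r => r ^ (2 * p) * (g r * h r)) s →
      ∃ C, ∀ r ∈ s, r ^ p * |g r| ≤ C := by
    intro p s hs h0 hsub i1 i2
    have P := (IsPrimitive.rpow (2 * p)).mul (hp.mul hp)
    have I : IntegrableOn (fun r => 2 * p * r ^ (2 * p - 1) * (g r * g r) +
        r ^ (2 * p) * (h r * g r + g r * h r)) s := by
      refine ((i1.const_mul (2 * p)).add (i2.const_mul 2)).congr
        (Eventually.of_forall fun r => ?_)
      simp only [Pi.add_apply]
      ring
    set F := fun r => 2 * p * r ^ (2 * p - 1) * (g r * g r) +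
        r ^ (2 * p) * (h r * g r + g r * h r) with hF
    set M := |g 1 * g 1| + ∫ r in s, ‖F r‖ with hM
    refine ⟨√M, fun r hr => ?_⟩
    have hr0 : 0 < r := h0 hr
    have e := P.sub_eq 1 r one_pos hr0
    have b1 : |∫ t in (1 : ℝ)..r, F t| ≤ ∫ t in s, ‖F t‖ := by
      rw [← Real.norm_eq_abs]
      refine intervalIntegral.norm_integral_le_integral_norm_uIoc.trans ?_
      exact setIntegral_mono_set I.norm (Eventually.of_forall fun _ => norm_nonneg _)
        (hsub r hr).eventuallyLE
    have b2 : r ^ (2 * p) * (g r * g r) ≤ M := by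
      have e1 : r ^ (2 * p) * (g r * g r) = g 1 * g 1 + ∫ t in (1 : ℝ)..r, F t := by
        rw [hF, ← e]; simp
      rw [e1]
      exact add_le_add (le_abs_self _) ((le_abs_self _).trans b1)
    refine Real.le_sqrt_of_sq_le ?_
    refine le_trans (le_of_eq ?_) b2
    rw [mul_pow, sq_abs, two_mul, Real.rpow_add hr0]
    ring
  have i1 := hg.1.integrable_sq
  have i2 := hg.1.integrable_mul hh.1
  have j1 := hg.2.integrable_sq
  have j2 := hg.2.integrable_mul hh.2
  obtain ⟨C, hC⟩ := main (τ + 1) (Set.Ioc 0 1) measurableSet_Ioc (fun _ h => h.1)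
    (fun r hr t ht => by
      rw [Set.uIoc_of_ge hr.2] at ht
      exact ⟨hr.1.trans ht.1, ht.2⟩)
    (i1.congr (by
      filter_upwards [ae_restrict_mem measurableSet_Ioc] with r hr
      rw [mul_pow, sq (r ^ (τ + 1 / 2)), ← Real.rpow_add hr.1]
      ring_nf))
    (i2.congr (by
      filter_upwards [ae_restrict_mem measurableSet_Ioc] with r hr
      have e : 2 * (τ + 1) = (τ + 1 / 2) + (τ + 1 + 1 / 2) := by ring
      simp only [Pi.mul_apply]
      rw [e, Real.rpow_add hr.1 (τ + 1 / 2) (τ + 1 + 1 / 2)]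
      ring))
  obtain ⟨D, hD⟩ := main (γ + 1 / 2) (Set.Ioi 1) measurableSet_Ioi (Set.Ioi_subset_Ioi zero_le_one)
    (fun r hr t ht => by
      rw [Set.uIoc_of_le (le_of_lt hr)] at ht
      exact ht.1)
    (j1.mono' ((aestronglyMeasurable_rpow _ _).mul (hg.aesm_far.pow 2)) (by
      filter_upwards [ae_restrict_mem measurableSet_Ioi] with r hr
      have hr1 : 1 < r := hr
      have hr0 : 0 < r := one_pos.trans hr1
      rw [mul_pow, sq (r ^ (γ + 1 / 2)), ← Real.rpow_add hr0,
        Real.norm_of_nonneg (mul_nonneg (Real.rpow_nonneg hr0.le _) (sq_nonneg _))]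
      refine mul_le_mul_of_nonneg_right ?_ (sq_nonneg _)
      exact Real.rpow_le_rpow_of_exponent_le hr1.le (by linarith)))
    (j2.congr (by
      filter_upwards [ae_restrict_mem measurableSet_Ioi] with r hr
      have hr0 : 0 < r := one_pos.trans hr
      simp only [Pi.mul_apply]
      rw [two_mul, Real.rpow_add hr0 (γ + 1 / 2) (γ + 1 / 2)]
      ring))
  exact ⟨max C D, fun r h1 h2 => (hC r ⟨h1, h2⟩).trans (le_max_left _ _),
    fun r h1 => (hD r h1).trans (le_max_right _ _)⟩

end MemRadialL2

/-! ### Weighted regularity of radial profiles -/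

/-- The profile `g` has `n` derivatives `g^{(j)}` on `(0, ∞)`, each `g^{(j)}` being weighted square
integrable with weights `τ + j` at the origin and `γ` at infinity. -/
def RadialReg (γ : ℝ) : ℕ → ℝ → (ℝ → ℝ) → Prop
  | 0, τ, g => MemRadialL2 γ τ g
  | n + 1, τ, g => MemRadialL2 γ τ g ∧ ∃ h, IsPrimitive g h ∧ RadialReg γ n (τ + 1) h

namespace RadialReg

variable {γ γ' τ σ : ℝ} {n : ℕ} {g g' h : ℝ → ℝ}

lemma memRadialL2 (hg : RadialReg γ n τ g) : MemRadialL2 γ τ g := by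
  cases n with
  | zero => exact hg
  | succ n => exact hg.1

lemma of_succ (hg : RadialReg γ (n + 1) τ g) : RadialReg γ n τ g := by
  induction n generalizing τ g with
  | zero => exact hg.memRadialL2
  | succ n ih =>
    obtain ⟨h0, h, hp, hr⟩ := hg
    exact ⟨h0, h, hp, ih hr⟩

lemma of_le {k : ℕ} (hg : RadialReg γ k τ g) (hnk : n ≤ k) : RadialReg γ n τ g := by
  induction k, hnk using Nat.le_induction with
  | base => exact hg
  | succ k _ ih => exact ih hg.of_succ

lemma weight_succ (hg : RadialReg γ n τ g) : RadialReg γ n (τ + 1) g := by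
  induction n generalizing τ g with
  | zero => exact MemRadialL2.weight_succ hg
  | succ n ih =>
    obtain ⟨h0, h, hp, hr⟩ := hg
    exact ⟨h0.weight_succ, h, hp, ih hr⟩

lemma add (hg : RadialReg γ n τ g) (hg' : RadialReg γ n τ g') :
    RadialReg γ n τ (fun r => g r + g' r) := by
  induction n generalizing τ g g' with
  | zero => exact MemRadialL2.add hg hg'
  | succ n ih =>
    obtain ⟨h0, h, hp, hr⟩ := hg
    obtain ⟨h0', h', hp', hr'⟩ := hg'
    exact ⟨h0.add h0', _, hp.add hp', ih hr hr'⟩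

lemma const_mul (c : ℝ) (hg : RadialReg γ n τ g) : RadialReg γ n τ (fun r => c * g r) := by
  induction n generalizing τ g with
  | zero => exact MemRadialL2.const_mul c hg
  | succ n ih =>
    obtain ⟨h0, h, hp, hr⟩ := hg
    exact ⟨h0.const_mul c, _, hp.const_mul c, ih hr⟩

lemma congr (hg : RadialReg γ n τ g) (e : Set.EqOn g' g (Set.Ioi 0)) : RadialReg γ n τ g' := by
  have e' : g' =ᵐ[volume.restrict (Set.Ioi 0)] g := by
    filter_upwards [ae_restrict_mem measurableSet_Ioi] with r hr using e hr
  cases n with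
  | zero => exact MemRadialL2.congr_ae hg e'
  | succ n =>
    obtain ⟨h0, h, hp, hr⟩ := hg
    exact ⟨h0.congr_ae e', h, hp.congr e EventuallyEq.rfl, hr⟩

lemma inv_pow_mul (k : ℕ) (hg : RadialReg γ n τ g) :
    RadialReg γ n (τ + k) (fun r => r⁻¹ ^ k * g r) := by
  induction n generalizing τ g k with
  | zero => exact MemRadialL2.inv_pow_mul k hg
  | succ n ih =>
    have hg0 := hg.of_succ
    obtain ⟨h0, h, hp, hr⟩ := hg
    refine ⟨h0.inv_pow_mul k, _, (IsPrimitive.inv_pow k).mul hp, ?_⟩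
    have h1 := (ih (k + 1) hg0).const_mul (-(k : ℝ))
    have h2 := ih k hr
    have e1 : τ + ((k + 1 : ℕ) : ℝ) = τ + k + 1 := by push_cast; ring
    have e2 : τ + 1 + (k : ℝ) = τ + k + 1 := by ring
    rw [e1] at h1
    rw [e2] at h2
    exact (h1.add h2).congr fun r _ => by ring

/-- The pointwise bound r^{τ+1} |g| ≤ C costs one power of r at the origin. At infinity r^{γ'+1/2}
|g| ≤ C, and γ' ≥ -1/2 turns this into boundedness, so no decay of the other factor is used up. -/
lemma memRadialL2_mul_of_left (hγ : -(1 / 2) ≤ γ') (hg : RadialReg γ' 1 τ g)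
    (hg' : MemRadialL2 γ σ g') : MemRadialL2 γ (σ + τ + 1) (fun r => g r * g' r) := by
  obtain ⟨h0, h, hp, hr⟩ := hg
  obtain ⟨C, h1, h2⟩ := h0.exists_bound hp hr
  have e : σ + τ + 1 = σ + (τ + 1) := by ring
  rw [e]
  refine hg'.mul_of_bound (C := C) ?_ h1 (fun r hr => ?_)
  · exact hp.continuousOn.aestronglyMeasurable measurableSet_Ioi
  · refine le_trans ?_ (h2 r hr)
    exact le_mul_of_one_le_left (abs_nonneg _) (Real.one_le_rpow hr.le (by linarith))

/-- Here the pointwise bound is on the second factor and consumes its whole weight γ at infinity;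
the first factor is then needed only in L²(dr), which γ' ≥ -1/2 guarantees. -/
lemma memRadialL2_mul_of_right (hγ : -(1 / 2) ≤ γ') (hg : MemRadialL2 γ' τ g)
    (hg' : RadialReg γ 1 σ g') : MemRadialL2 γ (σ + τ + 1) (fun r => g r * g' r) := by
  obtain ⟨h0, h, hp, hr⟩ := hg'
  obtain ⟨C, h1, h2⟩ := h0.exists_bound hp hr
  have hm := hp.continuousOn.aestronglyMeasurable (μ := volume) measurableSet_Ioi
  have m1 : AEStronglyMeasurable g' (volume.restrict (Set.Ioc 0 1)) :=
    hm.mono_measure (Measure.restrict_mono Set.Ioc_subset_Ioi_self le_rfl)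
  have m2 : AEStronglyMeasurable g' (volume.restrict (Set.Ioi 1)) :=
    hm.mono_measure (Measure.restrict_mono (Set.Ioi_subset_Ioi zero_le_one) le_rfl)
  constructor
  · refine hg.1.of_le_mul (c := C) ((aestronglyMeasurable_rpow _ _).mul (hg.aesm_near.mul m1)) ?_
    filter_upwards [ae_restrict_mem measurableSet_Ioc] with r hr
    have hr0 : 0 < r := hr.1
    have e : σ + τ + 1 + 1 / 2 = (σ + 1) + (τ + 1 / 2) := by ring
    rw [e, Real.rpow_add hr0, norm_mul, norm_mul, norm_mul, norm_mul,
      Real.norm_of_nonneg (Real.rpow_nonneg hr0.le (σ + 1))]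
    calc r ^ (σ + 1) * ‖r ^ (τ + 1 / 2)‖ * (‖g r‖ * ‖g' r‖)
        = (r ^ (σ + 1) * |g' r|) * (‖r ^ (τ + 1 / 2)‖ * ‖g r‖) := by
          rw [Real.norm_eq_abs (g' r)]; ring
      _ ≤ C * (‖r ^ (τ + 1 / 2)‖ * ‖g r‖) := by gcongr; exact h1 r hr.1 hr.2
  · refine hg.2.of_le_mul (c := C) ((aestronglyMeasurable_rpow _ _).mul (hg.aesm_far.mul m2)) ?_
    filter_upwards [ae_restrict_mem measurableSet_Ioi] with r hr
    have hr1 : 1 < r := hr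
    have hr0 : 0 < r := one_pos.trans hr1
    rw [norm_mul, norm_mul, norm_mul, Real.norm_of_nonneg (Real.rpow_nonneg hr0.le (γ + 1 / 2)),
      Real.norm_of_nonneg (Real.rpow_nonneg hr0.le (γ' + 1 / 2))]
    calc r ^ (γ + 1 / 2) * (‖g r‖ * ‖g' r‖)
        = (r ^ (γ + 1 / 2) * |g' r|) * (1 * ‖g r‖) := by
          rw [Real.norm_eq_abs (g' r)]; ring
      _ ≤ C * (r ^ (γ' + 1 / 2) * ‖g r‖) := by
          have hC : r ^ (γ + 1 / 2) * |g' r| ≤ C := h2 r hr1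
          have h3 : (1 : ℝ) ≤ r ^ (γ' + 1 / 2) := Real.one_le_rpow hr1.le (by linarith)
          exact mul_le_mul hC (mul_le_mul_of_nonneg_right h3 (norm_nonneg _)) (by positivity)
            ((mul_nonneg (Real.rpow_nonneg hr0.le _) (abs_nonneg _)).trans hC)

/-- The product rule in weighted spaces; one of the factors has at least one derivative. -/
lemma mul {a b : ℕ} (hγ : -(1 / 2) ≤ γ') (hg : RadialReg γ' a τ g) (hg' : RadialReg γ b σ g')
    (ha : n ≤ a) (hb : n ≤ b) (hab : 1 ≤ a ∨ 1 ≤ b) :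
    RadialReg γ n (σ + τ + 1) (fun r => g r * g' r) := by
  have base : ∀ {a b : ℕ} {τ σ : ℝ} {g g' : ℝ → ℝ}, RadialReg γ' a τ g → RadialReg γ b σ g' →
      (1 ≤ a ∨ 1 ≤ b) → MemRadialL2 γ (σ + τ + 1) (fun r => g r * g' r) := by
    intro a b τ σ g g' hg hg' hab
    rcases hab with h | h
    · exact memRadialL2_mul_of_left hγ (hg.of_le h) hg'.memRadialL2
    · exact memRadialL2_mul_of_right hγ hg.memRadialL2 (hg'.of_le h)
  induction n generalizing a b τ σ g g' with
  | zero => exact base hg hg' hab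
  | succ n ih =>
    refine ⟨base hg hg' hab, ?_⟩
    obtain ⟨a, rfl⟩ : ∃ a', a = a' + 1 := ⟨a - 1, by omega⟩
    obtain ⟨b, rfl⟩ : ∃ b', b = b' + 1 := ⟨b - 1, by omega⟩
    have hg0 := hg
    have hg0' := hg'
    obtain ⟨-, h, hp, hr⟩ := hg
    obtain ⟨-, h', hp', hr'⟩ := hg'
    refine ⟨_, hp.mul hp', ?_⟩
    -- In each term of the product rule the undifferentiated factor still has a derivative to spare,
    -- which supplies the pointwise bound.
    have h1 := ih hr hg0' (by omega) (by omega) (Or.inr (by omega))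
    have h2 := ih hg0 hr' (by omega) (by omega) (Or.inl (by omega))
    have e1 : σ + (τ + 1) + 1 = σ + τ + 1 + 1 := by ring
    have e2 : σ + 1 + τ + 1 = σ + τ + 1 + 1 := by ring
    rw [e1] at h1
    rw [e2] at h2
    exact h1.add h2

end RadialReg

/-! ### Polar coordinates -/

section Polar

/-- Unit circle times half-line with its measure `r dr`. -/
lemma measurePreserving_polar :
    MeasurePreserving (homeomorphUnitSphereProd Plane) ((volume : Measure Plane).comap (↑))
      ((volume : Measure Plane).toSphere.prod (Measure.volumeIoiPow 1)) := by
  have h := (volume : Measure Plane).measurePreserving_homeomorphUnitSphereProd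
  rwa [show Module.finrank ℝ Plane - 1 = 1 by simp] at h

lemma ae_plane_iff_comap {P : Plane → Prop} :
    (∀ᵐ x, P x) ↔ ∀ᵐ x : ({0}ᶜ : Set Plane) ∂(volume : Measure Plane).comap (↑), P x := by
  rw [← ae_restrict_iff_subtype (measurableSet_singleton _).compl, restrict_compl_singleton]

lemma ae_volumeIoiPow_one_iff {P : ℝ → Prop} :
    (∀ᵐ r : Set.Ioi (0 : ℝ) ∂Measure.volumeIoiPow 1, P r) ↔ ∀ᵐ r ∂volume.restrict (Set.Ioi (0 : ℝ)), P r := by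
  rw [ae_restrict_iff_subtype measurableSet_Ioi, Measure.volumeIoiPow,
    ae_withDensity_iff (by fun_prop)]
  refine ⟨fun h => h.mono fun r hr => hr ?_, fun h => h.mono fun r hr _ => hr⟩
  have : 0 < r.1 := r.2
  simpa using this

/-- The density r is positive on the half-line and the circle has positive measure, so null sets of
radii and null radial sets correspond. This carries almost-everywhere identities between radial
functions and profiles. -/
lemma ae_norm_iff {P : ℝ → Prop} :
    (∀ᵐ x : Plane, P ‖x‖) ↔ ∀ᵐ r ∂volume.restrict (Set.Ioi (0 : ℝ)), P r := by
  rw [ae_plane_iff_comap, ← ae_volumeIoiPow_one_iff]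
  have mp := measurePreserving_polar
  have e1 : (∀ᵐ x : ({0}ᶜ : Set Plane) ∂(volume : Measure Plane).comap (↑), P ‖(x : Plane)‖) ↔
      ∀ᵐ z ∂(volume : Measure Plane).toSphere.prod (Measure.volumeIoiPow 1), P z.2 := by
    rw [← mp.map_eq, (Homeomorph.measurableEmbedding _).ae_map_iff]
    simp
  rw [e1]
  constructor
  · intro h
    have h2 := Measure.ae_ae_of_ae_prod h
    have : (volume : Measure Plane).toSphere ≠ 0 := Measure.toSphere_ne_zero _
    have : NeBot (ae (volume : Measure Plane).toSphere) := ae_neBot.2 this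
    obtain ⟨_, hθ⟩ := h2.exists
    exact hθ
  · intro h
    exact Measure.quasiMeasurePreserving_snd.ae h

lemma aestronglyMeasurable_norm_iff {g : ℝ → ℝ} :
    AEStronglyMeasurable (fun x : Plane => g ‖x‖) volume ↔
      AEStronglyMeasurable g (volume.restrict (Set.Ioi 0)) := by
  have mp := measurePreserving_polar
  have h1 : AEStronglyMeasurable (fun x : Plane => g ‖x‖) volume ↔
      AEStronglyMeasurable (fun x : ({0}ᶜ : Set Plane) => g ‖(x : Plane)‖)
        ((volume : Measure Plane).comap (↑)) := by
    rw [← restrict_compl_singleton (μ := (volume : Measure Plane)) 0,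
      ← map_comap_subtype_coe (measurableSet_singleton _).compl,
      (MeasurableEmbedding.subtype_coe (measurableSet_singleton _).compl).aestronglyMeasurable_map_iff,
      map_comap_subtype_coe (measurableSet_singleton _).compl, restrict_compl_singleton]
    rfl
  have h2 : AEStronglyMeasurable (fun x : ({0}ᶜ : Set Plane) => g ‖(x : Plane)‖)
        ((volume : Measure Plane).comap (↑)) ↔
      AEStronglyMeasurable (fun z : Metric.sphere (0 : Plane) 1 × Set.Ioi (0 : ℝ) => g z.2)
        ((volume : Measure Plane).toSphere.prod (Measure.volumeIoiPow 1)) := by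
    rw [← mp.aestronglyMeasurable_comp_iff (Homeomorph.measurableEmbedding _)]
    simp [Function.comp_def]
  have h3 : AEStronglyMeasurable (fun r : Set.Ioi (0 : ℝ) => g r) (Measure.volumeIoiPow 1) ↔
      AEStronglyMeasurable g (volume.restrict (Set.Ioi 0)) := by
    rw [← map_comap_subtype_coe measurableSet_Ioi,
      (MeasurableEmbedding.subtype_coe measurableSet_Ioi).aestronglyMeasurable_map_iff]
    refine ⟨fun h => h.mono_ac ?_, fun h => h.mono_ac (withDensity_absolutelyContinuous _ _)⟩
    refine withDensity_absolutelyContinuous' (by fun_prop) (Eventually.of_forall fun r => ?_)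
    have : 0 < r.1 := r.2
    simpa using this
  rw [h1, h2, ← h3]
  exact AEStronglyMeasurable.comp_snd_iff (f := fun r : Set.Ioi (0 : ℝ) => g r)
    (Measure.toSphere_ne_zero _)

lemma integrable_norm_iff {g : ℝ → ℝ} :
    Integrable (fun x : Plane => g ‖x‖) volume ↔
      IntegrableOn (fun r => r * g r) (Set.Ioi 0) := by
  rw [integrable_fun_norm_addHaar (volume : Measure Plane)]
  simp

/-- The length of the unit circle. -/
noncomputable def circleLength : ℝ := 2 * (volume : Measure Plane).real (Metric.ball 0 1)

lemma circleLength_pos : 0 < circleLength :=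
  mul_pos two_pos (ENNReal.toReal_pos (Metric.measure_ball_pos _ _ one_pos).ne'
    measure_ball_lt_top.ne)

lemma integral_norm (g : ℝ → ℝ) :
    ∫ x : Plane, g ‖x‖ = circleLength * ∫ r in Set.Ioi (0 : ℝ), r * g r := by
  rw [integral_fun_norm_addHaar (volume : Measure Plane)]
  simp [circleLength, mul_assoc]

/-- The integral of `G` over the circle of radius `r`, with respect to angle. -/
noncomputable def circleIntegralAngle (G : Plane → ℝ) (r : ℝ) : ℝ :=
  ∫ θ : Metric.sphere (0 : Plane) 1, G (r • (θ : Plane)) ∂(volume : Measure Plane).toSphere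

lemma integral_polar {G : Plane → ℝ} (hG : Integrable G volume) :
    IntegrableOn (fun r => r * circleIntegralAngle G r) (Set.Ioi 0) ∧
      ∫ x, G x = ∫ r in Set.Ioi (0 : ℝ), r * circleIntegralAngle G r := by
  have mp := measurePreserving_polar
  have emb := (homeomorphUnitSphereProd Plane).measurableEmbedding
  set Φ : Metric.sphere (0 : Plane) 1 × Set.Ioi (0 : ℝ) → ℝ := fun z => G (z.2.1 • z.1.1) with hΦ
  have hcomp : ∀ x : ({0}ᶜ : Set Plane), Φ (homeomorphUnitSphereProd Plane x) = G x := by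
    intro x
    have hx : ‖(x : Plane)‖ ≠ 0 := norm_ne_zero_iff.2 x.2
    simp [hΦ, smul_smul, hx]
  have i1 : Integrable (fun x : ({0}ᶜ : Set Plane) => G x) ((volume : Measure Plane).comap (↑)) := by
    have : IntegrableOn G ({0}ᶜ : Set Plane) := hG.integrableOn
    rwa [integrableOn_iff_comap_subtypeVal (measurableSet_singleton _).compl] at this
  have i2 : Integrable Φ ((volume : Measure Plane).toSphere.prod (Measure.volumeIoiPow 1)) := by
    rw [← mp.integrable_comp_emb emb]
    exact i1.congr (Eventually.of_forall fun x => (hcomp x).symm)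
  have i3 := i2.integral_prod_right
  have e1 : ∫ x, G x = ∫ r, ∫ θ, Φ (θ, r) ∂(volume : Measure Plane).toSphere
      ∂Measure.volumeIoiPow 1 := by
    rw [← integral_prod_symm _ i2, ← mp.integral_comp emb]
    simp only [hcomp]
    rw [integral_subtype_comap (measurableSet_singleton _).compl, restrict_compl_singleton]
  have e2 : ∀ r : Set.Ioi (0 : ℝ), ∫ θ, Φ (θ, r) ∂(volume : Measure Plane).toSphere =
      circleIntegralAngle G r := fun r => rfl
  simp only [e2] at i3 e1
  constructor
  · rw [integrableOn_iff_comap_subtypeVal measurableSet_Ioi]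
    rw [Measure.volumeIoiPow, integrable_withDensity_iff_integrable_smul' (by fun_prop)
      (by simp)] at i3
    refine i3.congr (Eventually.of_forall fun r => ?_)
    have : 0 < r.1 := r.2
    simp [ENNReal.toReal_ofReal, this.le]
  · rw [e1, ← integral_subtype_comap measurableSet_Ioi
      (fun r : ℝ => r * circleIntegralAngle G r)]
    simp only [Measure.volumeIoiPow, ENNReal.ofReal]
    rw [integral_withDensity_eq_integral_smul (by fun_prop)]
    refine integral_congr_ae (Eventually.of_forall fun r => ?_)
    have : 0 < r.1 := r.2
    simp [NNReal.smul_def, this.le]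

lemma circleIntegralAngle_radial_mul (φ : ℝ → ℝ) (G : Plane → ℝ) {r : ℝ} (hr : 0 < r) :
    circleIntegralAngle (fun x => φ ‖x‖ * G x) r = φ r * circleIntegralAngle G r := by
  unfold circleIntegralAngle
  rw [← integral_const_mul]
  refine integral_congr_ae (Eventually.of_forall fun θ => ?_)
  have : ‖(θ : Plane)‖ = 1 := by simp
  simp [norm_smul, this, abs_of_pos hr]

lemma isCompact_norm_preimage {K : Set ℝ} (hK : IsCompact K) :
    IsCompact ((fun x : Plane => ‖x‖) ⁻¹' K) := by
  obtain ⟨C, hC⟩ := hK.isBounded.exists_norm_le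
  refine Metric.isCompact_of_isClosed_isBounded (hK.isClosed.preimage continuous_norm) ?_
  refine (Metric.isBounded_closedBall (x := (0 : Plane)) (r := C)).subset fun x hx => ?_
  simpa using hC _ hx

lemma IntegrableOn.of_id_mul {f : ℝ → ℝ} {K : Set ℝ} (hK : IsCompact K) (h0 : K ⊆ Set.Ioi 0)
    (h : IntegrableOn (fun r => r * f r) K) : IntegrableOn f K := by
  have hc : ContinuousOn (fun r : ℝ => r⁻¹) K :=
    continuousOn_id.inv₀ fun r hr => ne_of_gt (h0 hr)
  refine (h.continuousOn_mul hc hK).congr_fun (fun r hr => ?_) hK.measurableSet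
  have : r ≠ 0 := ne_of_gt (h0 hr)
  field_simp

/-- A compact set of positive radii corresponds to a compact set in the punctured plane. Cutting G
off there makes it integrable, and Fubini in polar coordinates applies; the Jacobian r is harmless
away from 0. -/
lemma locallyIntegrableOn_circleIntegralAngle {G : Plane → ℝ}
    (hG : LocallyIntegrableOn G puncturedPlane volume) :
    LocallyIntegrableOn (circleIntegralAngle G) (Set.Ioi 0) volume := by
  rw [locallyIntegrableOn_iff isOpen_Ioi.isLocallyClosed]
  intro K hK hKc
  have hK' : (fun x : Plane => ‖x‖) ⁻¹' K ⊆ puncturedPlane := fun x hx =>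
    norm_pos_iff.1 (hK hx)
  have h1 : Integrable (fun x : Plane => K.indicator (fun _ => (1 : ℝ)) ‖x‖ * G x) volume := by
    have := (hG.integrableOn_compact_subset hK' (isCompact_norm_preimage hKc)).integrable_indicator
      (isCompact_norm_preimage hKc).measurableSet
    refine this.congr (Eventually.of_forall fun x => ?_)
    by_cases hx : ‖x‖ ∈ K <;> simp [Set.indicator, hx]
  have h2 := (integral_polar h1).1
  refine IntegrableOn.of_id_mul hKc hK ?_
  refine (h2.mono_set hK).congr_fun (fun r hr => ?_) hKc.measurableSet
  simp only
  rw [circleIntegralAngle_radial_mul _ _ (hK hr), Set.indicator_of_mem hr, one_mul]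

lemma locallyIntegrableOn_norm_iff {g : ℝ → ℝ} :
    LocallyIntegrableOn (fun x : Plane => g ‖x‖) puncturedPlane volume ↔
      LocallyIntegrableOn g (Set.Ioi 0) volume := by
  rw [locallyIntegrableOn_iff isOpen_Ioi.isLocallyClosed,
    locallyIntegrableOn_iff puncturedPlane.isOpen.isLocallyClosed]
  have key : ∀ K : Set ℝ, K ⊆ Set.Ioi 0 → IsCompact K →
      (Integrable (fun x : Plane => K.indicator g ‖x‖) volume ↔ IntegrableOn g K) := by
    intro K hK hKc
    rw [integrable_norm_iff]
    constructor
    · intro h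
      refine IntegrableOn.of_id_mul hKc hK ((h.mono_set hK).congr_fun (fun r hr => ?_)
        hKc.measurableSet)
      simp [Set.indicator_of_mem hr]
    · intro h
      have h1 : IntegrableOn (fun r => r * g r) K := h.continuousOn_mul continuousOn_id hKc
      refine (h1.integrable_indicator hKc.measurableSet).integrableOn.congr
        (Eventually.of_forall fun r => ?_)
      by_cases hr : r ∈ K <;> simp [hr]
  constructor
  · intro h K hK hKc
    rw [← key K hK hKc]
    have := (h _ (fun x hx => norm_pos_iff.1 (hK hx))
      (isCompact_norm_preimage hKc)).integrable_indicator (isCompact_norm_preimage hKc).measurableSet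
    exact this.congr (Eventually.of_forall fun x =>
      Set.indicator_comp_right (fun x : Plane => ‖x‖) (g := g))
  · intro h K hK hKc
    have hc := hKc.image (continuous_norm (E := Plane))
    have hs : (fun x : Plane => ‖x‖) '' K ⊆ Set.Ioi 0 := by
      rintro _ ⟨x, hx, rfl⟩
      exact norm_pos_iff.2 (hK hx)
    refine (((key _ hs hc).2 (h _ hs hc)).integrableOn (s := K)).congr_fun (fun x hx => ?_)
      hKc.measurableSet
    simp only
    exact Set.indicator_of_mem (Set.mem_image_of_mem _ hx) g

end Polar

/-! ### Weighted norms of radial functions -/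

section RadialNorm

variable {χ : ℝ → ℝ}

lemma originWeight_eq_of_le (hχ : IsRadialCutoff χ) {r : ℝ} (hr : r ≤ 1) :
    originWeight χ r = r := by
  rcases hr.lt_or_eq with h | h
  · simp [originWeight, hχ.eq_zero r h]
  · simp [originWeight, h]

lemma rpow_bounds_of_mem_Icc {x : ℝ} (h1 : 1 ≤ x) (h2 : x ≤ 2) (p : ℝ) :
    (2 ^ |p|)⁻¹ ≤ x ^ p ∧ x ^ p ≤ (2 : ℝ) ^ |p| := by
  have hx : 0 < x := one_pos.trans_le h1
  have up : ∀ q : ℝ, x ^ q ≤ (2 : ℝ) ^ |q| := fun q =>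
    (Real.rpow_le_rpow_of_exponent_le h1 (le_abs_self q)).trans
      (Real.rpow_le_rpow hx.le h2 (abs_nonneg q))
  refine ⟨?_, up p⟩
  have := up (-p)
  rw [Real.rpow_neg hx.le, abs_neg] at this
  exact inv_le_of_inv_le₀ (Real.rpow_pos_of_pos hx p) this

/-- The radial profile of the double weight. -/
noncomputable def weightProfile (χ : ℝ → ℝ) (γ σ r : ℝ) : ℝ :=
  originWeight χ r ^ σ * √(1 + r ^ 2) ^ γ

lemma doubleWeight_eq_weightProfile (γ σ : ℝ) (x : Plane) :
    doubleWeight χ γ σ x = weightProfile χ γ σ ‖x‖ := rfl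

lemma measurable_weightProfile (hχ : IsRadialCutoff χ) (γ σ : ℝ) :
    Measurable (weightProfile χ γ σ) := by
  have hc : Continuous χ := hχ.contDiff.continuous
  have h1 : Continuous (originWeight χ) := by unfold originWeight; fun_prop
  have h2 : Continuous fun r : ℝ => √(1 + r ^ 2) := by fun_prop
  exact (h1.measurable.pow_const σ).mul (h2.measurable.pow_const γ)

/-- For r ≤ 1 one has m(r) = r and the bracket lies in [1, 2]; for r > 1 both m(r) and the bracket
divided by r lie in [1, 2]. Only the origin sees σ, and only infinity sees γ. -/
lemma weightProfile_bounds (hχ : IsRadialCutoff χ) (γ σ : ℝ) :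
    ∃ C : ℝ, 0 < C ∧
      (∀ r, 0 < r → r ≤ 1 → r ^ σ ≤ C * weightProfile χ γ σ r ∧
        weightProfile χ γ σ r ≤ C * r ^ σ) ∧
      (∀ r, 1 < r → r ^ γ ≤ C * weightProfile χ γ σ r ∧
        weightProfile χ γ σ r ≤ C * r ^ γ) := by
  have two_pow : ∀ p : ℝ, (0 : ℝ) < 2 ^ p := fun p => Real.rpow_pos_of_pos two_pos p
  have one_le : ∀ p : ℝ, (1 : ℝ) ≤ 2 ^ |p| := fun p => Real.one_le_rpow one_le_two (abs_nonneg p)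
  have scale : ∀ {A B W e : ℝ}, 0 < A → 0 < B → W = B * e → A⁻¹ ≤ e → e ≤ A →
      B ≤ A * W ∧ W ≤ A * B := by
    intro A B W e hA hB hW h1 h2
    subst hW
    constructor
    · have : 1 ≤ A * e := by
        have := mul_le_mul_of_nonneg_left h1 hA.le
        rwa [mul_inv_cancel₀ hA.ne'] at this
      nlinarith
    · nlinarith
  refine ⟨2 ^ |σ| * 2 ^ |γ|, mul_pos (two_pow _) (two_pow _), fun r h0 h1 => ?_, fun r h1 => ?_⟩
  · have hJ1 : 1 ≤ √(1 + r ^ 2) := by rw [Real.one_le_sqrt]; nlinarith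
    have hJ2 : √(1 + r ^ 2) ≤ 2 := by
      rw [Real.sqrt_le_left (by norm_num)]; nlinarith
    obtain ⟨b1, b2⟩ := rpow_bounds_of_mem_Icc hJ1 hJ2 γ
    refine scale (e := √(1 + r ^ 2) ^ γ) (mul_pos (two_pow _) (two_pow _))
      (Real.rpow_pos_of_pos h0 σ) ?_ ?_ ?_
    · rw [weightProfile, originWeight_eq_of_le hχ h1]
    · refine le_trans ?_ b1
      exact inv_anti₀ (two_pow _) (le_mul_of_one_le_left (two_pow _).le (one_le σ))
    · exact b2.trans (le_mul_of_one_le_left (two_pow _).le (one_le σ))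
  · have h0 : 0 < r := one_pos.trans h1
    have hM1 : 1 ≤ originWeight χ r := by
      have := min_le_originWeight hχ (r := r)
      rwa [min_eq_right h1.le] at this
    obtain ⟨a1, a2⟩ := rpow_bounds_of_mem_Icc hM1 (originWeight_le_two hχ r) σ
    have hJ1 : 1 ≤ √(1 + r ^ 2) / r := by
      rw [le_div_iff₀ h0, one_mul]
      exact Real.le_sqrt_of_sq_le (by linarith)
    have hJ2 : √(1 + r ^ 2) / r ≤ 2 := by
      rw [div_le_iff₀ h0, Real.sqrt_le_left (by positivity)]; nlinarith
    obtain ⟨b1, b2⟩ := rpow_bounds_of_mem_Icc hJ1 hJ2 γ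
    refine scale (e := originWeight χ r ^ σ * (√(1 + r ^ 2) / r) ^ γ)
      (mul_pos (two_pow _) (two_pow _)) (Real.rpow_pos_of_pos h0 γ) ?_ ?_ ?_
    · rw [weightProfile, Real.div_rpow (Real.sqrt_nonneg _) h0.le]
      have := (Real.rpow_pos_of_pos h0 γ).ne'
      field_simp
    · rw [mul_inv]
      exact mul_le_mul a1 b1 (inv_nonneg.2 (two_pow _).le)
        ((inv_nonneg.2 (two_pow _).le).trans a1)
    · exact mul_le_mul a2 b2 (Real.rpow_nonneg (by positivity) _) (two_pow _).le

lemma memLp_two_union_iff {f : ℝ → ℝ} :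
    MemLp f 2 (volume.restrict (Set.Ioi 0)) ↔
      MemLp f 2 (volume.restrict (Set.Ioc 0 1)) ∧ MemLp f 2 (volume.restrict (Set.Ioi 1)) := by
  have hu : Set.Ioc (0 : ℝ) 1 ∪ Set.Ioi 1 = Set.Ioi 0 := Set.Ioc_union_Ioi_eq_Ioi zero_le_one
  constructor
  · intro h
    exact ⟨h.mono_measure (Measure.restrict_mono Set.Ioc_subset_Ioi_self le_rfl),
      h.mono_measure (Measure.restrict_mono (Set.Ioi_subset_Ioi zero_le_one) le_rfl)⟩
  · rintro ⟨h1, h2⟩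
    have hm : AEStronglyMeasurable f (volume.restrict (Set.Ioi 0)) := by
      rw [← hu]; exact aestronglyMeasurable_union_iff.2 ⟨h1.1, h2.1⟩
    rw [memLp_two_iff_integrable_sq hm]
    have := (IntegrableOn.union (μ := volume) h1.integrable_sq h2.integrable_sq)
    rwa [hu] at this

/-- The area element r dr contributes the factor r^{1/2} that appears as the shift 1/2 in the
exponents of `MemRadialL2`. -/
lemma memLp_doubleWeight_norm_iff (hχ : IsRadialCutoff χ) {γ τ : ℝ} {g : ℝ → ℝ} :
    MemLp (fun x : Plane => doubleWeight χ γ τ x * g ‖x‖) 2 volume ↔ MemRadialL2 γ τ g := by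
  have step1 : MemLp (fun x : Plane => doubleWeight χ γ τ x * g ‖x‖) 2 volume ↔
      MemLp (fun r => r ^ (1 / 2 : ℝ) * (weightProfile χ γ τ r * g r)) 2
        (volume.restrict (Set.Ioi 0)) := by
    simp only [doubleWeight_eq_weightProfile]
    set F := fun r => weightProfile χ γ τ r * g r with hF
    have hm : AEStronglyMeasurable (fun x : Plane => F ‖x‖) volume ↔
        AEStronglyMeasurable (fun r => r ^ (1 / 2 : ℝ) * F r) (volume.restrict (Set.Ioi 0)) := by
      rw [aestronglyMeasurable_norm_iff]
      exact ⟨fun h => (aestronglyMeasurable_rpow _ _).mul h,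
        fun h => aestronglyMeasurable_of_rpow_mul measurableSet_Ioi subset_rfl h⟩
    have hi : Integrable (fun x : Plane => F ‖x‖ ^ 2) volume ↔
        IntegrableOn (fun r => (r ^ (1 / 2 : ℝ) * F r) ^ 2) (Set.Ioi 0) := by
      rw [integrable_norm_iff (g := fun r => F r ^ 2)]
      refine integrableOn_congr_fun (fun r hr => ?_) measurableSet_Ioi
      have hr : 0 < r := hr
      change r * F r ^ 2 = _
      rw [mul_pow (r ^ (1 / 2 : ℝ)), ← Real.sqrt_eq_rpow, Real.sq_sqrt hr.le]
    constructor
    · intro h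
      rw [memLp_two_iff_integrable_sq (hm.1 h.1)]
      exact hi.1 h.integrable_sq
    · intro h
      rw [memLp_two_iff_integrable_sq (hm.2 h.1)]
      exact hi.2 h.integrable_sq
  rw [step1, memLp_two_union_iff]
  obtain ⟨C, hC, hnear, hfar⟩ := weightProfile_bounds hχ γ τ
  have compare : ∀ (s : Set ℝ) (p : ℝ), MeasurableSet s → s ⊆ Set.Ioi 0 →
      (∀ r ∈ s, r ^ p ≤ C * weightProfile χ γ τ r ∧ weightProfile χ γ τ r ≤ C * r ^ p) →
      (MemLp (fun r => r ^ (1 / 2 : ℝ) * (weightProfile χ γ τ r * g r)) 2 (volume.restrict s) ↔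
        MemLp (fun r => r ^ (p + 1 / 2) * g r) 2 (volume.restrict s)) := by
    intro s p hs h0 hb
    have hW : ∀ r ∈ s, 0 < weightProfile χ γ τ r := fun r hr =>
      pos_of_mul_pos_right ((Real.rpow_pos_of_pos (h0 hr) p).trans_le (hb r hr).1) hC.le
    constructor
    · intro h
      have hg : AEStronglyMeasurable g (volume.restrict s) := by
        have h1 := aestronglyMeasurable_of_rpow_mul hs h0 h.1
        refine ((measurable_weightProfile hχ γ τ).inv.aestronglyMeasurable.mul h1).congr ?_
        filter_upwards [ae_restrict_mem hs] with r hr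
        have := (hW r hr).ne'
        simp only [Pi.mul_apply, Pi.inv_apply]
        field_simp
      refine h.of_le_mul (c := C) ((aestronglyMeasurable_rpow _ _).mul hg) ?_
      filter_upwards [ae_restrict_mem hs] with r hr
      have hr0 : 0 < r := h0 hr
      rw [Real.rpow_add hr0, norm_mul, norm_mul, norm_mul, norm_mul,
        Real.norm_of_nonneg (Real.rpow_nonneg hr0.le p), Real.norm_of_nonneg (hW r hr).le]
      calc r ^ p * ‖r ^ (1 / 2 : ℝ)‖ * ‖g r‖
          ≤ (C * weightProfile χ γ τ r) * ‖r ^ (1 / 2 : ℝ)‖ * ‖g r‖ := by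
            gcongr; exact (hb r hr).1
        _ = _ := by ring
    · intro h
      have hg := aestronglyMeasurable_of_rpow_mul hs h0 h.1
      refine h.of_le_mul (c := C) ((aestronglyMeasurable_rpow _ _).mul
        ((measurable_weightProfile hχ γ τ).aestronglyMeasurable.mul hg)) ?_
      filter_upwards [ae_restrict_mem hs] with r hr
      have hr0 : 0 < r := h0 hr
      rw [Real.rpow_add hr0, norm_mul, norm_mul, norm_mul, norm_mul,
        Real.norm_of_nonneg (Real.rpow_nonneg hr0.le p), Real.norm_of_nonneg (hW r hr).le]
      calc ‖r ^ (1 / 2 : ℝ)‖ * (weightProfile χ γ τ r * ‖g r‖)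
          ≤ ‖r ^ (1 / 2 : ℝ)‖ * ((C * r ^ p) * ‖g r‖) := by
            gcongr; exact (hb r hr).2
        _ = _ := by ring
  exact and_congr
    (compare _ τ measurableSet_Ioc Set.Ioc_subset_Ioi_self fun r hr => hnear r hr.1 hr.2)
    (compare _ γ measurableSet_Ioi (Set.Ioi_subset_Ioi zero_le_one) fun r hr => hfar r hr)

end RadialNorm

/-! ### Radial weak derivatives -/

section DuBoisReymond

lemma exists_Icc_of_tsupport_subset_Ioi {ζ : ℝ → ℝ} (hc : HasCompactSupport ζ)
    (hs : tsupport ζ ⊆ Set.Ioi 0) :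
    ∃ a b : ℝ, 0 < a ∧ a < b ∧ tsupport ζ ⊆ Set.Icc a b := by
  rcases (tsupport ζ).eq_empty_or_nonempty with h | h
  · exact ⟨1, 2, one_pos, one_lt_two, by simp [h]⟩
  · obtain ⟨a, ha, hmin⟩ := hc.isCompact.exists_isLeast h
    obtain ⟨b, hb, hmax⟩ := hc.isCompact.exists_isGreatest h
    exact ⟨a, b + 1, hs ha, by linarith [hmin hb], fun x hx => ⟨hmin hx, by linarith [hmax hx]⟩⟩

/-- The integral is started to the left of the support of ζ; to the right of the support it equals
the full integral of ζ, which is 0. -/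
lemma exists_primitive_of_integral_eq_zero {ζ : ℝ → ℝ} (h : ContDiff ℝ ∞ ζ)
    (hc : HasCompactSupport ζ) (hs : tsupport ζ ⊆ Set.Ioi 0) (h0 : ∫ r, ζ r = 0) :
    ∃ Z : ℝ → ℝ, ContDiff ℝ ∞ Z ∧ HasCompactSupport Z ∧ tsupport Z ⊆ Set.Ioi 0 ∧ deriv Z = ζ := by
  obtain ⟨a, b, ha, hab, hsub⟩ := exists_Icc_of_tsupport_subset_Ioi hc hs
  have hz : ∀ r, r ∉ Set.Icc a b → ζ r = 0 := fun r hr =>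
    image_eq_zero_of_notMem_tsupport fun h => hr (hsub h)
  set Z : ℝ → ℝ := fun x => ∫ t in (a / 2)..x, ζ t with hZ
  have hd : ∀ x, HasDerivAt Z (ζ x) x := fun x =>
    intervalIntegral.integral_hasDerivAt_right (h.continuous.intervalIntegrable _ _)
      h.continuous.aestronglyMeasurable.stronglyMeasurableAtFilter h.continuous.continuousAt
  have hder : deriv Z = ζ := funext fun x => (hd x).deriv
  have hsupp : Function.support Z ⊆ Set.Icc a b := by
    intro x hx
    by_contra hxs
    refine hx ?_
    rcases lt_or_ge x a with hxa | hxa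
    · refine intervalIntegral.integral_zero_ae (Eventually.of_forall fun t ht => hz t ?_)
      exact fun h => absurd h.1 (not_le.2 (ht.2.trans_lt (max_lt (by linarith) hxa)))
    · have hxb : b < x := by
        by_contra hxb
        exact hxs ⟨hxa, not_lt.1 hxb⟩
      simp only [hZ]
      rw [intervalIntegral.integral_of_le (by linarith), ← h0, ← integral_Icc_eq_integral_Ioc]
      refine setIntegral_eq_integral_of_forall_compl_eq_zero fun t ht => hz t fun h => ht ?_
      exact ⟨by linarith [h.1], h.2.trans hxb.le⟩
  have hts : tsupport Z ⊆ Set.Icc a b := closure_minimal hsupp isClosed_Icc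
  refine ⟨Z, ?_, ?_, hts.trans fun x hx => ha.trans_le hx.1, hder⟩
  · rw [contDiff_infty_iff_deriv, hder]
    exact ⟨fun x => (hd x).differentiableAt, h⟩
  · exact HasCompactSupport.of_support_subset_isCompact isCompact_Icc hsupp

/-- The lemma of du Bois-Reymond on the half-line. -/
lemma exists_ae_eq_const_of_integral_deriv_mul_eq_zero {k : ℝ → ℝ}
    (hk : LocallyIntegrableOn k (Set.Ioi 0) volume)
    (h : ∀ Z : ℝ → ℝ, ContDiff ℝ ∞ Z → HasCompactSupport Z → tsupport Z ⊆ Set.Ioi 0 →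
      ∫ r, deriv Z r * k r = 0) :
    ∃ c, ∀ᵐ r, r ∈ Set.Ioi (0 : ℝ) → k r = c := by
  let bump : ContDiffBump (2 : ℝ) := ⟨1 / 2, 1, by norm_num, by norm_num⟩
  set ρ : ℝ → ℝ := bump.normed volume with hρ
  have ρ1 : ContDiff ℝ ∞ ρ := bump.contDiff_normed
  have ρ2 : HasCompactSupport ρ := bump.hasCompactSupport_normed
  have ρ3 : tsupport ρ ⊆ Set.Ioi 0 := by
    rw [hρ, bump.tsupport_normed_eq, Real.closedBall_eq_Icc]
    intro x hx
    have : (2 : ℝ) - 1 ≤ x := hx.1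
    exact (by norm_num : (0 : ℝ) < 2 - 1).trans_le this
  have ρ4 : ∫ r, ρ r = 1 := bump.integral_normed
  have hint : ∀ ζ : ℝ → ℝ, ContDiff ℝ ∞ ζ → HasCompactSupport ζ → tsupport ζ ⊆ Set.Ioi 0 →
      ∀ {w : ℝ → ℝ}, LocallyIntegrableOn w (Set.Ioi 0) volume →
      Integrable (fun r => ζ r * w r) volume := by
    intro ζ hζ hc hs w hw
    have i1 : IntegrableOn (fun r => ζ r * w r) (tsupport ζ) :=
      (hw.integrableOn_compact_subset hs hc.isCompact).continuousOn_mul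
        hζ.continuous.continuousOn hc.isCompact
    exact (integrableOn_iff_integrable_of_support_subset
      ((Function.support_mul_subset_left _ _).trans (subset_tsupport ζ))).1 i1
  -- With ρ of integral 1, the function ζ - (∫ ζ) ρ has mean zero for every test function ζ, hence
  -- is the derivative of a test function. Its pairing with k vanishes, which says that ζ pairs to 0
  -- with k - c.
  set c := ∫ r, ρ r * k r with hc
  refine ⟨c, ?_⟩
  have := isOpen_Ioi.ae_eq_zero_of_integral_contDiff_smul_eq_zero (μ := volume)
    (f := fun r => k r - c) (hk.sub (locallyIntegrableOn_const c)) (fun ζ hζ hζc hζs => by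
      set I := ∫ r, ζ r with hI
      have d1 : ContDiff ℝ ∞ (fun r => ζ r - I * ρ r) := hζ.sub (contDiff_const.mul ρ1)
      have d2 : HasCompactSupport (fun r => ζ r - I * ρ r) := hζc.sub ρ2.mul_left
      have d3 : tsupport (fun r => ζ r - I * ρ r) ⊆ Set.Ioi 0 :=
        (tsupport_sub _ _).trans (Set.union_subset hζs (tsupport_mul_subset_right.trans ρ3))
      have iζ : Integrable ζ volume := hζ.continuous.integrable_of_hasCompactSupport hζc
      have iρ : Integrable ρ volume := ρ1.continuous.integrable_of_hasCompactSupport ρ2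
      obtain ⟨Z, z1, z2, z3, z4⟩ := exists_primitive_of_integral_eq_zero d1 d2 d3 (by
        rw [integral_sub iζ (iρ.const_mul I), integral_const_mul, ρ4]
        simp [hI])
      have e := h Z z1 z2 z3
      rw [z4] at e
      have j1 := hint ζ hζ hζc hζs hk
      have j2 := hint ρ ρ1 ρ2 ρ3 hk
      have e2 : ∫ r, (ζ r - I * ρ r) * k r = (∫ r, ζ r * k r) - I * c := by
        rw [hc, ← integral_const_mul, ← integral_sub j1 (j2.const_mul I)]
        exact integral_congr_ae (Eventually.of_forall fun r => by ring)
      have e3 : ∫ r, ζ r • (k r - c) = (∫ r, ζ r * k r) - I * c := by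
        rw [hI, ← integral_mul_const, ← integral_sub j1 (iζ.mul_const c)]
        exact integral_congr_ae (Eventually.of_forall fun r => by simp only [smul_eq_mul]; ring)
      rw [e3, ← e2, e])
  filter_upwards [this] with r hr hr0
  linarith [hr hr0]

lemma IsPrimitive.integral_deriv_mul {g h : ℝ → ℝ} (hg : IsPrimitive g h) {Z : ℝ → ℝ}
    (hZ : ContDiff ℝ ∞ Z) (hc : HasCompactSupport Z) (hs : tsupport Z ⊆ Set.Ioi 0) :
    (∫ r, deriv Z r * g r) = -∫ r, Z r * h r := by
  obtain ⟨a, b, ha, hab, hsub⟩ := exists_Icc_of_tsupport_subset_Ioi hc hs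
  set a' := a / 2
  set b' := b + 1
  have ha' : 0 < a' := by positivity
  have hb' : 0 < b' := add_pos (ha.trans hab) one_pos
  have hz : ∀ r, r ∉ Set.Icc a b → Z r = 0 := fun r hr =>
    image_eq_zero_of_notMem_tsupport fun h => hr (hsub h)
  have hz' : ∀ r, r ∉ Set.Icc a b → deriv Z r = 0 := fun r hr =>
    image_eq_zero_of_notMem_tsupport fun h => hr (hsub (tsupport_deriv_subset h))
  have hcd : Continuous (deriv Z) := hZ.continuous_deriv (by simp)
  have hP : IsPrimitive Z (deriv Z) :=
    IsPrimitive.of_hasDerivAt (fun r _ => (hZ.differentiable (by simp) r).hasDerivAt)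
      (hcd.locallyIntegrable.locallyIntegrableOn _)
  have key := (hP.mul hg).sub_eq a' b' ha' hb'
  have za : Z a' = 0 := hz _ fun h => by have := h.1; simp only [a'] at this; linarith
  have zb : Z b' = 0 := hz _ fun h => by have := h.2; simp only [b'] at this; linarith
  rw [za, zb] at key
  have i1 : IntervalIntegrable (fun r => deriv Z r * g r) volume a' b' :=
    (hcd.continuousOn.mul (hg.continuousOn.mono (uIcc_subset_Ioi ha' hb'))).intervalIntegrable
  have i2 : IntervalIntegrable (fun r => Z r * h r) volume a' b' :=
    (hg.intervalIntegrable ha' hb').continuousOn_mul hZ.continuous.continuousOn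
  rw [intervalIntegral.integral_add i1 i2] at key
  have full : ∀ F : ℝ → ℝ, (∀ r, r ∉ Set.Icc a b → F r = 0) →
      ∫ r in a'..b', F r = ∫ r, F r := by
    intro F hF
    rw [intervalIntegral.integral_of_le (by simp only [a', b']; linarith)]
    refine setIntegral_eq_integral_of_forall_compl_eq_zero fun t ht => hF t fun h => ht ?_
    exact ⟨by have := h.1; simp only [a']; linarith, by have := h.2; simp only [b']; linarith⟩
  rw [full _ fun r hr => by rw [hz' r hr, zero_mul], full _ fun r hr => by rw [hz r hr, zero_mul]]
    at key
  linarith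

end DuBoisReymond

/-! ### Weak gradients of radial functions and primitives of their profiles -/

section RadialWeakDeriv

lemma sum_coord_sq (x : Plane) : ∑ i, x i * x i = ‖x‖ ^ 2 := by
  rw [EuclideanSpace.norm_sq_eq]
  exact Finset.sum_congr rfl fun i _ => by rw [Real.norm_eq_abs, sq_abs, sq]

lemma sum_direction_sq {x : Plane} (hx : x ≠ 0) : ∑ i, x i / ‖x‖ * (x i / ‖x‖) = 1 := by
  have hn : ‖x‖ ≠ 0 := norm_ne_zero_iff.2 hx
  have : ∑ i, x i / ‖x‖ * (x i / ‖x‖) = (∑ i, x i * x i) / ‖x‖ ^ 2 := by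
    rw [Finset.sum_div]
    exact Finset.sum_congr rfl fun i _ => by field_simp
  rw [this, sum_coord_sq]
  field_simp

lemma hasFDerivAt_norm_plane {x : Plane} (hx : x ≠ 0) :
    HasFDerivAt (fun y : Plane => ‖y‖) (‖x‖⁻¹ • innerSL ℝ x) x := by
  have hn : ‖x‖ ≠ 0 := norm_ne_zero_iff.2 hx
  have h := (hasDerivAt_inv (inv_ne_zero hn)).comp_hasFDerivAt x (hasFDerivAt_norm_inv hx)
  have e : (Inv.inv ∘ fun y : Plane => ‖y‖⁻¹) = fun y => ‖y‖ := by ext y; simp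
  rw [e] at h
  refine h.congr_fderiv ?_
  ext v
  simp
  field_simp

/-- A radial test function on the punctured plane. -/
noncomputable def radialTestFunction (ζ : ℝ → ℝ) (h : ContDiff ℝ ∞ ζ) (hc : HasCompactSupport ζ)
    (hs : tsupport ζ ⊆ Set.Ioi 0) : 𝓓(puncturedPlane, ℝ) where
  toFun x := ζ ‖x‖
  contDiff' := by
    rw [contDiff_iff_contDiffAt]
    intro x
    by_cases hx : x = 0
    · have h0 : (0 : ℝ) ∉ tsupport ζ := fun h => lt_irrefl (0 : ℝ) (hs h)
      have : (fun y : Plane => ζ ‖y‖) =ᶠ[𝓝 x] fun _ => 0 := by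
        have ht : Tendsto (fun y : Plane => ‖y‖) (𝓝 x) (𝓝 0) := by
          have := (continuous_norm (E := Plane)).tendsto x
          rwa [hx, norm_zero, ← hx] at this
        exact ht.eventually (notMem_tsupport_iff_eventuallyEq.1 h0)
      exact contDiffAt_const.congr_of_eventuallyEq this
    · exact h.contDiffAt.comp x (contDiffAt_norm ℝ hx)
  hasCompactSupport' := by
    refine HasCompactSupport.of_support_subset_isCompact (isCompact_norm_preimage hc.isCompact) ?_
    exact fun x hx => subset_tsupport ζ hx
  tsupport_subset' := by
    refine (closure_minimal (t := (fun x : Plane => ‖x‖) ⁻¹' (tsupport ζ))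
      (fun x hx => subset_tsupport ζ hx)
      (hc.isCompact.isClosed.preimage continuous_norm)).trans ?_
    exact fun x hx => norm_pos_iff.1 (hs hx)

lemma lineDeriv_radialTestFunction {ζ : ℝ → ℝ} (h : ContDiff ℝ ∞ ζ) (hc : HasCompactSupport ζ)
    (hs : tsupport ζ ⊆ Set.Ioi 0) (i : Fin 2) {x : Plane} (hx : x ≠ 0) :
    (∂_{basisVec i} (radialTestFunction ζ h hc hs) : 𝓓(puncturedPlane, ℝ)) x =
      deriv ζ ‖x‖ * (x i / ‖x‖) := by
  rw [TestFunction.lineDeriv_apply_eq_fderiv]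
  have hd := ((h.differentiable (by simp) ‖x‖).hasDerivAt).comp_hasFDerivAt x
    (hasFDerivAt_norm_plane hx)
  have e : fderiv ℝ (⇑(radialTestFunction ζ h hc hs)) x = _ := hd.fderiv
  rw [e]
  simp [inner_basisVec, div_eq_inv_mul]

/-- The components of `x / |x|²`. -/
lemma IsSymbol.kelvin (i : Fin 2) : IsSymbol 1 (fun x => x i * ‖x‖⁻¹ ^ 2) := by
  fin_cases i
  · convert IsSymbol.mono 1 0 1 using 2 with x
    simp
  · convert IsSymbol.mono 0 1 1 using 2 with x
    simp

lemma fderiv_kelvin (i : Fin 2) {x : Plane} (hx : x ≠ 0) :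
    fderiv ℝ (fun x : Plane => x i * ‖x‖⁻¹ ^ 2) x (basisVec i) =
      ‖x‖⁻¹ ^ 2 - 2 * (x i * x i) * ‖x‖⁻¹ ^ 4 := by
  have h0 : HasFDerivAt (fun y : Plane => y i) (EuclideanSpace.proj (𝕜 := ℝ) i) x :=
    (EuclideanSpace.proj (𝕜 := ℝ) i).hasFDerivAt
  have h := h0.mul ((hasFDerivAt_norm_inv hx).pow 2)
  have e : fderiv ℝ (fun x : Plane => x i * ‖x‖⁻¹ ^ 2) x = _ := h.fderiv
  rw [e]
  simp [basisVec_apply, inner_basisVec]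
  ring

/-- The test field is ζ(|x|) x/|x|². In the punctured plane x/|x|² is divergence free, so the
divergence of the test field is ζ'(|x|)/|x| with no zeroth-order term, and 1/|x| cancels the
Jacobian in polar coordinates. -/
lemma integral_radial_test {u : Plane → ℝ} {w : Fin 2 → Plane → ℝ}
    (h : ∀ i, HasWeakDeriv puncturedPlane (Pi.single i 1) u (w i))
    {ζ : ℝ → ℝ} (hζ : ContDiff ℝ ∞ ζ) (hc : HasCompactSupport ζ) (hs : tsupport ζ ⊆ Set.Ioi 0) :
    ∫ x, deriv ζ ‖x‖ * ‖x‖⁻¹ * u x = -∫ x, ζ ‖x‖ * ‖x‖⁻¹ * ∑ i, x i / ‖x‖ * w i x := by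
  set η : Fin 2 → 𝓓(puncturedPlane, ℝ) := fun i =>
    (radialTestFunction ζ hζ hc hs).mulContDiffOn _ (IsSymbol.kelvin i).contDiffOn with hη
  have e : ∀ i, ∫ x, (∂_{basisVec i} (η i) : 𝓓(puncturedPlane, ℝ)) x * u x =
      -∫ x, η i x * w i x := by
    intro i
    have := (h i).eq (η i)
    rwa [testDeriv_single, sum_single_one, pow_one, neg_one_mul] at this
  have s := Finset.sum_congr (s₁ := Finset.univ) rfl fun i _ => e i
  rw [← integral_finsetSum _ fun i _ => TestFunction.integrable_mul (h i).left _,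
    Finset.sum_neg_distrib,
    ← integral_finsetSum _ fun i _ => TestFunction.integrable_mul (h i).right _] at s
  refine (integral_congr_ae ?_).trans (s.trans (congrArg _ (integral_congr_ae ?_)))
  · filter_upwards [ae_ne_zero_plane] with x hx
    have hn : ‖x‖ ≠ 0 := norm_ne_zero_iff.2 hx
    simp only [hη, TestFunction.lineDeriv_mulContDiffOn, fderiv_kelvin _ hx,
      lineDeriv_radialTestFunction hζ hc hs _ hx]
    have hζx : (radialTestFunction ζ hζ hc hs) x = ζ ‖x‖ := rfl
    rw [← Finset.sum_mul, hζx]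
    congr 1
    have h2 := sum_coord_sq x
    have h3 : x 0 * x 0 = ‖x‖ ^ 2 - x 1 * x 1 := by
      rw [Fin.sum_univ_two] at h2; linarith
    rw [Fin.sum_univ_two]
    have e1 : deriv ζ ‖x‖ * (x 0 / ‖x‖) * (x 0 * ‖x‖⁻¹ ^ 2) = deriv ζ ‖x‖ * ‖x‖⁻¹ ^ 3 * (x 0 * x 0) := by
      ring
    rw [e1, h3]
    field_simp
    ring
  · filter_upwards with x
    have hζx : ∀ i, η i x = ζ ‖x‖ * (x i * ‖x‖⁻¹ ^ 2) := fun i => rfl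
    simp only [hζx]
    rw [Finset.mul_sum]
    refine Finset.sum_congr rfl fun i _ => ?_
    ring

/-- The profile of a radial function with weak first derivatives is a primitive. -/
lemma exists_isPrimitive_of_hasWeakDeriv {g : ℝ → ℝ} {w : Fin 2 → Plane → ℝ}
    (h : ∀ i, HasWeakDeriv puncturedPlane (Pi.single i 1) (fun x => g ‖x‖) (w i)) :
    ∃ g' h' : ℝ → ℝ, IsPrimitive g' h' ∧ g' =ᵐ[volume.restrict (Set.Ioi 0)] g := by
  set H : Plane → ℝ := fun x => ∑ i, x i / ‖x‖ * w i x with hH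
  have hHl : LocallyIntegrableOn H puncturedPlane volume := by
    have : ∀ i, LocallyIntegrableOn (fun x => x i / ‖x‖ * w i x) puncturedPlane volume := fun i =>
      (h i).right.continuousOn_mul (IsSymbol.direction i).contDiffOn.continuousOn
        puncturedPlane.isOpen.isLocallyClosed
    simp only [hH, Fin.sum_univ_two]
    exact (this 0).add (this 1)
  have hgl : LocallyIntegrableOn g (Set.Ioi 0) volume :=
    locallyIntegrableOn_norm_iff.1 (h 0).left
  have hlen := circleLength_pos
  -- The candidate derivative is the angular mean of the radial component of the weak gradient.
  set h' : ℝ → ℝ := fun r => circleLength⁻¹ * circleIntegralAngle H r with hh'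
  have hl' : LocallyIntegrableOn h' (Set.Ioi 0) volume :=
    (locallyIntegrableOn_circleIntegralAngle hHl).smul circleLength⁻¹
  have P := IsPrimitive.of_locallyIntegrableOn 0 hl'
  set g0 : ℝ → ℝ := fun r => 0 + ∫ t in (1 : ℝ)..r, h' t with hg0
  have hg0l : LocallyIntegrableOn g0 (Set.Ioi 0) volume :=
    P.continuousOn.locallyIntegrableOn measurableSet_Ioi
  have prodInt : ∀ {ζ k : ℝ → ℝ}, Continuous ζ → HasCompactSupport ζ → tsupport ζ ⊆ Set.Ioi 0 →
      LocallyIntegrableOn k (Set.Ioi 0) volume → Integrable (fun r => ζ r * k r) volume := by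
    intro ζ k hζ hc hs hk
    exact (integrableOn_iff_integrable_of_support_subset
      ((Function.support_mul_subset_left _ _).trans (subset_tsupport ζ))).1
      ((hk.integrableOn_compact_subset hs hc.isCompact).continuousOn_mul hζ.continuousOn
        hc.isCompact)
  -- Both g and the indefinite integral of h' have h' as distributional derivative, so they differ
  -- by a constant almost everywhere.
  obtain ⟨c, hc⟩ := exists_ae_eq_const_of_integral_deriv_mul_eq_zero
    (k := fun r => g r - g0 r) (hgl.sub hg0l) (fun Z z1 z2 z3 => by
      have z4 : tsupport (deriv Z) ⊆ Set.Ioi 0 := tsupport_deriv_subset.trans z3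
      have zc : Continuous (deriv Z) := z1.continuous_deriv (by simp)
      have k1 := P.integral_deriv_mul z1 z2 z3
      have k2 := integral_radial_test h z1 z2 z3
      have hzero : ∀ {F : ℝ → ℝ} {k : ℝ → ℝ}, tsupport F ⊆ Set.Ioi 0 →
          ∫ r in Set.Ioi (0 : ℝ), F r * k r = ∫ r, F r * k r := by
        intro F k hF
        refine setIntegral_eq_integral_of_forall_compl_eq_zero fun r hr => ?_
        rw [image_eq_zero_of_notMem_tsupport fun h => hr (hF h), zero_mul]
      have l1 : ∫ x : Plane, deriv Z ‖x‖ * ‖x‖⁻¹ * g ‖x‖ =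
          circleLength * ∫ r, deriv Z r * g r := by
        rw [integral_norm (fun r => deriv Z r * r⁻¹ * g r), ← hzero z4]
        congr 1
        refine setIntegral_congr_fun measurableSet_Ioi fun r hr => ?_
        have : r ≠ 0 := ne_of_gt hr
        field_simp
      have l2 : ∫ x, Z ‖x‖ * ‖x‖⁻¹ * H x = circleLength * ∫ r, Z r * h' r := by
        have i1 : Integrable (fun x : Plane => Z ‖x‖ * ‖x‖⁻¹ * H x) volume := by
          have : Integrable (fun x => (radialTestFunction Z z1 z2 z3) x * (‖x‖⁻¹ * H x)) volume := by
            refine TestFunction.integrable_mul (hHl.continuousOn_mul ?_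
              puncturedPlane.isOpen.isLocallyClosed) _
            exact continuous_norm.continuousOn.inv₀ fun x hx => norm_ne_zero_iff.2 hx
          exact this.congr (Eventually.of_forall fun x => (mul_assoc _ _ _).symm)
        rw [(integral_polar i1).2, ← hzero z3, ← integral_const_mul]
        refine setIntegral_congr_fun measurableSet_Ioi fun r hr => ?_
        rw [circleIntegralAngle_radial_mul (fun r => Z r * r⁻¹) H hr]
        have : r ≠ 0 := ne_of_gt hr
        simp only [hh']
        field_simp
      rw [l1, l2] at k2
      have k3 : ∫ r, deriv Z r * g r = -∫ r, Z r * h' r := by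
        have : circleLength * (∫ r, deriv Z r * g r) = circleLength * (-∫ r, Z r * h' r) := by
          linarith
        exact mul_left_cancel₀ hlen.ne' this
      have e : ∫ r, deriv Z r * (g r - g0 r) =
          (∫ r, deriv Z r * g r) - ∫ r, deriv Z r * g0 r := by
        rw [← integral_sub (prodInt zc z2.deriv z4 hgl) (prodInt zc z2.deriv z4 hg0l)]
        exact integral_congr_ae (Eventually.of_forall fun r => by ring)
      rw [e, k1, k3, sub_self])
  refine ⟨_, h', IsPrimitive.of_locallyIntegrableOn c hl', ?_⟩
  rw [EventuallyEq, ae_restrict_iff' measurableSet_Ioi]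
  filter_upwards [hc] with r hr hr0
  have := hr hr0
  simp only [hg0] at this
  linarith

/-- A primitive gives a radial function with the expected weak first derivatives. -/
lemma IsPrimitive.hasWeakDeriv {g h : ℝ → ℝ} (hg : IsPrimitive g h) (i : Fin 2) :
    HasWeakDeriv puncturedPlane (Pi.single i 1) (fun x => g ‖x‖)
      (fun x => x i / ‖x‖ * h ‖x‖) := by
  have hdir : ∀ {k : ℝ → ℝ}, LocallyIntegrableOn k (Set.Ioi 0) volume →
      LocallyIntegrableOn (fun x : Plane => x i / ‖x‖ * k ‖x‖) puncturedPlane volume := fun hk =>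
    (locallyIntegrableOn_norm_iff.2 hk).continuousOn_mul
      (IsSymbol.direction i).contDiffOn.continuousOn puncturedPlane.isOpen.isLocallyClosed
  have hrad : ∀ {k k' : ℝ → ℝ}, IsPrimitive k k' →
      LocallyIntegrableOn (fun x : Plane => k ‖x‖) puncturedPlane volume := fun hk =>
    locallyIntegrableOn_norm_iff.2 (hk.continuousOn.locallyIntegrableOn measurableSet_Ioi)
  refine ⟨hrad hg, hdir hg.locallyIntegrableOn, fun η => ?_⟩
  rw [testDeriv_single, sum_single_one, pow_one, neg_one_mul, ← sub_eq_zero, sub_neg_eq_add]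
  obtain ⟨a, b, ha, hab, hsub⟩ : ∃ a b : ℝ, 0 < a ∧ a < b ∧
      ∀ x ∈ tsupport η, ‖x‖ ∈ Set.Icc a b := by
    rcases (tsupport η).eq_empty_or_nonempty with h | h
    · exact ⟨1, 2, one_pos, one_lt_two, by simp [h]⟩
    · have hne := h.image (fun x : Plane => ‖x‖)
      have hcp := η.hasCompactSupport.isCompact.image (continuous_norm (E := Plane))
      obtain ⟨a, ⟨x, hx, hxa⟩, hmin⟩ := hcp.exists_isLeast hne
      obtain ⟨b, hb, hmax⟩ := hcp.exists_isGreatest hne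
      refine ⟨a, b + 1, ?_, by linarith [hmin hb], fun y hy => ⟨hmin ⟨y, hy, rfl⟩, ?_⟩⟩
      · rw [← hxa]; exact norm_pos_iff.2 (η.tsupport_subset hx)
      · linarith [hmax ⟨y, hy, rfl⟩]
  have hb : 0 < b := ha.trans hab
  have hz : ∀ x, ‖x‖ ∉ Set.Icc a b → η x = 0 := fun x hx =>
    image_eq_zero_of_notMem_tsupport fun h => hx (hsub x h)
  have hz' : ∀ x, ‖x‖ ∉ Set.Icc a b → (∂_{basisVec i} η : 𝓓(puncturedPlane, ℝ)) x = 0 := by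
    intro x hx
    rw [TestFunction.lineDeriv_apply_eq_fderiv]
    have : fderiv ℝ η x = 0 :=
      (notMem_tsupport_iff_eventuallyEq.1 fun h => hx (hsub x h)).fderiv_eq.trans (by simp)
    rw [this]; rfl
  obtain ⟨B, hB⟩ := η.continuous.bounded_above_of_compact_support η.hasCompactSupport
  have hB0 : 0 ≤ B := (norm_nonneg _).trans (hB 0)
  set A := ∫ x, ‖(∂_{basisVec i} η : 𝓓(puncturedPlane, ℝ)) x‖ with hA
  have hA0 : 0 ≤ A := integral_nonneg fun _ => norm_nonneg _
  have hIh : IntegrableOn h (Set.Icc a b) :=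
    hg.locallyIntegrableOn.integrableOn_compact_subset (fun x hx => ha.trans_le hx.1) isCompact_Icc
  set D := (∫ x, (∂_{basisVec i} η : 𝓓(puncturedPlane, ℝ)) x * g ‖x‖) +
    ∫ x, η x * (x i / ‖x‖ * h ‖x‖) with hD
  -- D is the defect in the weak derivative identity. Approximating h in L¹ on [a, b] by a
  -- continuous k gives a C¹ primitive K for which the identity is classical. Since K(a) = g(a), |g
  -- - K| ≤ ε on [a, b], and D is bounded by a multiple of ε that does not depend on k.
  have bound : ∀ ε : ℝ, 0 < ε → |D| ≤ ε * (A + B * (circleLength * b)) := by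
    intro ε hε
    obtain ⟨k, -, hk, hkc, hki⟩ :=
      (hIh.integrable_indicator measurableSet_Icc).exists_hasCompactSupport_integral_sub_le hε
    have hIsub : IntegrableOn (fun r => ‖h r - k r‖) (Set.Icc a b) :=
      (hIh.sub hkc.integrableOn_Icc).norm
    have hε1 : ∫ t in Set.Icc a b, ‖h t - k t‖ ≤ ε := by
      refine le_trans (le_of_eq ?_) ((setIntegral_le_integral
        ((hIh.integrable_indicator measurableSet_Icc).sub hki).norm
        (Eventually.of_forall fun _ => norm_nonneg _) (s := Set.Icc a b)).trans hk)
      refine setIntegral_congr_fun measurableSet_Icc fun t ht => ?_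
      simp [ht]
    set K : ℝ → ℝ := fun r => g a + ∫ t in a..r, k t with hK
    have hKd : ∀ r, HasDerivAt K (k r) r := fun r =>
      (intervalIntegral.integral_hasDerivAt_right (hkc.intervalIntegrable _ _)
        hkc.aestronglyMeasurable.stronglyMeasurableAtFilter hkc.continuousAt).const_add (g a)
    have PK : IsPrimitive K k := IsPrimitive.of_hasDerivAt (fun r _ => hKd r)
      (hkc.locallyIntegrable.locallyIntegrableOn _)
    have W : HasWeakDeriv puncturedPlane (Pi.single i 1) (fun x => K ‖x‖)
        (fun x => x i / ‖x‖ * k ‖x‖) := by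
      refine HasWeakDeriv.of_hasFDerivAt
        (fun x hx => (hKd ‖x‖).comp_hasFDerivAt x (hasFDerivAt_norm_plane hx)) (fun x hx => ?_) ?_
      · simp [inner_basisVec, div_eq_inv_mul, mul_comm]
      · exact (IsSymbol.direction i).contDiffOn.continuousOn.mul
          (hkc.comp continuous_norm).continuousOn
    have eK := W.eq η
    rw [testDeriv_single, sum_single_one, pow_one, neg_one_mul] at eK
    have hdiff : ∀ r ∈ Set.Icc a b, |g r - K r| ≤ ε := by
      intro r hr
      have i1 := hg.intervalIntegrable ha (ha.trans_le hr.1)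
      have i2 : IntervalIntegrable k volume a r := hkc.intervalIntegrable _ _
      have : g r - K r = ∫ t in a..r, (h t - k t) := by
        rw [intervalIntegral.integral_sub i1 i2, ← hg.sub_eq a r ha (ha.trans_le hr.1)]
        simp only [hK]; ring
      rw [this, ← Real.norm_eq_abs]
      refine (intervalIntegral.norm_integral_le_integral_norm hr.1).trans (le_trans ?_ hε1)
      rw [intervalIntegral.integral_of_le hr.1]
      exact setIntegral_mono_set hIsub
        (Eventually.of_forall fun _ => norm_nonneg _)
        (Set.Ioc_subset_Icc_self.trans (Set.Icc_subset_Icc_right hr.2)).eventuallyLE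
    have j1 := TestFunction.integrable_mul (hrad hg) (∂_{basisVec i} η)
    have j2 := TestFunction.integrable_mul (hdir hg.locallyIntegrableOn) η
    have j3 := TestFunction.integrable_mul W.left (∂_{basisVec i} η)
    have j4 := TestFunction.integrable_mul W.right η
    have hDeq : D = (∫ x, (∂_{basisVec i} η : 𝓓(puncturedPlane, ℝ)) x * (g ‖x‖ - K ‖x‖)) +
        ∫ x, η x * (x i / ‖x‖ * (h ‖x‖ - k ‖x‖)) := by
      have e1 : ∫ x, (∂_{basisVec i} η : 𝓓(puncturedPlane, ℝ)) x * (g ‖x‖ - K ‖x‖) =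
          (∫ x, (∂_{basisVec i} η : 𝓓(puncturedPlane, ℝ)) x * g ‖x‖) -
            ∫ x, (∂_{basisVec i} η : 𝓓(puncturedPlane, ℝ)) x * K ‖x‖ := by
        rw [← integral_sub j1 j3]
        exact integral_congr_ae (Eventually.of_forall fun x => by ring)
      have e2 : ∫ x, η x * (x i / ‖x‖ * (h ‖x‖ - k ‖x‖)) =
          (∫ x, η x * (x i / ‖x‖ * h ‖x‖)) - ∫ x, η x * (x i / ‖x‖ * k ‖x‖) := by
        rw [← integral_sub j2 j4]
        exact integral_congr_ae (Eventually.of_forall fun x => by ring)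
      rw [e1, e2, eK, hD]
      ring
    have b1 : |∫ x, (∂_{basisVec i} η : 𝓓(puncturedPlane, ℝ)) x * (g ‖x‖ - K ‖x‖)| ≤ ε * A := by
      rw [← Real.norm_eq_abs, hA, ← integral_const_mul]
      refine norm_integral_le_of_norm_le ((∂_{basisVec i} η : 𝓓(puncturedPlane, ℝ)).continuous
        |>.integrable_of_hasCompactSupport
          (∂_{basisVec i} η : 𝓓(puncturedPlane, ℝ)).hasCompactSupport |>.norm.const_mul ε)
        (Eventually.of_forall fun x => ?_)
      by_cases hx : ‖x‖ ∈ Set.Icc a b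
      · rw [norm_mul, mul_comm]
        exact mul_le_mul_of_nonneg_right (hdiff _ hx) (norm_nonneg _)
      · rw [hz' x hx]; simp
    have iind : Integrable (fun x : Plane =>
        (Set.Icc a b).indicator (fun r => ‖h r - k r‖) ‖x‖) volume := by
      rw [integrable_norm_iff]
      have : IntegrableOn (fun r => r * ‖h r - k r‖) (Set.Icc a b) :=
        hIsub.continuousOn_mul continuousOn_id isCompact_Icc
      refine (this.integrable_indicator measurableSet_Icc).integrableOn.congr
        (Eventually.of_forall fun r => ?_)
      by_cases hr : r ∈ Set.Icc a b <;> simp [Set.indicator, hr]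
    have b2 : |∫ x, η x * (x i / ‖x‖ * (h ‖x‖ - k ‖x‖))| ≤ B * (circleLength * (b * ε)) := by
      have c1 : ∫ x : Plane, (Set.Icc a b).indicator (fun r => ‖h r - k r‖) ‖x‖ ≤
          circleLength * (b * ε) := by
        rw [integral_norm]
        refine mul_le_mul_of_nonneg_left ?_ circleLength_pos.le
        have : ∫ r in Set.Ioi (0 : ℝ), r * (Set.Icc a b).indicator (fun r => ‖h r - k r‖) r =
            ∫ r in Set.Icc a b, r * ‖h r - k r‖ := by
          rw [← integral_indicator measurableSet_Ioi, ← integral_indicator measurableSet_Icc]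
          refine integral_congr_ae (Eventually.of_forall fun r => ?_)
          by_cases hr : r ∈ Set.Icc a b
          · have : 0 < r := ha.trans_le hr.1
            simp [Set.indicator, hr, this]
          · simp [Set.indicator, hr]
        rw [this]
        refine le_trans ?_ (mul_le_mul_of_nonneg_left hε1 hb.le)
        rw [← integral_const_mul]
        refine setIntegral_mono_on
          (hIsub.continuousOn_mul continuousOn_id isCompact_Icc)
          (hIsub.const_mul b) measurableSet_Icc fun r hr => ?_
        exact mul_le_mul_of_nonneg_right hr.2 (norm_nonneg _)
      refine le_trans ?_ (mul_le_mul_of_nonneg_left c1 hB0)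
      rw [← Real.norm_eq_abs, ← integral_const_mul]
      refine norm_integral_le_of_norm_le (iind.const_mul B) (Eventually.of_forall fun x => ?_)
      by_cases hx : ‖x‖ ∈ Set.Icc a b
      · rw [Set.indicator_of_mem hx, norm_mul, norm_mul]
        have hdirle : ‖x i / ‖x‖‖ ≤ 1 := by
          rw [norm_div, norm_norm]
          exact div_le_one_of_le₀ (abs_coord_le_norm x i) (norm_nonneg _)
        calc ‖η x‖ * (‖x i / ‖x‖‖ * ‖h ‖x‖ - k ‖x‖‖) ≤ B * (1 * ‖h ‖x‖ - k ‖x‖‖) := by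
              gcongr; exact hB x
          _ = _ := by rw [one_mul]
      · rw [hz x hx, Set.indicator_of_notMem hx]; simp
    rw [hDeq]
    calc _ ≤ ε * A + B * (circleLength * (b * ε)) := (abs_add_le _ _).trans (add_le_add b1 b2)
      _ = _ := by ring
  by_contra hne
  have hpos : 0 < |D| := abs_pos.2 hne
  set S := A + B * (circleLength * b) with hS
  have hS0 : 0 ≤ S := add_nonneg hA0 (mul_nonneg hB0 (mul_nonneg circleLength_pos.le hb.le))
  -- This ε gives |D| ≤ |D| S / (2 (S + 1)), which is impossible unless D = 0.
  have := bound (|D| / (2 * (S + 1))) (by positivity)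
  rw [div_mul_eq_mul_div, le_div_iff₀ (by positivity)] at this
  nlinarith

end RadialWeakDeriv

/-! ### Radial functions in weighted Sobolev spaces and their profiles -/

section Profiles

variable {χ : ℝ → ℝ} {γ τ : ℝ} {n : ℕ}

/-- Each first derivative of g(|x|) is x_i/|x| times the next profile, and the direction is a symbol
of order 0, so it costs no weight. -/
lemma RadialReg.puncturedSobolev (hχ : IsRadialCutoff χ) {g : ℝ → ℝ} (hg : RadialReg γ n τ g) :
    PuncturedSobolev χ γ n τ (fun x => g ‖x‖) := by
  induction n generalizing τ g with
  | zero => exact (memLp_doubleWeight_norm_iff hχ).2 hg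
  | succ n ih =>
    obtain ⟨h0, h, hp, hr⟩ := hg
    refine ⟨(memLp_doubleWeight_norm_iff hχ).2 h0, fun i => ⟨_, hp.hasWeakDeriv i, ?_⟩⟩
    simpa using (ih hr).symbol_mul hχ (IsSymbol.direction i)

lemma HasWeakDeriv.ae_eq_of_isPrimitive {v w : Plane → ℝ} {g h : ℝ → ℝ} {i : Fin 2}
    (hw : HasWeakDeriv puncturedPlane (Pi.single i 1) v w)
    (hv : v =ᵐ[volume] fun x => g ‖x‖) (hg : IsPrimitive g h) :
    w =ᵐ[volume] fun x => x i / ‖x‖ * h ‖x‖ := by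
  have := (hw.congr hv.symm EventuallyEq.rfl).unique (hg.hasWeakDeriv i)
  filter_upwards [this, ae_ne_zero_plane] with x hx hx0 using hx hx0

/-- By uniqueness the weak gradient is h(|x|) x/|x|; contracting with the unit vector x/|x| leaves
h. -/
lemma sum_direction_mul_ae_eq {v : Plane → ℝ} {w : Fin 2 → Plane → ℝ} {g h : ℝ → ℝ}
    (hw : ∀ i, HasWeakDeriv puncturedPlane (Pi.single i 1) v (w i))
    (hv : v =ᵐ[volume] fun x => g ‖x‖) (hg : IsPrimitive g h) :
    (fun x => ∑ i, x i / ‖x‖ * w i x) =ᵐ[volume] fun x => h ‖x‖ := by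
  filter_upwards [(hw 0).ae_eq_of_isPrimitive hv hg, (hw 1).ae_eq_of_isPrimitive hv hg,
    ae_ne_zero_plane] with x h0 h1 hx
  have := sum_direction_sq hx
  rw [Fin.sum_univ_two] at this ⊢
  rw [h0, h1]
  linear_combination h ‖x‖ * this

/-- The induction passes to the radial derivative: it has one order of regularity less, because
directions are symbols of order 0, and it is again radial almost everywhere. The profile it yields
may replace the derivative of g', since primitives only see it up to null sets. -/
lemma PuncturedSobolev.exists_radialReg (hχ : IsRadialCutoff χ) {v : Plane → ℝ} {g : ℝ → ℝ}
    (hv : PuncturedSobolev χ γ n τ v) (e : v =ᵐ[volume] fun x => g ‖x‖) :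
    ∃ g', RadialReg γ n τ g' ∧ v =ᵐ[volume] fun x => g' ‖x‖ := by
  induction n generalizing τ v g with
  | zero =>
    refine ⟨g, (memLp_doubleWeight_norm_iff hχ).1 (MemLp.ae_eq ?_ hv.memLp), e⟩
    exact e.mono fun x hx => by simp [hx]
  | succ n ih =>
    obtain ⟨hm, hd⟩ := hv
    choose w hw hs using hd
    obtain ⟨g', h', hp, hgg⟩ := exists_isPrimitive_of_hasWeakDeriv
      (fun i => (hw i).congr e.symm EventuallyEq.rfl)
    have e' : v =ᵐ[volume] fun x => g' ‖x‖ := by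
      filter_upwards [e, ae_norm_iff (P := fun r => g' r = g r).2 hgg] with x hx hx'
      rw [hx, hx']
    have hH : PuncturedSobolev χ γ n (τ + 1) (fun x => ∑ i, x i / ‖x‖ * w i x) := by
      have h0 := (hs 0).symbol_mul hχ (IsSymbol.direction 0)
      have h1 := (hs 1).symbol_mul hχ (IsSymbol.direction 1)
      simp only [Nat.cast_zero, add_zero] at h0 h1
      refine (h0.add h1).congr (Eventually.of_forall fun x => ?_)
      simp [Fin.sum_univ_two]
    have eH := sum_direction_mul_ae_eq hw e' hp
    obtain ⟨h'', hr, eH'⟩ := ih hH eH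
    have ehh : ∀ᵐ r ∂volume.restrict (Set.Ioi (0 : ℝ)), h'' r = h' r :=
      ae_norm_iff.1 ((eH'.symm.trans eH))
    refine ⟨g', ⟨(memLp_doubleWeight_norm_iff hχ).1 (MemLp.ae_eq ?_ hm), h'',
      hp.congr (fun _ _ => rfl) ehh, hr⟩, e'⟩
    exact e'.mono fun x hx => by simp [hx]

end Profiles

/-! ### Completeness of the radial Sobolev space and its description by profiles -/

namespace SobolevData

variable {χ : ℝ → ℝ} {γ σ : ℝ} {s : ℕ}

lemma doubleWeight_mul_component (hχ : IsRadialCutoff χ) (G : SobolevData s) (α : MultiIndex s) :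
    (fun x => doubleWeight χ γ (σ + ((∑ i, α.1 i : ℕ) : ℝ)) x * G.component χ γ σ α x)
      =ᵐ[volume] G α := by
  filter_upwards [ae_ne_zero_plane] with x hx
  exact mul_div_cancel₀ _ (doubleWeight_pos hχ _ _ hx).ne'

lemma memLp_component (hχ : IsRadialCutoff χ) (G : SobolevData s) (α : MultiIndex s) :
    MemLp (fun x => doubleWeight χ γ (σ + ((∑ i, α.1 i : ℕ) : ℝ)) x * G.component χ γ σ α x) 2
      volume :=
  (Lp.memLp (G α)).ae_eq (doubleWeight_mul_component hχ G α).symm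

lemma locallyIntegrableOn_component (hχ : IsRadialCutoff χ) (G : SobolevData s)
    (α : MultiIndex s) :
    LocallyIntegrableOn (G.component χ γ σ α) puncturedPlane volume :=
  locallyIntegrableOn_of_doubleWeight_mul hχ (memLp_component hχ G α)

lemma tendsto_apply {G : ℕ → SobolevData s} {G₀ : SobolevData s} (h : Tendsto G atTop (𝓝 G₀))
    (α : MultiIndex s) : Tendsto (fun n => G n α) atTop (𝓝 (G₀ α)) :=
  ((PiLp.continuous_apply 1 _ α).tendsto G₀).comp h

/-- Convergence in L² gives an almost everywhere convergent subsequence for one multi-index; since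
there are finitely many, extracting successively serves all of them. -/
lemma exists_subseq_ae_tendsto {G : ℕ → SobolevData s} {G₀ : SobolevData s}
    (h : Tendsto G atTop (𝓝 G₀)) :
    ∃ ns : ℕ → ℕ, StrictMono ns ∧ ∀ α : MultiIndex s,
      ∀ᵐ x, Tendsto (fun n => (G (ns n) α : Plane → ℝ) x) atTop (𝓝 ((G₀ α : Plane → ℝ) x)) := by
  classical
  have key : ∀ S : Finset (MultiIndex s), ∃ ns : ℕ → ℕ, StrictMono ns ∧ ∀ α ∈ S,
      ∀ᵐ x, Tendsto (fun n => (G (ns n) α : Plane → ℝ) x) atTop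
        (𝓝 ((G₀ α : Plane → ℝ) x)) := by
    intro S
    induction S using Finset.induction_on with
    | empty => exact ⟨id, strictMono_id, by simp⟩
    | insert β S _ ih =>
      obtain ⟨ns, hns, hS⟩ := ih
      have ht := (tendsto_apply h β).comp hns.tendsto_atTop
      obtain ⟨ms, hms, hβ⟩ := (tendstoInMeasure_of_tendsto_Lp ht).exists_seq_tendsto_ae
      refine ⟨ns ∘ ms, hns.comp hms, fun α hα => ?_⟩
      rcases Finset.mem_insert.1 hα with rfl | hα
      · exact hβ
      · filter_upwards [hS α hα] with x hx using hx.comp hms.tendsto_atTop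
  obtain ⟨ns, hns, h⟩ := key Finset.univ
  exact ⟨ns, hns, fun α => h α (Finset.mem_univ α)⟩

end SobolevData

/-- Integration against a square integrable function as a functional on `L²`. -/
lemma exists_L2_functional {k : Plane → ℝ} (hk : MemLp k 2 volume) :
    ∃ ℓ : Lp ℝ 2 (volume : Measure Plane) →L[ℝ] ℝ, ∀ G : Lp ℝ 2 (volume : Measure Plane),
      ℓ G = ∫ x, k x * G x := by
  refine ⟨innerSL ℝ hk.toLp, fun G => ?_⟩
  rw [innerSL_apply_apply, L2.inner_def]
  refine integral_congr_ae ?_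
  filter_upwards [hk.coeFn_toLp] with x hx
  rw [hx]
  simp [mul_comm]

namespace RadialSobolev

variable {χ : ℝ → ℝ} {s : ℕ} {γ σ : ℝ}

/-- A test function is supported away from the origin, so dividing it by the weight leaves an L²
function and the pairing is continuous on L². -/
lemma tendsto_integral_component (hχ : IsRadialCutoff χ) {G : ℕ → SobolevData s}
    {G₀ : SobolevData s} (h : Tendsto G atTop (𝓝 G₀)) (α : MultiIndex s)
    (η : 𝓓(puncturedPlane, ℝ)) :
    Tendsto (fun n => ∫ x, η x * (G n).component χ γ σ α x) atTop
      (𝓝 (∫ x, η x * G₀.component χ γ σ α x)) := by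
  have hk : MemLp (fun x => η x * (doubleWeight χ γ (σ + ((∑ i, α.1 i : ℕ) : ℝ)) x)⁻¹) 2
      volume := by
    have hc : Continuous (fun x =>
        η x * (doubleWeight χ γ (σ + ((∑ i, α.1 i : ℕ) : ℝ)) x)⁻¹) := by
      rw [continuous_iff_continuousAt]
      intro x
      by_cases hx : x ∈ tsupport η
      · exact η.continuous.continuousAt.mul ((continuousOn_doubleWeight_inv hχ _ _).continuousAt
          (puncturedPlane.isOpen.mem_nhds (η.tsupport_subset hx)))
      · refine (continuousAt_const (y := (0 : ℝ))).congr ?_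
        filter_upwards [notMem_tsupport_iff_eventuallyEq.1 hx] with y hy
        simp [hy]
    exact hc.memLp_of_hasCompactSupport η.hasCompactSupport.mul_right
  obtain ⟨ℓ, hℓ⟩ := exists_L2_functional hk
  have e : ∀ H : SobolevData s, ∫ x, η x * H.component χ γ σ α x = ℓ (H α) := by
    intro H
    rw [hℓ]
    refine integral_congr_ae (Eventually.of_forall fun x => ?_)
    simp only [SobolevData.component, div_eq_mul_inv]
    ring
  simp only [e]
  exact (ℓ.continuous.tendsto _).comp (SobolevData.tendsto_apply h α)

/-- Closedness in a complete space gives completeness, on which the closed graph theorem below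
depends. Weak derivative identities pass to the limit in each pairing; radiality needs almost
everywhere convergence. -/
lemma isClosed_carrier (hχ : IsRadialCutoff χ) :
    IsClosed (RadialSobolev χ s γ σ : Set (SobolevData s)) := by
  refine IsSeqClosed.isClosed fun G G₀ hG hlim => ?_
  refine ⟨?_, fun α => ⟨SobolevData.locallyIntegrableOn_component hχ _ _,
    SobolevData.locallyIntegrableOn_component hχ _ _, fun η => ?_⟩⟩
  · choose g hg using fun n => (hG n).1
    obtain ⟨ns, -, hae⟩ := SobolevData.exists_subseq_ae_tendsto hlim
    -- The limiting profile is the pointwise limit of the profiles where it exists; `limUnder`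
    -- supplies some value at the remaining radii.
    refine ⟨fun r => limUnder atTop fun n => g (ns n) r, ?_⟩
    filter_upwards [hae (zeroIndex s), ae_all_iff.2 fun n => hg (ns n)] with x hx hgx
    refine (Tendsto.limUnder_eq ?_).symm
    simp only [← hgx]
    exact hx.div_const _
  · refine tendsto_nhds_unique (tendsto_integral_component hχ hlim (zeroIndex s) (testDeriv α.1 η))
      ?_
    refine ((tendsto_integral_component hχ hlim α η).const_mul ((-1) ^ ∑ i, α.1 i)).congr
      fun n => ?_
    exact (((hG n).2 α).eq η).symm

lemma completeSpace (hχ : IsRadialCutoff χ) : CompleteSpace (RadialSobolev χ s γ σ) :=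
  (isClosed_carrier hχ).completeSpace_coe

lemma toFun_add (u v : RadialSobolev χ s γ σ) : toFun (u + v) =ᵐ[volume] toFun u + toFun v :=
  SobolevData.component_add χ γ σ u.1 v.1 _

lemma toFun_smul (c : ℝ) (u : RadialSobolev χ s γ σ) : toFun (c • u) =ᵐ[volume] c • toFun u :=
  SobolevData.component_smul χ γ σ c u.1 _

lemma hasWeakDeriv (u : RadialSobolev χ s γ σ) (α : MultiIndex s) :
    HasWeakDeriv puncturedPlane α.1 (toFun u) (u.1.component χ γ σ α) := u.2.2 α

/-- Weak derivatives are unique, so the function alone determines the whole encoded family. Linear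
identities and graph limits can thus be checked on functions. -/
lemma toFun_injective (hχ : IsRadialCutoff χ) {u v : RadialSobolev χ s γ σ}
    (h : toFun u =ᵐ[volume] toFun v) : u = v := by
  apply Subtype.ext
  ext α : 1
  apply Lp.ext
  have e := (hasWeakDeriv u α).unique ((hasWeakDeriv v α).congr h EventuallyEq.rfl)
  filter_upwards [SobolevData.doubleWeight_mul_component (γ := γ) (σ := σ) hχ u.1 α,
    SobolevData.doubleWeight_mul_component (γ := γ) (σ := σ) hχ v.1 α, e, ae_ne_zero_plane]
    with x h1 h2 h3 hx
  rw [← h1, ← h2, h3 hx]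

lemma memLp_toFun (hχ : IsRadialCutoff χ) (u : RadialSobolev χ s γ σ) :
    MemLp (fun x => doubleWeight χ γ σ x * toFun u x) 2 volume := by
  have := SobolevData.memLp_component (γ := γ) (σ := σ) hχ u.1 (zeroIndex s)
  have e : σ + ((∑ i, (zeroIndex s).1 i : ℕ) : ℝ) = σ := by simp [zeroIndex]
  rwa [e] at this

lemma puncturedSobolev (hχ : IsRadialCutoff χ) (u : RadialSobolev χ s γ σ) :
    PuncturedSobolev χ γ s σ (toFun u) := by
  classical
  refine PuncturedSobolev.of_family (D := fun α =>
    if h : ∑ i, α i ≤ s then u.1.component χ γ σ ⟨α, h⟩ else 0) (fun α hα => ?_)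
    (fun α hα => ?_) ?_
  · simp only [hα, dif_pos]
    exact hasWeakDeriv u ⟨α, hα⟩
  · simp only [hα, dif_pos]
    exact SobolevData.memLp_component hχ u.1 ⟨α, hα⟩
  · have h0 : ∑ i, (0 : Fin 2 → ℕ) i ≤ s := by simp
    simp only [h0, dif_pos]
    exact EventuallyEq.rfl

/-- The profile of an element of the radial Sobolev space. -/
lemma exists_profile (hχ : IsRadialCutoff χ) (u : RadialSobolev χ s γ σ) :
    ∃ g, RadialReg γ s σ g ∧ toFun u =ᵐ[volume] fun x => g ‖x‖ := by
  obtain ⟨g, hg⟩ := u.2.1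
  exact (puncturedSobolev hχ u).exists_radialReg hχ hg

lemma exists_of_profile (hχ : IsRadialCutoff χ) {g : ℝ → ℝ} (hg : RadialReg γ s σ g) :
    ∃ u : RadialSobolev χ s γ σ, toFun u =ᵐ[volume] fun x => g ‖x‖ := by
  have hp := hg.puncturedSobolev hχ
  choose D hD hm using fun α : MultiIndex s => hp.exists_weakDeriv hχ α.1 α.2
  set G : SobolevData s := WithLp.toLp 1 (fun α => (hm α).toLp) with hG
  have hc : ∀ α, G.component χ γ σ α =ᵐ[volume] D α := by
    intro α
    filter_upwards [(hm α).coeFn_toLp, ae_ne_zero_plane] with x hx hx0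
    have : (G α : Plane → ℝ) x = _ := hx
    rw [SobolevData.component, this]
    exact mul_div_cancel_left₀ _ (doubleWeight_pos hχ _ _ hx0).ne'
  have h0 : D (zeroIndex s) =ᵐ[volume] fun x => g ‖x‖ := by
    have := (hD (zeroIndex s)).unique (HasWeakDeriv.refl (hp.locallyIntegrableOn hχ))
    filter_upwards [this, ae_ne_zero_plane] with x hx hx0 using hx hx0
  have h1 := (hc (zeroIndex s)).trans h0
  exact ⟨⟨G, ⟨g, h1⟩, fun α => (hD α).congr h1 (hc α)⟩, h1⟩

end RadialSobolev

/-! ### The operator `∂_r + 1/r - lam ∂_r φ₀` -/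

/-- `ψ` is a regular representative of `∂_r φ₀ - κ`. -/
structure PhaseProfile (γt : ℝ) (k : ℕ) (κ : ℝ) (φ₀ ψ : ℝ → ℝ) : Prop where
  radialReg : RadialReg γt k 0 ψ
  isPrimitive : IsPrimitive φ₀ (fun r => κ + ψ r)
  deriv_ae : deriv φ₀ =ᵐ[volume.restrict (Set.Ioi 0)] fun r => κ + ψ r
  exists_deriv : ∃ ψ₁, IsPrimitive ψ ψ₁ ∧ MemRadialL2 γt 0 ψ₁

lemma doubleWeight_zero (χ : ℝ → ℝ) (γ : ℝ) (x : Plane) :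
    doubleWeight χ γ 0 x = japaneseBracket x ^ γ := by
  simp [doubleWeight]

/-- The pointwise derivative of φ₀ need not be continuous. It agrees almost everywhere with κ plus a
continuous profile, and φ₀ is an indefinite integral of either. -/
lemma exists_phaseProfile {χ : ℝ → ℝ} (hχ : IsRadialCutoff χ) {γt κ : ℝ} {k : ℕ} (hk : 1 ≤ k)
    {φ₀ : ℝ → ℝ} (hdiff : ∀ r, 0 < r → DifferentiableAt ℝ φ₀ r)
    (hH : MemWeightedSobolev k γt (fun x => deriv φ₀ ‖x‖ - κ)) :
    ∃ ψ, PhaseProfile γt k κ φ₀ ψ := by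
  obtain ⟨ψ, hψ, e⟩ := (hH.puncturedSobolev hχ).exists_radialReg hχ
    (g := fun r => deriv φ₀ r - κ) EventuallyEq.rfl
  have hae : deriv φ₀ =ᵐ[volume.restrict (Set.Ioi 0)] fun r => κ + ψ r := by
    have := (ae_norm_iff (P := fun r => deriv φ₀ r - κ = ψ r)).1 e
    filter_upwards [this] with r hr
    rw [← hr]; ring
  obtain ⟨-, ψ₁, hp, -⟩ := hψ.of_le hk
  have hloc : LocallyIntegrableOn (deriv φ₀) (Set.Ioi 0) volume :=
    ((continuousOn_const.add hp.continuousOn).locallyIntegrableOn measurableSet_Ioi).congr hae.symm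
  -- Differentiability at every point together with local integrability of the derivative suffices
  -- for the fundamental theorem of calculus.
  have hφ : IsPrimitive φ₀ (deriv φ₀) :=
    IsPrimitive.of_hasDerivAt (fun r hr => (hdiff r hr).hasDerivAt) hloc
  refine ⟨ψ, hψ, hφ.congr (fun _ _ => rfl) hae.symm, hae, ψ₁, hp, ?_⟩
  -- `RadialReg` with weight 0 only gives ψ₁ weight 1 at the origin, which does not make r ψ₁
  -- integrable. The hypothesis concerns derivatives on the whole plane without powers of m, and
  -- this gives weight 0.
  choose D hD hm using fun i : Fin 2 => hH (Pi.single i 1) (by rw [sum_single_one]; exact hk)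
  have h0 : ∀ i, MemLp (fun x : Plane => x i / ‖x‖ * (doubleWeight χ γt 0 x * D i x)) 2 volume := by
    intro i
    have hDi : MemLp (fun x => doubleWeight χ γt 0 x * D i x) 2 volume := by
      simpa only [doubleWeight_zero] using hm i
    have := (PuncturedSobolev.symbol_mul (n := 0) (τ := 0) (v := D i) hχ
      (IsSymbol.direction i) hDi).memLp
    refine this.ae_eq (Eventually.of_forall fun x => ?_)
    simp only [Nat.cast_zero, add_zero]
    ring
  refine (memLp_doubleWeight_norm_iff hχ).1 (((h0 0).add (h0 1)).ae_eq ?_)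
  filter_upwards [sum_direction_mul_ae_eq (fun i => (hD i).mono le_top) e hp] with x hx
  rw [← hx, Fin.sum_univ_two, Pi.add_apply]
  ring

/-- The zeroth-order coefficient `1/r - lam (κ + ψ)`. -/
noncomputable def phasePotential (lam κ : ℝ) (ψ : ℝ → ℝ) (r : ℝ) : ℝ :=
  r⁻¹ - lam * (κ + ψ r)

section Profiles

variable {γ γt σ lam κ : ℝ} {k n : ℕ} {ψ g h f : ℝ → ℝ}

/-- The term 1/r costs one power of r, the constant costs none, and ψ, being regular with weight 0,
costs one by the product rule. So V raises the weight by one and loses no derivative. -/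
lemma RadialReg.phasePotential_mul (hγt : -(1 / 2) ≤ γt) (hψ : RadialReg γt k 0 ψ) (hk : 1 ≤ k)
    (hnk : n ≤ k) (hg : RadialReg γ n σ g) :
    RadialReg γ n (σ + 1) (fun r => phasePotential lam κ ψ r * g r) := by
  have h1 := hg.inv_pow_mul 1
  have h2 := hg.weight_succ.const_mul (-(lam * κ))
  have h3 := (RadialReg.mul hγt hψ hg hnk le_rfl (Or.inl hk)).const_mul (-lam)
  rw [Nat.cast_one] at h1
  rw [add_zero] at h3
  refine ((h1.add h2).add h3).congr fun r _ => ?_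
  simp only [phasePotential, pow_one]
  ring

/-- Elliptic regularity for the first-order radial equation. -/
lemma RadialReg.of_phase_equation (hγt : -(1 / 2) ≤ γt) (hψ : RadialReg γt k 0 ψ) (hk : 1 ≤ k)
    (hnk : n ≤ k) (hf : RadialReg γ n (σ + 1) f) (hg : MemRadialL2 γ σ g)
    (hp : IsPrimitive g (fun r => f r - phasePotential lam κ ψ r * g r)) :
    RadialReg γ (n + 1) σ g := by
  -- Bootstrapping: in g' = f - V g the right side has as many derivatives as g, as long as f does,
  -- so g gains one at each round.
  have key : ∀ j, j ≤ n + 1 → RadialReg γ j σ g := by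
    intro j
    induction j with
    | zero => exact fun _ => hg
    | succ j ih =>
      intro hj
      have hj' : j ≤ n := by omega
      refine ⟨hg, _, hp, ?_⟩
      have := (hf.of_le hj').add
        ((RadialReg.phasePotential_mul (lam := lam) (κ := κ) hγt hψ hk (hj'.trans hnk)
          (ih (by omega))).const_mul (-1))
      exact this.congr fun r _ => by ring
  exact key _ le_rfl

end Profiles

namespace RadialSobolev

variable {χ : ℝ → ℝ} {s : ℕ} {γ σ γt lam κ : ℝ} {k : ℕ} {φ₀ ψ : ℝ → ℝ}

lemma phaseOperator_ae_eq (hs : 1 ≤ s) (hψ : PhaseProfile γt k κ φ₀ ψ)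
    {u : RadialSobolev χ s γ σ} {g h : ℝ → ℝ} (e : toFun u =ᵐ[volume] fun x => g ‖x‖)
    (hp : IsPrimitive g h) :
    phaseOperator hs lam φ₀ u =ᵐ[volume]
      fun x => h ‖x‖ + phasePotential lam κ ψ ‖x‖ * g ‖x‖ := by
  have hd := sum_direction_mul_ae_eq (fun i => hasWeakDeriv u (unitIndex hs i)) e hp
  filter_upwards [hd, e, ae_norm_iff.2 hψ.deriv_ae] with x h1 h2 h3
  simp only [phaseOperator, radialDeriv, phasePotential]
  rw [h1, h2, h3]
  ring

lemma phaseOperator_add (hs : 1 ≤ s) (u v : RadialSobolev χ s γ σ) :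
    phaseOperator hs lam φ₀ (u + v) =ᵐ[volume]
      phaseOperator hs lam φ₀ u + phaseOperator hs lam φ₀ v := by
  filter_upwards [toFun_add u v, SobolevData.component_add χ γ σ u.1 v.1 (unitIndex hs 0),
    SobolevData.component_add χ γ σ u.1 v.1 (unitIndex hs 1)] with x h0 h1 h2
  simp only [phaseOperator, radialDeriv, Fin.sum_univ_two, Pi.add_apply, Submodule.coe_add] at *
  rw [h0, h1, h2]
  ring

lemma phaseOperator_smul (hs : 1 ≤ s) (c : ℝ) (u : RadialSobolev χ s γ σ) :
    phaseOperator hs lam φ₀ (c • u) =ᵐ[volume] c • phaseOperator hs lam φ₀ u := by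
  filter_upwards [toFun_smul c u, SobolevData.component_smul χ γ σ c u.1 (unitIndex hs 0),
    SobolevData.component_smul χ γ σ c u.1 (unitIndex hs 1)] with x h0 h1 h2
  simp only [phaseOperator, radialDeriv, Fin.sum_univ_two, Pi.smul_apply, Submodule.coe_smul,
    smul_eq_mul] at *
  rw [h0, h1, h2]
  ring

lemma exists_phaseOperator_eq (hχ : IsRadialCutoff χ) (hs : 1 ≤ s) (hγt : -(1 / 2) ≤ γt)
    (hψ : PhaseProfile γt k κ φ₀ ψ) (hk : 1 ≤ k) (hsk : s - 1 ≤ k)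
    (u : RadialSobolev χ s γ σ) :
    ∃ f : RadialSobolev χ (s - 1) γ (σ + 1), toFun f =ᵐ[volume] phaseOperator hs lam φ₀ u := by
  obtain ⟨g, hg, e⟩ := exists_profile hχ u
  obtain ⟨n, rfl⟩ : ∃ n, s = n + 1 := ⟨s - 1, by omega⟩
  have hg' := hg
  obtain ⟨-, h, hp, hr⟩ := hg'
  obtain ⟨f, hf⟩ := exists_of_profile hχ
    (hr.add (RadialReg.phasePotential_mul (lam := lam) (κ := κ) hγt hψ.radialReg hk hsk hg.of_succ))
  exact ⟨f, hf.trans (phaseOperator_ae_eq hs hψ e hp).symm⟩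

/-- Boundedness comes from the closed graph theorem. The operator is a pointwise expression in u and
its first derivatives, so graph limits are identified along an almost everywhere convergent
subsequence. -/
lemma exists_continuousLinearMap (hχ : IsRadialCutoff χ) (hs : 1 ≤ s) (hγt : -(1 / 2) ≤ γt)
    (hψ : PhaseProfile γt k κ φ₀ ψ) (hk : 1 ≤ k) (hsk : s - 1 ≤ k) :
    ∃ L : RadialSobolev χ s γ σ →L[ℝ] RadialSobolev χ (s - 1) γ (σ + 1),
      ∀ u, toFun (L u) =ᵐ[volume] phaseOperator hs lam φ₀ u := by
  choose T hT using exists_phaseOperator_eq (lam := lam) (γ := γ) (σ := σ) hχ hs hγt hψ hk hsk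
  let L₀ : RadialSobolev χ s γ σ →ₗ[ℝ] RadialSobolev χ (s - 1) γ (σ + 1) :=
    { toFun := T
      map_add' := fun u v => toFun_injective hχ <|
        (hT _).trans <| (phaseOperator_add hs u v).trans <|
          (((hT u).add (hT v)).symm).trans (toFun_add _ _).symm
      map_smul' := fun c u => toFun_injective hχ <|
        (hT _).trans <| (phaseOperator_smul hs c u).trans <|
          ((hT u).const_smul c).symm.trans (toFun_smul _ _).symm }
  have := completeSpace (s := s) (γ := γ) (σ := σ) hχ
  have := completeSpace (s := s - 1) (γ := γ) (σ := σ + 1) hχ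
  suffices hc : Continuous L₀ from ⟨⟨L₀, hc⟩, hT⟩
  refine LinearMap.continuous_of_seq_closed_graph _ fun u x y hu hy => ?_
  refine toFun_injective hχ ?_
  have hu' : Tendsto (fun n => (u n).1) atTop (𝓝 x.1) :=
    (continuous_subtype_val.tendsto x).comp hu
  obtain ⟨ns, hns, hx⟩ := SobolevData.exists_subseq_ae_tendsto hu'
  have hy' : Tendsto (fun n => (T (u (ns n))).1) atTop (𝓝 y.1) :=
    (continuous_subtype_val.tendsto y).comp (hy.comp hns.tendsto_atTop)
  -- A second extraction makes the images converge almost everywhere as well.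
  obtain ⟨ms, hms, hy''⟩ := SobolevData.exists_subseq_ae_tendsto hy'
  filter_upwards [hx (zeroIndex s), hx (unitIndex hs 0), hx (unitIndex hs 1),
    hy'' (zeroIndex (s - 1)), ae_all_iff.2 fun n => hT (u n), hT x] with z h0 h1 h2 h3 h4 h5
  have t0 : Tendsto (fun n => toFun (T (u (ns (ms n)))) z) atTop (𝓝 (toFun y z)) :=
    h3.div_const _
  have c0 := (h0.comp hms.tendsto_atTop).div_const (doubleWeight χ γ (σ +
    ((∑ i, (zeroIndex s).1 i : ℕ) : ℝ)) z)
  have c1 := (h1.comp hms.tendsto_atTop).div_const (doubleWeight χ γ (σ +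
    ((∑ i, (unitIndex hs 0).1 i : ℕ) : ℝ)) z)
  have c2 := (h2.comp hms.tendsto_atTop).div_const (doubleWeight χ γ (σ +
    ((∑ i, (unitIndex hs 1).1 i : ℕ) : ℝ)) z)
  have t1 : Tendsto (fun n => phaseOperator hs lam φ₀ (u (ns (ms n))) z) atTop
      (𝓝 (phaseOperator hs lam φ₀ x z)) := by
    simp only [phaseOperator, radialDeriv, Fin.sum_univ_two]
    exact (((c1.const_mul _).add (c2.const_mul _)).add (c0.div_const _)).sub (c0.const_mul _)
  have : toFun (L₀ x) z = toFun (T x) z := rfl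
  rw [this, h5]
  refine tendsto_nhds_unique t0 (t1.congr fun n => (h4 _).symm)

end RadialSobolev

/-! ### Schur test and weighted Hardy kernels -/

/-- The Schur test on `L²`. -/
lemma lintegral_sq_lintegral_le_of_schur {μ : Measure ℝ} [SFinite μ] {K : ℝ → ℝ → ENNReal}
    (hK : Measurable (Function.uncurry K)) {p : ℝ → ENNReal} (hp : Measurable p)
    (hp0 : ∀ᵐ r ∂μ, p r ≠ 0) (hp1 : ∀ᵐ r ∂μ, p r ≠ ⊤) {A : ENNReal}
    (h1 : ∀ᵐ r ∂μ, ∫⁻ t, K r t * p t ∂μ ≤ A * p r)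
    (h2 : ∀ᵐ t ∂μ, ∫⁻ r, K r t * p r ∂μ ≤ A * p t)
    {F : ℝ → ENNReal} (hF : AEMeasurable F μ) :
    ∫⁻ r, (∫⁻ t, K r t * F t ∂μ) ^ 2 ∂μ ≤ A ^ 2 * ∫⁻ t, F t ^ 2 ∂μ := by
  have hKr : ∀ r, Measurable (K r) := fun r => hK.comp measurable_prodMk_left
  have hKt : ∀ t, Measurable (fun r => K r t) := fun t => hK.comp measurable_prodMk_right
  have hQ : ∀ r, AEMeasurable (fun t => K r t * ((p t)⁻¹ * F t ^ 2)) μ := fun r =>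
    (hKr r).aemeasurable.mul (hp.inv.aemeasurable.mul (hF.pow_const 2))
  have step1 : ∀ᵐ r ∂μ, (∫⁻ t, K r t * F t ∂μ) ^ 2 ≤
      A * ∫⁻ t, p r * (K r t * ((p t)⁻¹ * F t ^ 2)) ∂μ := by
    filter_upwards [h1] with r hr
    -- Cauchy–Schwarz for the splitting K F = (K p)^{1/2} (K p⁻¹ F²)^{1/2}. The first factor is
    -- controlled by `h1`; after Tonelli the second is controlled by `h2`.
    have hCS := ENNReal.lintegral_mul_le_Lp_mul_Lq μ Real.HolderConjugate.two_two
      (f := fun t => (K r t * p t) ^ (1 / 2 : ℝ))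
      (g := fun t => (K r t * ((p t)⁻¹ * F t ^ 2)) ^ (1 / 2 : ℝ))
      (((hKr r).mul hp).pow_const _).aemeasurable
      ((hQ r).pow_const _)
    have half : ∀ x : ENNReal, (x ^ (1 / 2 : ℝ)) ^ (2 : ℝ) = x := fun x => by
      rw [← ENNReal.rpow_mul]; norm_num
    have half' : ∀ x : ENNReal, (x ^ (1 / 2 : ℝ)) ^ 2 = x := fun x => by
      rw [← ENNReal.rpow_natCast, ← ENNReal.rpow_mul]; norm_num
    simp only [half, Pi.mul_apply] at hCS
    have e : ∫⁻ t, K r t * F t ∂μ = ∫⁻ t, (K r t * p t) ^ (1 / 2 : ℝ) *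
        (K r t * ((p t)⁻¹ * F t ^ 2)) ^ (1 / 2 : ℝ) ∂μ := by
      refine lintegral_congr_ae ?_
      filter_upwards [hp0, hp1] with t h0 hi
      rw [← ENNReal.mul_rpow_of_nonneg _ _ (by norm_num)]
      have : K r t * p t * (K r t * ((p t)⁻¹ * F t ^ 2)) = (K r t * F t) ^ (2 : ℝ) := by
        rw [ENNReal.rpow_two]
        calc K r t * p t * (K r t * ((p t)⁻¹ * F t ^ 2))
            = (p t * (p t)⁻¹) * (K r t * F t) ^ 2 := by ring
          _ = _ := by rw [ENNReal.mul_inv_cancel h0 hi, one_mul]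
      rw [this, ← ENNReal.rpow_mul]
      norm_num
    rw [e]
    calc _ ≤ ((∫⁻ t, K r t * p t ∂μ) ^ (1 / 2 : ℝ) *
          (∫⁻ t, K r t * ((p t)⁻¹ * F t ^ 2) ∂μ) ^ (1 / 2 : ℝ)) ^ 2 :=
          pow_le_pow_left' hCS 2
      _ = (∫⁻ t, K r t * p t ∂μ) * ∫⁻ t, K r t * ((p t)⁻¹ * F t ^ 2) ∂μ := by
          rw [mul_pow, half', half']
      _ ≤ A * p r * ∫⁻ t, K r t * ((p t)⁻¹ * F t ^ 2) ∂μ := by gcongr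
      _ = A * ∫⁻ t, p r * (K r t * ((p t)⁻¹ * F t ^ 2)) ∂μ := by
          rw [lintegral_const_mul'' _ (hQ r), mul_assoc]
  have hm : AEMeasurable (Function.uncurry fun r t => p r * (K r t * ((p t)⁻¹ * F t ^ 2)))
      (μ.prod μ) :=
    (hp.comp measurable_fst).aemeasurable.mul (hK.aemeasurable.mul
      ((hp.inv.aemeasurable.mul (hF.pow_const 2)).comp_snd))
  calc _ ≤ ∫⁻ r, A * ∫⁻ t, p r * (K r t * ((p t)⁻¹ * F t ^ 2)) ∂μ ∂μ := lintegral_mono_ae step1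
    _ = A * ∫⁻ r, ∫⁻ t, p r * (K r t * ((p t)⁻¹ * F t ^ 2)) ∂μ ∂μ :=
        lintegral_const_mul'' _ hm.lintegral_prod_right'
    _ = A * ∫⁻ t, ∫⁻ r, p r * (K r t * ((p t)⁻¹ * F t ^ 2)) ∂μ ∂μ := by
        rw [lintegral_lintegral_swap hm]
    _ ≤ A * ∫⁻ t, A * F t ^ 2 ∂μ := by
        gcongr 1
        refine lintegral_mono_ae ?_
        filter_upwards [h2, hp0, hp1] with t ht h0 hi
        calc ∫⁻ r, p r * (K r t * ((p t)⁻¹ * F t ^ 2)) ∂μ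
            = ∫⁻ r, (K r t * p r) * ((p t)⁻¹ * F t ^ 2) ∂μ := by
              congr 1; ext r; ring
          _ = (∫⁻ r, K r t * p r ∂μ) * ((p t)⁻¹ * F t ^ 2) :=
              lintegral_mul_const _ ((hKt t).mul hp)
          _ ≤ A * p t * ((p t)⁻¹ * F t ^ 2) := by gcongr
          _ = (p t * (p t)⁻¹) * (A * F t ^ 2) := by ring
          _ = A * F t ^ 2 := by rw [ENNReal.mul_inv_cancel h0 hi, one_mul]
    _ = A ^ 2 * ∫⁻ t, F t ^ 2 ∂μ := by
        rw [lintegral_const_mul'' _ (hF.pow_const 2), ← mul_assoc, sq]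

/-- `k` satisfies the hypotheses of the Schur test on `s`. -/
structure IsSchurKernel (s : Set ℝ) (k : ℝ → ℝ → ℝ) : Prop where
  measurable : Measurable (Function.uncurry k)
  nonneg : ∀ r ∈ s, ∀ t ∈ s, 0 ≤ k r t
  exists_weight : ∃ (p : ℝ → ℝ) (A : ℝ), Measurable p ∧ (∀ r ∈ s, 0 < p r) ∧
    (∀ r ∈ s, ∫⁻ t in s, ENNReal.ofReal (k r t * p t) ≤ ENNReal.ofReal (A * p r)) ∧
    ∀ t ∈ s, ∫⁻ r in s, ENNReal.ofReal (k r t * p r) ≤ ENNReal.ofReal (A * p t)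

lemma IsSchurKernel.swap {s : Set ℝ} {k : ℝ → ℝ → ℝ} (hk : IsSchurKernel s k) :
    IsSchurKernel s (fun r t => k t r) := by
  obtain ⟨p, A, hp, h0, h1, h2⟩ := hk.exists_weight
  exact ⟨hk.measurable.comp measurable_swap, fun r hr t ht => hk.nonneg t ht r hr,
    p, A, hp, h0, h2, h1⟩

/-- Formulated for a function G merely dominated by an integral over part of s, with integrand
bounded by k |F|. This is the form in which variation of constants formulas arise. -/
lemma IsSchurKernel.memLp {s : Set ℝ} {k : ℝ → ℝ → ℝ} (hk : IsSchurKernel s k)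
    (hs : MeasurableSet s) {F G : ℝ → ℝ} (hF : MemLp F 2 (volume.restrict s))
    (hG : AEStronglyMeasurable G (volume.restrict s)) {C : ℝ} {T : ℝ → Set ℝ} {W : ℝ → ℝ → ℝ}
    (hT : ∀ r ∈ s, MeasurableSet (T r) ∧ T r ⊆ s)
    (hGW : ∀ r ∈ s, |G r| ≤ |∫ t in T r, W r t|)
    (hW : ∀ r ∈ s, ∀ t ∈ T r, |W r t| ≤ C * k r t * |F t|) :
    MemLp G 2 (volume.restrict s) := by
  obtain ⟨p, A, hp, hp0, h1, h2⟩ := hk.exists_weight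
  set μ := volume.restrict s
  have key := lintegral_sq_lintegral_le_of_schur (μ := μ)
    (K := fun r t => ENNReal.ofReal (k r t)) hk.measurable.ennreal_ofReal
    (p := fun r => ENNReal.ofReal (p r)) hp.ennreal_ofReal
    (by filter_upwards [ae_restrict_mem hs] with r hr; simpa using hp0 r hr)
    (Eventually.of_forall fun r => ENNReal.ofReal_ne_top) (A := ENNReal.ofReal A)
    (by
      filter_upwards [ae_restrict_mem hs] with r hr
      rw [← ENNReal.ofReal_mul' (hp0 r hr).le]
      refine le_trans (le_of_eq ?_) (h1 r hr)
      refine setLIntegral_congr_fun hs fun t ht => ?_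
      exact (ENNReal.ofReal_mul' (hp0 t ht).le).symm)
    (by
      filter_upwards [ae_restrict_mem hs] with r hr
      rw [← ENNReal.ofReal_mul' (hp0 r hr).le]
      refine le_trans (le_of_eq ?_) (h2 r hr)
      refine setLIntegral_congr_fun hs fun t ht => ?_
      exact (ENNReal.ofReal_mul' (hp0 t ht).le).symm)
    hF.1.enorm
  have hfin : ∀ {H : ℝ → ℝ}, eLpNorm H 2 μ < ⊤ ↔ ∫⁻ t, ‖H t‖ₑ ^ 2 ∂μ < ⊤ := by
    intro H
    rw [eLpNorm_lt_top_iff_lintegral_rpow_enorm_lt_top two_ne_zero ENNReal.ofNat_ne_top]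
    simp
  refine ⟨hG, hfin.2 ?_⟩
  have hle : ∀ r ∈ s, ‖G r‖ₑ ≤ ENNReal.ofReal C * ∫⁻ t, ENNReal.ofReal (k r t) * ‖F t‖ₑ ∂μ := by
    intro r hr
    have hm : AEMeasurable (fun t => ENNReal.ofReal (k r t) * ‖F t‖ₑ) μ :=
      (hk.measurable.comp measurable_prodMk_left).ennreal_ofReal.aemeasurable.mul hF.1.enorm
    rw [← lintegral_const_mul'' _ hm]
    calc ‖G r‖ₑ ≤ ‖∫ t in T r, W r t‖ₑ := by
          rw [Real.enorm_eq_ofReal_abs, Real.enorm_eq_ofReal_abs]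
          exact ENNReal.ofReal_le_ofReal (hGW r hr)
      _ ≤ ∫⁻ t in T r, ‖W r t‖ₑ := enorm_integral_le_lintegral_enorm _
      _ ≤ ∫⁻ t in T r, ENNReal.ofReal C * (ENNReal.ofReal (k r t) * ‖F t‖ₑ) := by
          refine setLIntegral_mono' (hT r hr).1 fun t ht => ?_
          have h0 := hk.nonneg r hr t ((hT r hr).2 ht)
          rw [Real.enorm_eq_ofReal_abs, Real.enorm_eq_ofReal_abs, ← mul_assoc,
            ← ENNReal.ofReal_mul' h0, ← ENNReal.ofReal_mul' (abs_nonneg _)]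
          exact ENNReal.ofReal_le_ofReal (hW r hr t ht)
      _ ≤ _ := lintegral_mono_set (hT r hr).2
  calc ∫⁻ r, ‖G r‖ₑ ^ 2 ∂μ
      ≤ ∫⁻ r, (ENNReal.ofReal C * ∫⁻ t, ENNReal.ofReal (k r t) * ‖F t‖ₑ ∂μ) ^ 2 ∂μ :=
        setLIntegral_mono' hs fun r hr => pow_le_pow_left' (hle r hr) 2
    _ = ENNReal.ofReal C ^ 2 * ∫⁻ r, (∫⁻ t, ENNReal.ofReal (k r t) * ‖F t‖ₑ ∂μ) ^ 2 ∂μ := by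
        simp only [mul_pow]
        exact lintegral_const_mul' _ _ (ENNReal.pow_ne_top ENNReal.ofReal_ne_top)
    _ ≤ ENNReal.ofReal C ^ 2 * (ENNReal.ofReal A ^ 2 * ∫⁻ t, ‖F t‖ₑ ^ 2 ∂μ) := by gcongr
    _ < ⊤ := ENNReal.mul_lt_top (ENNReal.pow_lt_top ENNReal.ofReal_lt_top)
        (ENNReal.mul_lt_top (ENNReal.pow_lt_top ENNReal.ofReal_lt_top) (hfin.1 hF.2))

/-- The kernel `e^{-c (t - r)}` on `r < t`. -/
noncomputable def expKernel (c r t : ℝ) : ℝ := if r < t then Real.exp (-c * (t - r)) else 0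

/-- The kernel `r^{a - 1/2} t^{-a - 1/2}` on `r < t`. -/
noncomputable def powKernel (a r t : ℝ) : ℝ :=
  if r < t then r ^ (a - 1 / 2) * t ^ (-a - 1 / 2) else 0

/-- Only upper bounds are needed in the Schur test, so the domain may be enlarged to a set S on
which the integral is explicit. -/
lemma setLIntegral_ite_le {s : Set ℝ} {P : ℝ → Prop} {S : Set ℝ} (hS : MeasurableSet S)
    [DecidablePred P] {w : ℝ → ℝ} (hP : ∀ t ∈ s, P t → t ∈ S) (hs : MeasurableSet s)
    (h0 : ∀ t ∈ S, 0 ≤ w t) (hw : IntegrableOn w S) :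
    ∫⁻ t in s, ENNReal.ofReal (if P t then w t else 0) ≤ ENNReal.ofReal (∫ t in S, w t) := by
  rw [ofReal_integral_eq_lintegral_ofReal hw
    (by filter_upwards [ae_restrict_mem hS] with t ht using h0 t ht),
    ← lintegral_indicator hs, ← lintegral_indicator hS]
  refine lintegral_mono fun t => ?_
  by_cases hts : t ∈ s
  · by_cases h : P t
    · rw [Set.indicator_of_mem hts, Set.indicator_of_mem (hP t hts h), if_pos h]
    · rw [Set.indicator_of_mem hts, if_neg h]; simp
  · rw [Set.indicator_of_notMem hts]; exact zero_le

/-- The constant weight works: either marginal is at most ∫_0^∞ e^{-cx} dx = 1/c. -/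
lemma isSchurKernel_expKernel {c : ℝ} (hc : 0 < c) : IsSchurKernel (Set.Ioi 1) (expKernel c) := by
  refine ⟨?_, fun r _ t _ => ?_, fun _ => 1, 1 / c, measurable_const, fun _ _ => one_pos,
    fun r hr => ?_, fun t ht => ?_⟩
  · unfold expKernel Function.uncurry
    exact Measurable.ite (measurableSet_lt measurable_fst measurable_snd) (by fun_prop)
      measurable_const
  · unfold expKernel; split_ifs <;> positivity
  · simp only [expKernel, mul_one]
    have e : ∀ t, Real.exp (-c * (t - r)) = Real.exp (c * r) * Real.exp (-c * t) := fun t => by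
      rw [← Real.exp_add]; ring_nf
    refine (setLIntegral_ite_le (S := Set.Ioi r) measurableSet_Ioi (fun t _ h => h)
      measurableSet_Ioi (fun t _ => by positivity) ?_).trans (le_of_eq ?_)
    · simp only [e]
      exact (integrableOn_exp_mul_Ioi (neg_neg_of_pos hc) r).const_mul _
    · simp only [e]
      rw [integral_const_mul, integral_exp_mul_Ioi (neg_neg_of_pos hc)]
      congr 1
      have := Real.exp_pos (c * r)
      rw [neg_mul, Real.exp_neg]
      field_simp
  · simp only [expKernel, mul_one]
    have e : ∀ r, Real.exp (-c * (t - r)) = Real.exp (-(c * t)) * Real.exp (c * r) := fun r => by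
      rw [← Real.exp_add]; ring_nf
    refine (setLIntegral_ite_le (S := Set.Iic t) measurableSet_Iic (fun r _ h => le_of_lt h)
      measurableSet_Ioi (fun t _ => by positivity) ?_).trans (le_of_eq ?_)
    · simp only [e]
      exact (integrableOn_exp_mul_Iic hc t).const_mul _
    · simp only [e]
      rw [integral_const_mul, integral_exp_mul_Iic hc]
      congr 1
      rw [Real.exp_neg]
      field_simp

/-- The kernel is homogeneous of degree -1, for which r^{-1/2} is the natural weight: integrating it
against either variable returns at most r^{-1/2}/a. -/
lemma isSchurKernel_powKernel {a : ℝ} (ha : 0 < a) :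
    IsSchurKernel (Set.Ioc 0 1) (powKernel a) := by
  refine ⟨?_, fun r hr t ht => ?_, fun r => r ^ (-(1 / 2) : ℝ), 1 / a,
    measurable_id.pow_const _, fun r hr => Real.rpow_pos_of_pos hr.1 _,
    fun r hr => ?_, fun t ht => ?_⟩
  · unfold powKernel Function.uncurry
    exact Measurable.ite (measurableSet_lt measurable_fst measurable_snd)
      ((measurable_fst.pow_const _).mul (measurable_snd.pow_const _)) measurable_const
  · unfold powKernel
    have := hr.1
    have := ht.1
    split_ifs <;> positivity
  · have hr0 := hr.1
    simp only [powKernel, ite_mul, zero_mul]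
    have e : ∀ t ∈ Set.Ioi r, r ^ (a - 1 / 2) * t ^ (-a - 1 / 2) * t ^ (-(1 / 2) : ℝ) =
        r ^ (a - 1 / 2) * t ^ (-a - 1) := fun t ht => by
      rw [mul_assoc, ← Real.rpow_add (hr0.trans ht)]; ring_nf
    have hi : IntegrableOn (fun t => r ^ (a - 1 / 2) * t ^ (-a - 1)) (Set.Ioi r) :=
      (integrableOn_Ioi_rpow_of_lt (by linarith) hr0).const_mul _
    refine (setLIntegral_ite_le (S := Set.Ioi r) measurableSet_Ioi (fun t _ h => h)
      measurableSet_Ioc (fun t ht => ?_) (hi.congr_fun (fun t ht => (e t ht).symm)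
        measurableSet_Ioi)).trans (le_of_eq ?_)
    · have : 0 < t := hr0.trans ht
      positivity
    · rw [setIntegral_congr_fun measurableSet_Ioi e, integral_const_mul,
        integral_Ioi_rpow_of_lt (by linarith) hr0]
      congr 1
      rw [show -a - 1 + 1 = -a by ring, neg_div_neg_eq, ← mul_div_assoc, ← Real.rpow_add hr0]
      ring_nf
  · have ht0 := ht.1
    simp only [powKernel, ite_mul, zero_mul]
    have e : ∀ r ∈ Set.Ioc 0 t, r ^ (a - 1 / 2) * t ^ (-a - 1 / 2) * r ^ (-(1 / 2) : ℝ) =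
        t ^ (-a - 1 / 2) * r ^ (a - 1) := fun r hr => by
      rw [mul_right_comm, ← Real.rpow_add hr.1, mul_comm]; ring_nf
    have hi : IntegrableOn (fun r => t ^ (-a - 1 / 2) * r ^ (a - 1)) (Set.Ioc 0 t) :=
      ((intervalIntegrable_iff_integrableOn_Ioc_of_le ht0.le).1
        (intervalIntegral.intervalIntegrable_rpow' (by linarith))).const_mul _
    refine (setLIntegral_ite_le (S := Set.Ioc 0 t) measurableSet_Ioc
      (fun r hr h => ⟨hr.1, le_of_lt h⟩) measurableSet_Ioc (fun r hr => ?_)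
      (hi.congr_fun (fun t ht => (e t ht).symm) measurableSet_Ioc)).trans (le_of_eq ?_)
    · have := hr.1
      positivity
    · rw [setIntegral_congr_fun measurableSet_Ioc e, integral_const_mul,
        ← intervalIntegral.integral_of_le ht0.le, integral_rpow (Or.inl (by linarith))]
      congr 1
      rw [sub_add_cancel, Real.zero_rpow ha.ne', sub_zero, ← mul_div_assoc, ← Real.rpow_add ht0]
      ring_nf

/-! ### The integrating factor -/

/-- A positive weight `e`, bounded above and below near the origin and exponentially decaying, such
that `r e(r)` is an integrating factor for `g' + V g = f`. -/
structure IsDecayingWeight (e V : ℝ → ℝ) : Prop where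
  pos : ∀ r, 0 < e r
  isPrimitive : IsPrimitive (fun r => r * e r) (fun r => V r * (r * e r))
  isPrimitive_inv : IsPrimitive (fun r => (r * e r)⁻¹) (fun r => -(V r * (r * e r)⁻¹))
  near : ∃ A, 0 < A ∧ ∀ r, 0 < r → r ≤ 1 → (e r)⁻¹ ≤ A ∧ e r ≤ A
  far : ∃ A c, 0 < A ∧ 0 < c ∧ ∀ r t, 1 ≤ r → r ≤ t → e t ≤ A * Real.exp (-c * (t - r)) * e r

section Phase

variable {γt κ lam : ℝ} {k : ℕ} {φ₀ ψ : ℝ → ℝ}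

/-- The function φ₀ - κ r - r ψ has derivative -r ψ₁. This is integrable near 0 because r ≤ r^{1/2}
and r^{1/2} ψ₁ is in L² there, while r ψ is bounded by `MemRadialL2.exists_bound`. -/
lemma PhaseProfile.exists_abs_le_near (hψ : PhaseProfile γt k κ φ₀ ψ) :
    ∃ C, ∀ r, 0 < r → r ≤ 1 → |φ₀ r| ≤ C := by
  obtain ⟨ψ₁, hp, hm⟩ := hψ.exists_deriv
  obtain ⟨C, hC, -⟩ := hψ.radialReg.memRadialL2.exists_bound hp hm.weight_succ
  have hid : IsPrimitive (fun r => r) (fun _ => 1) :=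
    IsPrimitive.of_hasDerivAt (fun r _ => hasDerivAt_id r)
      (continuousOn_const.locallyIntegrableOn measurableSet_Ioi)
  have hΘ := (hψ.isPrimitive.add (hid.const_mul (-κ))).add ((hid.mul hp).const_mul (-1))
  have hΘ' : IsPrimitive (fun r => φ₀ r - κ * r - r * ψ r) (fun r => -(r * ψ₁ r)) :=
    hΘ.congr (fun r _ => by simp only; ring) (Eventually.of_forall fun r => by simp only; ring)
  have hint : IntegrableOn (fun r => r * ψ₁ r) (Set.Ioc 0 1) := by
    have h1 : Integrable (fun r => r ^ ((0 : ℝ) + 1 / 2) * ψ₁ r) (volume.restrict (Set.Ioc 0 1)) :=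
      hm.1.integrable one_le_two
    refine h1.mono (aestronglyMeasurable_id.mul hm.aesm_near) ?_
    filter_upwards [ae_restrict_mem measurableSet_Ioc] with r hr
    rw [norm_mul, norm_mul]
    refine mul_le_mul_of_nonneg_right ?_ (norm_nonneg _)
    rw [Real.norm_of_nonneg hr.1.le, Real.norm_of_nonneg (Real.rpow_nonneg hr.1.le _)]
    exact Real.self_le_rpow_of_le_one hr.1.le hr.2 (by norm_num)
  set D := ∫ t in Set.Ioc (0 : ℝ) 1, |t * ψ₁ t|
  refine ⟨|φ₀ 1 - κ * 1 - 1 * ψ 1| + D + |κ| + C, fun r hr hr1 => ?_⟩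
  have h1 := hΘ'.sub_eq r 1 hr one_pos
  have h2 : |∫ t in r..1, -(t * ψ₁ t)| ≤ D := by
    rw [intervalIntegral.integral_of_le hr1]
    refine (abs_integral_le_integral_abs).trans ?_
    simp only [abs_neg]
    exact setIntegral_mono_set hint.abs (Eventually.of_forall fun t => abs_nonneg _)
      (Eventually.of_forall (Set.Ioc_subset_Ioc_left hr.le))
  have h3 := hC r hr hr1
  rw [zero_add, Real.rpow_one] at h3
  have h4 : |r * ψ r| ≤ C := by rwa [abs_mul, abs_of_pos hr]
  have h5 : |κ * r| ≤ |κ| := by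
    rw [abs_mul, abs_of_pos hr]
    exact mul_le_of_le_one_right (abs_nonneg _) hr1
  rw [← h1] at h2
  have e : φ₀ r = (φ₀ 1 - κ * 1 - 1 * ψ 1) -
      (φ₀ 1 - κ * 1 - 1 * ψ 1 - (φ₀ r - κ * r - r * ψ r)) + κ * r + r * ψ r := by ring
  rw [e]
  refine (abs_add_le _ _).trans (add_le_add ((abs_add_le _ _).trans (add_le_add
    ((abs_sub _ _).trans (add_le_add le_rfl h2)) h5)) h4)

/-- Beyond some R the derivative is at least κ/2, so φ₀ - κ r/2 is monotone there. On [1, R] it is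
bounded by some M, and comparing values across R loses at most 2M. -/
lemma exists_phase_growth (hdiff : ∀ r, 0 < r → DifferentiableAt ℝ φ₀ r) (hκ : 0 < κ)
    (hlim : Tendsto (deriv φ₀) atTop (𝓝 κ)) :
    ∃ C, ∀ r t, 1 ≤ r → r ≤ t → κ / 2 * (t - r) - C ≤ φ₀ t - φ₀ r := by
  obtain ⟨R₀, hR₀⟩ := eventually_atTop.1 (hlim.eventually (eventually_ge_nhds (half_lt_self hκ)))
  set R := max R₀ 1
  set G : ℝ → ℝ := fun r => φ₀ r - κ / 2 * r with hG
  have hd : ∀ r, 0 < r → HasDerivAt G (deriv φ₀ r - κ / 2) r := fun r hr => by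
    exact ((hdiff r hr).hasDerivAt.sub ((hasDerivAt_id r).const_mul (κ / 2))).congr_deriv
      (by rw [mul_one])
  have hR1 : 1 ≤ R := le_max_right _ _
  have hR0 : 0 < R := one_pos.trans_le hR1
  have hcont : ContinuousOn G (Set.Ioi 0) := fun r hr => (hd r hr).continuousAt.continuousWithinAt
  obtain ⟨M, hM⟩ := (isCompact_Icc (a := (1 : ℝ)) (b := R)).exists_bound_of_continuousOn
    (hcont.mono fun r hr => one_pos.trans_le hr.1)
  have hmono : MonotoneOn G (Set.Ici R) := by
    refine monotoneOn_of_deriv_nonneg (convex_Ici R)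
      (hcont.mono fun r hr => hR0.trans_le hr) (fun r hr => ?_) (fun r hr => ?_)
    · rw [interior_Ici] at hr
      exact (hd r (hR0.trans hr)).differentiableAt.differentiableWithinAt
    · rw [interior_Ici] at hr
      rw [(hd r (hR0.trans hr)).deriv]
      linarith [hR₀ r ((le_max_left _ _).trans (le_of_lt hr))]
  refine ⟨2 * M, fun r t hr hrt => ?_⟩
  have key : G r - 2 * M ≤ G t := by
    have hM0 : 0 ≤ M := (norm_nonneg _).trans (hM 1 ⟨le_rfl, hR1⟩)
    rcases le_total R r with h | h
    · linarith [hmono h (h.trans hrt) hrt]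
    · have h1 := abs_le.1 (hM r ⟨hr, h⟩)
      rcases le_total R t with h' | h'
      · have h2 := abs_le.1 (hM R ⟨hR1, le_rfl⟩)
        linarith [hmono Set.self_mem_Ici h' h', h1.2, h2.1]
      · have h2 := abs_le.1 (hM t ⟨hr.trans hrt, h'⟩)
        linarith [h1.2, h2.1]
  simp only [hG] at key
  linarith

lemma PhaseProfile.continuousOn (hψ : PhaseProfile γt k κ φ₀ ψ) :
    ContinuousOn ψ (Set.Ioi 0) := by
  obtain ⟨ψ₁, hp, -⟩ := hψ.exists_deriv
  exact hp.continuousOn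

/-- Derivatives are computed with the pointwise φ₀' and then replaced by the continuous
representative κ + ψ. The bound near 0 is that of φ₀; the decay rate λκ/2 is inherited from the
growth of φ₀. -/
lemma PhaseProfile.isDecayingWeight (hψ : PhaseProfile γt k κ φ₀ ψ) (hlam : 0 < lam) (hκ : 0 < κ)
    (hdiff : ∀ r, 0 < r → DifferentiableAt ℝ φ₀ r) (hlim : Tendsto (deriv φ₀) atTop (𝓝 κ)) :
    IsDecayingWeight (fun r => Real.exp (-lam * φ₀ r)) (phasePotential lam κ ψ) := by
  have hφc : ContinuousOn φ₀ (Set.Ioi 0) := hψ.isPrimitive.continuousOn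
  have hV : ContinuousOn (phasePotential lam κ ψ) (Set.Ioi 0) := by
    unfold phasePotential
    exact (continuousOn_id.inv₀ fun r hr => ne_of_gt hr).sub
      (continuousOn_const.mul (continuousOn_const.add hψ.continuousOn))
  have hE : ContinuousOn (fun r => r * Real.exp (-lam * φ₀ r)) (Set.Ioi 0) :=
    continuousOn_id.mul (Real.continuous_exp.comp_continuousOn (continuousOn_const.mul hφc))
  have hE0 : ∀ r, 0 < r → r * Real.exp (-lam * φ₀ r) ≠ 0 := fun r hr => by positivity
  have hd : ∀ r, 0 < r → HasDerivAt (fun r => r * Real.exp (-lam * φ₀ r))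
      ((r⁻¹ - lam * deriv φ₀ r) * (r * Real.exp (-lam * φ₀ r))) r := fun r hr => by
    refine ((hasDerivAt_id r).mul
      ((hdiff r hr).hasDerivAt.const_mul (-lam)).exp).congr_deriv ?_
    have := hr.ne'
    simp only [id]
    field_simp
    ring
  have hae : (fun r => r⁻¹ - lam * deriv φ₀ r) =ᵐ[volume.restrict (Set.Ioi 0)]
      phasePotential lam κ ψ := by
    filter_upwards [hψ.deriv_ae] with r hr
    simp only [phasePotential, hr]
  have h1 : (fun r => phasePotential lam κ ψ r * (r * Real.exp (-lam * φ₀ r)))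
      =ᵐ[volume.restrict (Set.Ioi 0)]
      fun r => (r⁻¹ - lam * deriv φ₀ r) * (r * Real.exp (-lam * φ₀ r)) := by
    filter_upwards [hae] with r hr
    rw [hr]
  have h2 : (fun r => -(phasePotential lam κ ψ r * (r * Real.exp (-lam * φ₀ r))⁻¹))
      =ᵐ[volume.restrict (Set.Ioi 0)]
      fun r => -((r⁻¹ - lam * deriv φ₀ r) * (r * Real.exp (-lam * φ₀ r))⁻¹) := by
    filter_upwards [hae] with r hr
    rw [hr]
  refine ⟨fun r => Real.exp_pos _, ?_, ?_, ?_, ?_⟩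
  · exact (IsPrimitive.of_hasDerivAt hd
      (((hV.mul hE).locallyIntegrableOn measurableSet_Ioi).congr h1)).congr (fun _ _ => rfl) h1
  · refine (IsPrimitive.of_hasDerivAt (fun r hr => ((hd r hr).inv (hE0 r hr)).congr_deriv ?_)
      ((((hV.mul (hE.inv₀ hE0)).neg).locallyIntegrableOn measurableSet_Ioi).congr h2)).congr
      (fun _ _ => rfl) h2
    have := hE0 r hr
    field_simp
  · obtain ⟨C, hC⟩ := hψ.exists_abs_le_near
    refine ⟨Real.exp (lam * C), Real.exp_pos _, fun r hr hr1 => ?_⟩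
    have h := abs_le.1 (hC r hr hr1)
    rw [← Real.exp_neg]
    constructor
    · exact Real.exp_le_exp.2 (by nlinarith [h.2])
    · exact Real.exp_le_exp.2 (by nlinarith [h.1])
  · obtain ⟨C, hC⟩ := exists_phase_growth hdiff hκ hlim
    refine ⟨Real.exp (lam * C), lam * (κ / 2), Real.exp_pos _, by positivity,
      fun r t hr hrt => ?_⟩
    rw [← Real.exp_add, ← Real.exp_add]
    have := mul_le_mul_of_nonneg_left (hC r t hr hrt) hlam.le
    exact Real.exp_le_exp.2 (by linarith)

end Phase

/-! ### Integrability against the decaying weight -/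

lemma memLp_rpow_Ioc {p : ℝ} (hp : -(1 / 2) < p) :
    MemLp (fun r : ℝ => r ^ p) 2 (volume.restrict (Set.Ioc 0 1)) := by
  rw [memLp_two_iff_integrable_sq (aestronglyMeasurable_rpow _ _)]
  have h := (intervalIntegrable_iff_integrableOn_Ioc_of_le zero_le_one).1
    (intervalIntegral.intervalIntegrable_rpow' (a := 0) (b := 1) (r := 2 * p) (by linarith))
  refine h.congr_fun (fun r hr => ?_) measurableSet_Ioc
  rw [← Real.rpow_natCast, ← Real.rpow_mul hr.1.le]
  ring_nf

lemma one_add_rpow_le_exp {N c : ℝ} (hN : 0 < N) (hc : 0 < c) :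
    ∃ C, 0 < C ∧ ∀ x, 0 ≤ x → (1 + x) ^ N ≤ C * Real.exp (c * x) := by
  -- After taking N-th roots the claim is 1 + x ≤ M e^{cx/N}, which follows from 1 + y ≤ e^y once M
  -- ≥ 1 and M c/N ≥ 1.
  set M := max 1 (N / c)
  have hM : 0 < M := one_pos.trans_le (le_max_left _ _)
  refine ⟨M ^ N, Real.rpow_pos_of_pos hM _, fun x hx => ?_⟩
  have h1 : 1 + x ≤ M * Real.exp (c / N * x) := by
    calc 1 + x ≤ M * (c / N * x + 1) := by
          have h1 : 1 ≤ M := le_max_left _ _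
          have h2 : 1 ≤ M * (c / N) := by
            calc 1 = N / c * (c / N) := by field_simp
              _ ≤ _ := mul_le_mul_of_nonneg_right (le_max_right _ _) (by positivity)
          nlinarith
      _ ≤ _ := mul_le_mul_of_nonneg_left (Real.add_one_le_exp _) hM.le
  calc (1 + x) ^ N ≤ (M * Real.exp (c / N * x)) ^ N :=
        Real.rpow_le_rpow (by positivity) h1 hN.le
    _ = _ := by
        rw [Real.mul_rpow hM.le (Real.exp_pos _).le, ← Real.exp_mul]
        congr 2
        field_simp

/-- For r ≥ 1 the ratio t/r is at most 1 + (t - r). Thus polynomial weights at infinity are absorbed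
by an arbitrarily small part of the exponential decay. -/
lemma div_rpow_le_exp (p : ℝ) {c : ℝ} (hc : 0 < c) :
    ∃ C, 0 < C ∧ ∀ r t, 1 ≤ r → r ≤ t → (t / r) ^ p ≤ C * Real.exp (c * (t - r)) := by
  obtain ⟨C, hC, h⟩ := one_add_rpow_le_exp (N := |p| + 1) (by positivity) hc
  refine ⟨C, hC, fun r t hr hrt => le_trans ?_ (h (t - r) (sub_nonneg.2 hrt))⟩
  have hr0 : 0 < r := one_pos.trans_le hr
  have h1 : 1 ≤ t / r := (one_le_div hr0).2 hrt
  have h2 : t / r ≤ 1 + (t - r) := by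
    rw [div_le_iff₀ hr0]
    nlinarith
  calc (t / r) ^ p ≤ (t / r) ^ (|p| + 1) :=
        Real.rpow_le_rpow_of_exponent_le h1 (by linarith [le_abs_self p])
    _ ≤ _ := Real.rpow_le_rpow (by positivity) h2 (by positivity)

namespace IsDecayingWeight

variable {e V : ℝ → ℝ}

lemma continuousOn (he : IsDecayingWeight e V) : ContinuousOn e (Set.Ioi 0) := by
  refine (he.isPrimitive.continuousOn.mul
    (continuousOn_id.inv₀ fun r hr => ne_of_gt hr)).congr fun r hr => ?_
  have : r ≠ 0 := ne_of_gt hr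
  simp only [Pi.mul_apply, Pi.inv_apply, id]
  field_simp

lemma aestronglyMeasurable (he : IsDecayingWeight e V) {s : Set ℝ} (hs : s ⊆ Set.Ioi 0) :
    AEStronglyMeasurable e (volume.restrict s) :=
  (he.continuousOn.aestronglyMeasurable measurableSet_Ioi).mono_measure
    (Measure.restrict_mono hs le_rfl)

lemma memLp_near (he : IsDecayingWeight e V) {p : ℝ} (hp : -(1 / 2) < p) :
    MemLp (fun r => r ^ p * e r) 2 (volume.restrict (Set.Ioc 0 1)) := by
  obtain ⟨A, hA, h⟩ := he.near
  refine (memLp_rpow_Ioc hp).of_le_mul (c := A) ((aestronglyMeasurable_rpow _ _).mul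
    (he.aestronglyMeasurable Set.Ioc_subset_Ioi_self)) ?_
  filter_upwards [ae_restrict_mem measurableSet_Ioc] with r hr
  rw [norm_mul, mul_comm, Real.norm_of_nonneg (he.pos r).le]
  exact mul_le_mul_of_nonneg_right (h r hr.1 hr.2).2 (norm_nonneg _)

lemma memLp_far (he : IsDecayingWeight e V) (q : ℝ) :
    MemLp (fun r => r ^ q * e r) 2 (volume.restrict (Set.Ioi 1)) := by
  obtain ⟨A, c, hA, hc, h⟩ := he.far
  obtain ⟨C, hC, hq⟩ := div_rpow_le_exp q (half_pos hc)
  have hm : AEStronglyMeasurable (fun r => r ^ q * e r) (volume.restrict (Set.Ioi 1)) :=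
    (aestronglyMeasurable_rpow _ _).mul
      (he.aestronglyMeasurable (Set.Ioi_subset_Ioi zero_le_one))
  have hexp : MemLp (fun r => Real.exp (-(c / 2) * r)) 2 (volume.restrict (Set.Ioi 1)) := by
    rw [memLp_two_iff_integrable_sq (by fun_prop)]
    refine (integrableOn_exp_mul_Ioi (neg_neg_of_pos hc) 1).congr_fun (fun r _ => ?_)
      measurableSet_Ioi
    rw [sq, ← Real.exp_add]
    ring_nf
  refine hexp.of_le_mul (c := C * A * e 1 * Real.exp (c / 2)) hm ?_
  filter_upwards [ae_restrict_mem measurableSet_Ioi] with r hr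
  have hr : 1 < r := hr
  have hr0 : 0 < r := one_pos.trans hr
  have h1 := h 1 r le_rfl hr.le
  have h2 := hq 1 r le_rfl hr.le
  rw [div_one] at h2
  have := he.pos r
  rw [Real.norm_of_nonneg (by positivity), Real.norm_of_nonneg (by positivity)]
  calc r ^ q * e r ≤ (C * Real.exp (c / 2 * (r - 1))) * (A * Real.exp (-c * (r - 1)) * e 1) :=
        mul_le_mul h2 h1 this.le (by positivity)
    _ = C * A * e 1 * (Real.exp (c / 2 * (r - 1)) * Real.exp (-c * (r - 1))) := by ring
    _ = C * A * e 1 * (Real.exp (c / 2) * Real.exp (-(c / 2) * r)) := by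
        rw [← Real.exp_add, ← Real.exp_add]; ring_nf
    _ = _ := by ring

lemma integrableOn_far (he : IsDecayingWeight e V) {q : ℝ} {f : ℝ → ℝ}
    (hf : MemLp (fun r => r ^ q * f r) 2 (volume.restrict (Set.Ioi 1))) :
    IntegrableOn (fun r => r * e r * f r) (Set.Ioi 1) := by
  refine IntegrableOn.congr_fun (MemLp.integrable_mul (he.memLp_far (1 - q)) hf) (fun r hr => ?_)
    measurableSet_Ioi
  have hr0 : 0 < r := one_pos.trans hr
  have : r ^ (1 - q) * r ^ q = r := by rw [← Real.rpow_add hr0]; simp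
  simp only [Pi.mul_apply]
  linear_combination e r * f r * this

/-- The condition on p and b is what makes r^{b-p} square integrable near 0, so that Cauchy–Schwarz
applies. -/
lemma integrableOn_near (he : IsDecayingWeight e V) {p b : ℝ} (hpb : p < b + 1 / 2) {f : ℝ → ℝ}
    (hf : MemLp (fun r => r ^ p * f r) 2 (volume.restrict (Set.Ioc 0 1))) :
    IntegrableOn (fun r => r ^ b * (e r * f r)) (Set.Ioc 0 1) := by
  refine IntegrableOn.congr_fun (MemLp.integrable_mul (he.memLp_near (p := b - p) (by linarith)) hf)
    (fun r hr => ?_) measurableSet_Ioc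
  have : r ^ (b - p) * r ^ p = r ^ b := by rw [← Real.rpow_add hr.1]; simp
  simp only [Pi.mul_apply]
  linear_combination e r * f r * this

end IsDecayingWeight

/-! ### The first-order radial equation -/

namespace IsDecayingWeight

variable {e V f g v : ℝ → ℝ} {γ σ τ : ℝ}

lemma isPrimitive_mul (he : IsDecayingWeight e V)
    (hp : IsPrimitive g (fun r => f r - V r * g r)) :
    IsPrimitive (fun r => r * e r * g r) (fun r => r * e r * f r) :=
  (he.isPrimitive.mul hp).congr (fun _ _ => rfl) (Eventually.of_forall fun r => by simp only; ring)

lemma isPrimitive_inv_mul (he : IsDecayingWeight e V)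
    (hv : IsPrimitive v (fun r => r * e r * f r)) :
    IsPrimitive (fun r => (r * e r)⁻¹ * v r) (fun r => f r - V r * ((r * e r)⁻¹ * v r)) := by
  refine (he.isPrimitive_inv.mul hv).congr (fun _ _ => rfl) ?_
  filter_upwards [ae_restrict_mem measurableSet_Ioi] with r hr
  have h1 : r ≠ 0 := ne_of_gt hr
  have h2 := (he.pos r).ne'
  field_simp
  ring

lemma integrableOn_Ioi (hF : LocallyIntegrableOn f (Set.Ioi 0) volume)
    (h1 : IntegrableOn f (Set.Ioi 1)) {r : ℝ} (hr : 0 < r) : IntegrableOn f (Set.Ioi r) := by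
  have h2 : IntegrableOn f (Set.Icc r 1) :=
    hF.integrableOn_compact_subset (fun x hx => hr.trans_le hx.1) isCompact_Icc
  refine (h2.union h1).mono_set fun x hx => ?_
  rcases le_or_gt x 1 with h | h
  · exact Or.inl ⟨le_of_lt hx, h⟩
  · exact Or.inr h

/-- Solutions in the weighted space are determined by integration from infinity. -/
lemma eq_neg_integral (he : IsDecayingWeight e V) (hf : MemRadialL2 γ τ f)
    (hg : MemRadialL2 γ σ g) (hp : IsPrimitive g (fun r => f r - V r * g r)) {r : ℝ}
    (hr : 0 < r) : r * e r * g r = -∫ t in Set.Ioi r, t * e t * f t := by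
  have hv := he.isPrimitive_mul hp
  have hF : IntegrableOn (fun t => t * e t * f t) (Set.Ioi r) :=
    integrableOn_Ioi hv.locallyIntegrableOn (he.integrableOn_far hf.2) hr
  have hlim : Tendsto (fun b => b * e b * g b) atTop
      (𝓝 (r * e r * g r + ∫ t in Set.Ioi r, t * e t * f t)) := by
    refine ((intervalIntegral_tendsto_integral_Ioi r hF tendsto_id).const_add
      (r * e r * g r)).congr' ?_
    filter_upwards [eventually_gt_atTop 0] with b hb
    rw [id, ← hv.sub_eq r b hr hb]
    ring
  -- The limit of b e(b) g(b) at infinity is 0 because the function is integrable there, thanks to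
  -- the exponential decay of e.
  have h0 := IntegrableAtFilter.eq_zero_of_tendsto
    ⟨Set.Ioi 1, Ioi_mem_atTop 1, he.integrableOn_far hg.2⟩ (fun s hs => ?_) hlim
  · linarith
  · obtain ⟨a, ha⟩ := mem_atTop_sets.1 hs
    exact measure_mono_top (fun x hx => ha x hx) (Real.volume_Ici (a := a))

lemma eq_zero_of_homogeneous (he : IsDecayingWeight e V)
    (hf : f =ᵐ[volume.restrict (Set.Ioi 0)] 0) (hg : MemRadialL2 γ σ g)
    (hp : IsPrimitive g (fun r => f r - V r * g r)) {r : ℝ} (hr : 0 < r) : g r = 0 := by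
  have h0 : MemRadialL2 γ σ f := (MemRadialL2.const_mul 0 hg).congr_ae
    (hf.mono fun r hr => by simp [hr])
  have h := he.eq_neg_integral h0 hg hp hr
  have e0 : ∫ t in Set.Ioi r, t * e t * f t = 0 := by
    refine integral_eq_zero_of_ae ?_
    filter_upwards [ae_restrict_of_ae_restrict_of_subset (Set.Ioi_subset_Ioi hr.le) hf] with t ht
    simp [ht]
  rw [e0, neg_zero] at h
  have := he.pos r
  exact (mul_eq_zero.1 h).resolve_left (by positivity)

lemma integrableOn_of_neg (he : IsDecayingWeight e V) (hσ : σ < 0)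
    (hf : MemRadialL2 γ (σ + 1) f) : IntegrableOn (fun r => r * e r * f r) (Set.Ioi 0) := by
  rw [← Set.Ioc_union_Ioi_eq_Ioi (zero_le_one' ℝ)]
  refine IntegrableOn.union ?_ (he.integrableOn_far hf.2)
  refine (he.integrableOn_near (b := 1) (by linarith) hf.1).congr_fun (fun r _ => ?_)
    measurableSet_Ioc
  simp only [Real.rpow_one]
  ring

/-- As r → 0 the quantity r e g tends to minus the integral I. If I ≠ 0, then |e g| is at least a
multiple of 1/r near 0, hence not integrable; but for σ < 0 membership of g in the weighted space
makes e g integrable. -/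
lemma integral_eq_zero (he : IsDecayingWeight e V) (hσ : σ < 0) (hf : MemRadialL2 γ (σ + 1) f)
    (hg : MemRadialL2 γ σ g) (hp : IsPrimitive g (fun r => f r - V r * g r)) :
    ∫ t in Set.Ioi 0, t * e t * f t = 0 := by
  by_contra hI
  set I := ∫ t in Set.Ioi (0 : ℝ), t * e t * f t
  have hF := he.integrableOn_of_neg hσ hf
  have hlim : Tendsto (fun r => r * e r * g r) (𝓝[>] 0) (𝓝 (-I)) := by
    have hc := aecover_Ioi_of_Ioi (μ := (volume : Measure ℝ)) (A := (0 : ℝ)) (a := id)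
      (l := 𝓝[>] 0) (tendsto_nhdsWithin_of_tendsto_nhds tendsto_id)
    refine (hc.integral_tendsto_of_countably_generated hF).neg.congr' ?_
    filter_upwards [self_mem_nhdsWithin] with r hr
    rw [he.eq_neg_integral hf hg hp hr, Measure.restrict_restrict measurableSet_Ioi,
      Set.inter_eq_left.2 (Set.Ioi_subset_Ioi (le_of_lt hr))]
    rfl
  have hint : IntegrableOn (fun r => e r * g r) (Set.Ioc 0 1) := by
    simpa using he.integrableOn_near (b := 0) (by linarith) hg.1
  refine not_integrableOn_of_tendsto_norm_atTop_of_deriv_isBigO_filter (𝓝[>] (0 : ℝ))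
    (f := Real.log) (Ioc_mem_nhdsGT one_pos) ?_ ?_ ?_ hint
  · filter_upwards [self_mem_nhdsWithin] with r hr
    exact Real.differentiableAt_log (ne_of_gt hr)
  · exact tendsto_abs_atBot_atTop.comp Real.tendsto_log_nhdsGT_zero
  · refine IsBigO.of_bound (2 / |I|) ?_
    have hev := hlim.abs.eventually (eventually_ge_nhds (b := |I| / 2)
      (by rw [abs_neg]; exact half_lt_self (abs_pos.2 hI)))
    filter_upwards [hev, self_mem_nhdsWithin] with r h1 hr
    have hr : 0 < r := hr
    have hI' := abs_pos.2 hI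
    rw [Real.deriv_log, Real.norm_eq_abs, Real.norm_eq_abs, abs_inv, abs_of_pos hr]
    rw [mul_assoc, abs_mul, abs_of_pos hr] at h1
    rw [div_mul_eq_mul_div, le_div_iff₀ hI', ← div_eq_inv_mul, div_le_iff₀ hr]
    linarith

/-- In weighted variables the kernel is (t/r)^{1/2-γ} e(t)/e(r). Half of the decay rate pays for the
power, and the other half remains for the Schur test. -/
lemma memLp_far_of_integral (he : IsDecayingWeight e V)
    (hf : MemLp (fun r => r ^ (γ + 1 / 2) * f r) 2 (volume.restrict (Set.Ioi 1)))
    (hv : ContinuousOn v (Set.Ioi 0))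
    (hvf : ∀ r, 1 < r → v r = -∫ t in Set.Ioi r, t * e t * f t) :
    MemLp (fun r => r ^ (γ + 1 / 2) * ((r * e r)⁻¹ * v r)) 2 (volume.restrict (Set.Ioi 1)) := by
  obtain ⟨A, c, hA, hc, h⟩ := he.far
  obtain ⟨C, hC, hq⟩ := div_rpow_le_exp (1 / 2 - γ) (half_pos hc)
  have hsub : Set.Ioi (1 : ℝ) ⊆ Set.Ioi 0 := Set.Ioi_subset_Ioi zero_le_one
  refine (isSchurKernel_expKernel (half_pos hc)).memLp measurableSet_Ioi hf
    ((aestronglyMeasurable_rpow _ _).mul ((he.isPrimitive_inv.continuousOn.mul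
      hv).aestronglyMeasurable measurableSet_Ioi |>.mono_measure
      (Measure.restrict_mono hsub le_rfl)))
    (C := A * C) (T := fun r => Set.Ioi r)
    (W := fun r t => r ^ (γ + 1 / 2) * (r * e r)⁻¹ * (t * e t * f t))
    (fun r hr => ⟨measurableSet_Ioi, Set.Ioi_subset_Ioi (le_of_lt hr)⟩) (fun r hr => ?_)
    (fun r hr t ht => ?_)
  · rw [hvf r hr, integral_const_mul, ← mul_assoc, mul_neg, abs_neg]
  · have hr : 1 < r := hr
    have ht : r < t := ht
    have hr0 : 0 < r := one_pos.trans hr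
    have ht0 : 0 < t := hr0.trans ht
    have her := he.pos r
    have het := he.pos t
    have h1 := h r t hr.le ht.le
    have h2 := hq r t hr.le ht.le
    rw [expKernel, if_pos ht, ← mul_assoc, abs_mul, abs_mul (t ^ (γ + 1 / 2)),
      abs_of_pos (a := t ^ (γ + 1 / 2)) (by positivity),
      abs_of_pos (a := r ^ (γ + 1 / 2) * (r * e r)⁻¹ * (t * e t)) (by positivity),
      ← mul_assoc _ (t ^ (γ + 1 / 2)) |f t|]
    refine mul_le_mul_of_nonneg_right ?_ (abs_nonneg _)
    have h3 : e t / e r ≤ A * Real.exp (-c * (t - r)) := by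
      rwa [div_le_iff₀ her]
    calc r ^ (γ + 1 / 2) * (r * e r)⁻¹ * (t * e t)
        = (t / r) ^ (1 / 2 - γ) * (e t / e r) * t ^ (γ + 1 / 2) := by
          have e1 : t ^ (1 / 2 - γ) * t ^ (γ + 1 / 2) = t := by
            rw [← Real.rpow_add ht0, show 1 / 2 - γ + (γ + 1 / 2) = 1 by ring, Real.rpow_one]
          have e2 : r ^ (1 / 2 - γ) * r ^ (γ + 1 / 2) = r := by
            rw [← Real.rpow_add hr0, show 1 / 2 - γ + (γ + 1 / 2) = 1 by ring, Real.rpow_one]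
          have p1 : 0 < r ^ (1 / 2 - γ) := by positivity
          rw [Real.div_rpow ht0.le hr0.le]
          calc r ^ (γ + 1 / 2) * (r * e r)⁻¹ * (t * e t)
              = r ^ (γ + 1 / 2) * ((r ^ (1 / 2 - γ) * r ^ (γ + 1 / 2)) * e r)⁻¹ *
                ((t ^ (1 / 2 - γ) * t ^ (γ + 1 / 2)) * e t) := by rw [e1, e2]
            _ = _ := by field_simp
      _ ≤ (C * Real.exp (c / 2 * (t - r))) * (A * Real.exp (-c * (t - r))) * t ^ (γ + 1 / 2) := by
          gcongr
      _ = A * C * (Real.exp (c / 2 * (t - r)) * Real.exp (-c * (t - r))) * t ^ (γ + 1 / 2) := by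
          ring
      _ = _ := by
          rw [← Real.exp_add]
          ring_nf

/-- Both Hardy estimates rest on this: with e comparable to 1, the weighted kernel is r^{σ-1/2}
t^{-σ-1/2}. This is `powKernel σ` on r < t, and the transpose of `powKernel (-σ)` on t < r. -/
lemma near_kernel_bound {A r t fr : ℝ} (hr : 0 < r) (ht : 0 < t) (her : 0 < e r)
    (het : 0 < e t) (h1 : (e r)⁻¹ ≤ A) (h2 : e t ≤ A) :
    |r ^ (σ + 1 / 2) * (r * e r)⁻¹ * (t * e t * fr)| ≤
      A * A * (r ^ (σ - 1 / 2) * t ^ (-σ - 1 / 2)) * |t ^ (σ + 1 + 1 / 2) * fr| := by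
  have hA : 0 < A := het.trans_le h2
  have e1 : r ^ (σ + 1 / 2) * r⁻¹ = r ^ (σ - 1 / 2) := by
    rw [← Real.rpow_neg_one, ← Real.rpow_add hr]; ring_nf
  have e2 : t ^ (-σ - 1 / 2) * t ^ (σ + 1 + 1 / 2) = t := by
    rw [← Real.rpow_add ht]; ring_nf; exact Real.rpow_one t
  rw [← mul_assoc, abs_mul, abs_mul (t ^ (σ + 1 + 1 / 2)),
    abs_of_pos (a := t ^ (σ + 1 + 1 / 2)) (by positivity),
    abs_of_pos (a := r ^ (σ + 1 / 2) * (r * e r)⁻¹ * (t * e t)) (by positivity),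
    ← mul_assoc _ (t ^ (σ + 1 + 1 / 2)) |fr|]
  refine mul_le_mul_of_nonneg_right ?_ (abs_nonneg _)
  calc r ^ (σ + 1 / 2) * (r * e r)⁻¹ * (t * e t)
      = (r ^ (σ + 1 / 2) * r⁻¹) * t * ((e r)⁻¹ * e t) := by rw [mul_inv]; ring
    _ ≤ (r ^ (σ + 1 / 2) * r⁻¹) * t * (A * A) := by gcongr
    _ = r ^ (σ - 1 / 2) * (t ^ (-σ - 1 / 2) * t ^ (σ + 1 + 1 / 2)) * (A * A) := by rw [e1, e2]
    _ = _ := by ring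

lemma memLp_near_of_integral_Ioo (he : IsDecayingWeight e V) (hσ : σ < 0)
    (hf : MemLp (fun r => r ^ (σ + 1 + 1 / 2) * f r) 2 (volume.restrict (Set.Ioc 0 1)))
    (hv : ContinuousOn v (Set.Ioi 0))
    (hvf : ∀ r ∈ Set.Ioc (0 : ℝ) 1, v r = ∫ t in Set.Ioo 0 r, t * e t * f t) :
    MemLp (fun r => r ^ (σ + 1 / 2) * ((r * e r)⁻¹ * v r)) 2 (volume.restrict (Set.Ioc 0 1)) := by
  obtain ⟨A, hA, h⟩ := he.near
  refine (isSchurKernel_powKernel (neg_pos.2 hσ)).swap.memLp measurableSet_Ioc hf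
    ((aestronglyMeasurable_rpow _ _).mul ((he.isPrimitive_inv.continuousOn.mul
      hv).aestronglyMeasurable measurableSet_Ioi |>.mono_measure
      (Measure.restrict_mono Set.Ioc_subset_Ioi_self le_rfl)))
    (C := A * A) (T := fun r => Set.Ioo 0 r)
    (W := fun r t => r ^ (σ + 1 / 2) * (r * e r)⁻¹ * (t * e t * f t))
    (fun r hr => ⟨measurableSet_Ioo, fun t ht => ⟨ht.1, ht.2.le.trans hr.2⟩⟩) (fun r hr => ?_)
    (fun r hr t ht => ?_)
  · rw [hvf r hr, integral_const_mul, ← mul_assoc]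
  · refine (near_kernel_bound hr.1 ht.1 (he.pos r) (he.pos t) (h r hr.1 hr.2).1
      (h t ht.1 (ht.2.le.trans hr.2)).2).trans (le_of_eq ?_)
    rw [powKernel, if_pos ht.2, neg_neg, mul_comm (r ^ _)]

/-- The constant c produces a singularity c/r with weighted size r^{σ-1/2}, square integrable
exactly because σ > 0. The integral part is a Hardy operator on t > r. -/
lemma memLp_near_of_integral_Ioc (he : IsDecayingWeight e V) (hσ : 0 < σ)
    (hf : MemLp (fun r => r ^ (σ + 1 + 1 / 2) * f r) 2 (volume.restrict (Set.Ioc 0 1)))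
    (hv : ContinuousOn v (Set.Ioi 0)) (c : ℝ)
    (hvf : ∀ r ∈ Set.Ioc (0 : ℝ) 1, v r = c - ∫ t in Set.Ioc r 1, t * e t * f t) :
    MemLp (fun r => r ^ (σ + 1 / 2) * ((r * e r)⁻¹ * v r)) 2 (volume.restrict (Set.Ioc 0 1)) := by
  obtain ⟨A, hA, h⟩ := he.near
  have hinv : AEStronglyMeasurable (fun r => (r * e r)⁻¹) (volume.restrict (Set.Ioc 0 1)) :=
    (he.isPrimitive_inv.continuousOn.aestronglyMeasurable measurableSet_Ioi).mono_measure
      (Measure.restrict_mono Set.Ioc_subset_Ioi_self le_rfl)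
  have hG1 : MemLp (fun r => r ^ (σ + 1 / 2) * ((r * e r)⁻¹ * c)) 2
      (volume.restrict (Set.Ioc 0 1)) := by
    refine (memLp_rpow_Ioc (p := σ - 1 / 2) (by linarith)).of_le_mul (c := A * |c|)
      ((aestronglyMeasurable_rpow _ _).mul (hinv.mul aestronglyMeasurable_const)) ?_
    filter_upwards [ae_restrict_mem measurableSet_Ioc] with r hr
    have hr0 := hr.1
    have her := he.pos r
    have e1 : r ^ (σ + 1 / 2) * r⁻¹ = r ^ (σ - 1 / 2) := by
      rw [← Real.rpow_neg_one, ← Real.rpow_add hr.1]; ring_nf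
    rw [Real.norm_eq_abs, Real.norm_of_nonneg (Real.rpow_nonneg hr0.le _), ← mul_assoc, abs_mul,
      abs_of_pos (a := r ^ (σ + 1 / 2) * (r * e r)⁻¹) (by positivity), mul_assoc, ← e1]
    calc r ^ (σ + 1 / 2) * ((r * e r)⁻¹ * |c|)
        = (r ^ (σ + 1 / 2) * r⁻¹) * |c| * (e r)⁻¹ := by rw [mul_inv]; ring
      _ ≤ (r ^ (σ + 1 / 2) * r⁻¹) * |c| * A := by
          have := (h r hr.1 hr.2).1
          gcongr
      _ = _ := by ring
  have hG2 : MemLp (fun r => r ^ (σ + 1 / 2) * ((r * e r)⁻¹ * (c - v r))) 2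
      (volume.restrict (Set.Ioc 0 1)) := by
    refine (isSchurKernel_powKernel hσ).memLp measurableSet_Ioc hf
      ((aestronglyMeasurable_rpow _ _).mul ((he.isPrimitive_inv.continuousOn.mul
        (continuousOn_const.sub hv)).aestronglyMeasurable measurableSet_Ioi |>.mono_measure
        (Measure.restrict_mono Set.Ioc_subset_Ioi_self le_rfl)))
      (C := A * A) (T := fun r => Set.Ioc r 1)
      (W := fun r t => r ^ (σ + 1 / 2) * (r * e r)⁻¹ * (t * e t * f t))
      (fun r hr => ⟨measurableSet_Ioc, Set.Ioc_subset_Ioc_left hr.1.le⟩) (fun r hr => ?_)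
      (fun r hr t ht => ?_)
    · rw [hvf r hr, integral_const_mul, ← mul_assoc, sub_sub_cancel]
    · have ht0 : 0 < t := hr.1.trans ht.1
      rw [powKernel, if_pos ht.1]
      exact near_kernel_bound hr.1 ht0 (he.pos r) (he.pos t) (h r hr.1 hr.2).1 (h t ht0 ht.2).2
  refine (hG1.sub hG2).ae_eq (Eventually.of_forall fun r => ?_)
  simp only [Pi.sub_apply]
  ring

/-- The solution is the one vanishing at infinity in the sense of `eq_neg_integral`. Near 0 it is
rewritten as an integral over (r, 1] plus a constant when σ > 0, and as an integral over (0, r) when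
σ < 0; the latter is where the vanishing total integral enters. -/
lemma exists_solution (he : IsDecayingWeight e V) (hfl : LocallyIntegrableOn f (Set.Ioi 0) volume)
    (hf : MemRadialL2 γ (σ + 1) f)
    (hσ : 0 < σ ∨ σ < 0 ∧ ∫ t in Set.Ioi 0, t * e t * f t = 0) :
    ∃ g, MemRadialL2 γ σ g ∧ IsPrimitive g (fun r => f r - V r * g r) := by
  set F : ℝ → ℝ := fun r => r * e r * f r with hF
  have hFl : LocallyIntegrableOn F (Set.Ioi 0) volume :=
    hfl.continuousOn_mul he.isPrimitive.continuousOn isOpen_Ioi.isLocallyClosed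
  have hF1 : IntegrableOn F (Set.Ioi 1) := he.integrableOn_far hf.2
  have hv := IsPrimitive.of_locallyIntegrableOn (-∫ t in Set.Ioi 1, F t) hFl
  set v : ℝ → ℝ := fun r => (-∫ t in Set.Ioi 1, F t) + ∫ t in (1 : ℝ)..r, F t with hvdef
  have hvr : ∀ r, 0 < r → v r = -∫ t in Set.Ioi r, F t := by
    intro r hr
    have := intervalIntegral.integral_Ioi_sub_Ioi' hF1 (integrableOn_Ioi hFl hF1 hr)
    simp only [hvdef]
    linarith
  refine ⟨_, ⟨?_, he.memLp_far_of_integral hf.2 hv.continuousOn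
    fun r hr => hvr r (one_pos.trans hr)⟩, he.isPrimitive_inv_mul hv⟩
  rcases hσ with hσ | ⟨hσ, h0⟩
  · refine he.memLp_near_of_integral_Ioc hσ hf.1 hv.continuousOn (-∫ t in Set.Ioi 1, F t)
      fun r hr => ?_
    rw [← intervalIntegral.integral_of_le hr.2, intervalIntegral.integral_symm]
    simp only [hvdef]
    ring
  · refine he.memLp_near_of_integral_Ioo hσ hf.1 hv.continuousOn fun r hr => ?_
    have hFi : IntegrableOn F (Set.Ioi 0) := he.integrableOn_of_neg hσ hf
    have hu : ∫ t in Set.Ioi 0, F t = (∫ t in Set.Ioc 0 r, F t) + ∫ t in Set.Ioi r, F t := by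
      rw [← Set.Ioc_union_Ioi_eq_Ioi hr.1.le]
      exact setIntegral_union (Set.Ioc_disjoint_Ioi le_rfl) measurableSet_Ioi
        (hFi.mono_set Set.Ioc_subset_Ioi_self) (hFi.mono_set (Set.Ioi_subset_Ioi hr.1.le))
    rw [hvr r hr.1, ← integral_Ioc_eq_integral_Ioo]
    change -∫ t in Set.Ioi r, F t = ∫ t in Set.Ioc 0 r, F t
    have h0' : ∫ t in Set.Ioi 0, F t = 0 := h0
    linarith

end IsDecayingWeight

/-! ### Injective Fredholm operators -/

section FunctionalAnalysis

variable {X Y : Type*} [NormedAddCommGroup X] [NormedSpace ℝ X] [NormedAddCommGroup Y]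
  [NormedSpace ℝ Y] {T : X →L[ℝ] Y}

lemma ContinuousLinearMap.ker_eq_bot_of_injective (hT : Function.Injective T) : T.ker = ⊥ :=
  LinearMap.ker_eq_bot.2 hT

/-- An injective operator with closed range between Banach spaces is bounded below, which gives the
strictness required of a Fredholm operator; the kernel conditions are trivial. -/
lemma ContinuousLinearMap.isFredholm_of_injective [CompleteSpace X] [CompleteSpace Y]
    (hT : Function.Injective T)
    (hc : IsClosed (T.range : Set Y)) (hfin : T.range.CoFG) : T.IsFredholm := by
  obtain ⟨K, hK⟩ := T.antilipschitz_of_injective_of_isClosed_range hT hc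
  refine ⟨(hK.isUniformEmbedding T.uniformContinuous).isEmbedding.isStrictMap, hc, ?_, hfin, ?_⟩
  · rw [ContinuousLinearMap.ker_eq_bot_of_injective hT]
    infer_instance
  · rw [ContinuousLinearMap.ker_eq_bot_of_injective hT]
    exact Submodule.closedComplemented_bot

lemma fredholmIndex_of_injective (hT : Function.Injective T) :
    fredholmIndex T = -(Module.finrank ℝ (Y ⧸ T.range) : ℤ) := by
  rw [fredholmIndex, ContinuousLinearMap.ker_eq_bot_of_injective hT]
  simp

lemma isFredholm_and_index_of_range_eq_ker [CompleteSpace X] [CompleteSpace Y]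
    (hT : Function.Injective T) {ℓ : StrongDual ℝ Y}
    (hℓ : ℓ ≠ 0) (hr : ∀ f, f ∈ T.range ↔ ℓ f = 0) : T.IsFredholm ∧ fredholmIndex T = -1 := by
  have hrange : T.range = LinearMap.ker (ℓ : Y →ₗ[ℝ] ℝ) := by
    ext f
    rw [hr f]
    rfl
  have hsurj : Function.Surjective (ℓ : Y →ₗ[ℝ] ℝ) :=
    LinearMap.surjective fun h => hℓ (ContinuousLinearMap.coe_injective h)
  let E : (Y ⧸ T.range) ≃ₗ[ℝ] ℝ :=
    (Submodule.quotEquivOfEq _ _ hrange).trans (LinearMap.quotKerEquivOfSurjective _ hsurj)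
  refine ⟨ContinuousLinearMap.isFredholm_of_injective hT ?_ (Module.Finite.equiv E.symm), ?_⟩
  · rw [hrange]
    exact ℓ.isClosed_ker
  · rw [fredholmIndex_of_injective hT, E.finrank_eq]
    simp

/-- A functional that annihilates the range vanishes on the kernel of ℓ, and is therefore a multiple
of ℓ. -/
lemma comp_eq_zero_iff_of_range_eq_ker {ℓ : StrongDual ℝ Y} (hℓ : ℓ ≠ 0)
    (hr : ∀ f, f ∈ T.range ↔ ℓ f = 0) (η : StrongDual ℝ Y) :
    η ∘L T = 0 ↔ η ∈ Submodule.span ℝ {ℓ} := by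
  rw [Submodule.mem_span_singleton]
  constructor
  · intro h
    have hker : ∀ f, ℓ f = 0 → η f = 0 := by
      intro f hf
      obtain ⟨u, rfl⟩ := (hr f).2 hf
      exact DFunLike.congr_fun h u
    obtain ⟨f₀, hf₀⟩ : ∃ f₀, ℓ f₀ ≠ 0 := by
      by_contra! h0
      exact hℓ (ContinuousLinearMap.ext h0)
    refine ⟨η f₀ / ℓ f₀, ContinuousLinearMap.ext fun f => ?_⟩
    have := hker (f - (ℓ f / ℓ f₀) • f₀) (by simp [hf₀])
    rw [map_sub, map_smul, sub_eq_zero, smul_eq_mul] at this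
    rw [smul_apply, smul_eq_mul, this]
    ring
  · rintro ⟨a, rfl⟩
    ext u
    have := (hr (T u)).1 ⟨u, rfl⟩
    simp [this]

lemma isFredholm_and_index_of_bijective [CompleteSpace X] [CompleteSpace Y]
    (hT : Function.Bijective T) :
    T.IsFredholm ∧ fredholmIndex T = 0 ∧ T.IsInvertible := by
  have hrange : T.range = ⊤ := LinearMap.range_eq_top.2 hT.2
  have hsub : Subsingleton (Y ⧸ T.range) := Submodule.Quotient.subsingleton_iff.2 hrange
  refine ⟨ContinuousLinearMap.isFredholm_of_injective hT.1 ?_ inferInstance, ?_, ?_⟩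
  · rw [hrange]
    exact isClosed_univ
  · rw [fredholmIndex_of_injective hT.1, Module.finrank_zero_of_subsingleton]
    simp
  · exact ⟨ContinuousLinearEquiv.ofBijective T
      (ContinuousLinearMap.ker_eq_bot_of_injective hT.1) hrange, by ext; rfl⟩

end FunctionalAnalysis

/-! ### Smooth compactly supported profiles -/

section Bump

variable {ζ : ℝ → ℝ} {γ τ : ℝ}

lemma memLp_rpow_mul_of_tsupport (hc : Continuous ζ) (hs : HasCompactSupport ζ)
    (h0 : tsupport ζ ⊆ Set.Ioi 0) (p : ℝ) : MemLp (fun r => r ^ p * ζ r) 2 volume := by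
  have : Continuous fun r => r ^ p * ζ r := by
    rw [continuous_iff_continuousAt]
    intro r
    by_cases hr : r ∈ tsupport ζ
    · exact (Real.continuousAt_rpow_const _ _ (Or.inl (ne_of_gt (h0 hr)))).mul hc.continuousAt
    · refine (continuousAt_const (y := (0 : ℝ))).congr ?_
      filter_upwards [notMem_tsupport_iff_eventuallyEq.1 hr] with y hy
      simp [hy]
  exact this.memLp_of_hasCompactSupport hs.mul_left

lemma RadialReg.of_contDiff (hζ : ContDiff ℝ ∞ ζ) (hs : HasCompactSupport ζ)
    (h0 : tsupport ζ ⊆ Set.Ioi 0) (n : ℕ) : RadialReg γ n τ ζ := by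
  induction n generalizing ζ τ with
  | zero =>
    exact ⟨(memLp_rpow_mul_of_tsupport hζ.continuous hs h0 _).restrict _,
      (memLp_rpow_mul_of_tsupport hζ.continuous hs h0 _).restrict _⟩
  | succ n ih =>
    have hd : ContDiff ℝ ∞ (deriv ζ) := (contDiff_infty_iff_deriv.1 hζ).2
    refine ⟨⟨(memLp_rpow_mul_of_tsupport hζ.continuous hs h0 _).restrict _,
      (memLp_rpow_mul_of_tsupport hζ.continuous hs h0 _).restrict _⟩, deriv ζ,
      IsPrimitive.of_hasDerivAt (fun r _ => (hζ.differentiable (by simp) r).hasDerivAt)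
        (hd.continuous.locallyIntegrable.locallyIntegrableOn _),
      ih hd hs.deriv (tsupport_deriv_subset.trans h0)⟩

end Bump

/-! ### Kernel and range of the operator -/

namespace RadialSobolev

variable {χ : ℝ → ℝ} {s : ℕ} {γ σ γt κ lam : ℝ} {k : ℕ} {φ₀ ψ e : ℝ → ℝ}

lemma doubleWeight_neg_mul (hχ : IsRadialCutoff χ) (γ σ : ℝ) {x : Plane} (hx : x ≠ 0) :
    doubleWeight χ (-γ) (-σ) x * doubleWeight χ γ σ x = 1 := by
  have h1 := originWeight_pos hχ (norm_pos_iff.2 hx)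
  have h2 := japaneseBracket_pos x
  unfold doubleWeight
  rw [Real.rpow_neg h1.le, Real.rpow_neg h2.le]
  have h3 := Real.rpow_pos_of_pos h1 σ
  have h4 := Real.rpow_pos_of_pos h2 γ
  field_simp

/-- Pairing with a radial function in the dual weighted space. -/
lemma exists_pairing (hχ : IsRadialCutoff χ) (he : MemRadialL2 (-γ) (-σ) e) :
    ∃ ℓ : StrongDual ℝ (RadialSobolev χ s γ σ), ∀ f,
      Integrable (fun x => toFun f x * e ‖x‖) volume ∧ ℓ f = ∫ x, toFun f x * e ‖x‖ := by
  have hK := (memLp_doubleWeight_norm_iff hχ).2 he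
  obtain ⟨ℓ₀, hℓ₀⟩ := exists_L2_functional hK
  refine ⟨ℓ₀ ∘L (PiLp.proj 1 _ (zeroIndex s)) ∘L (RadialSobolev χ s γ σ).subtypeL, fun f => ?_⟩
  have h0 := SobolevData.doubleWeight_mul_component (γ := γ) (σ := σ) hχ f.1 (zeroIndex s)
  have e0 : σ + ((∑ i, (zeroIndex s).1 i : ℕ) : ℝ) = σ := by simp [zeroIndex]
  rw [e0] at h0
  have key : (fun x => doubleWeight χ (-γ) (-σ) x * e ‖x‖ * f.1 (zeroIndex s) x) =ᵐ[volume]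
      fun x => toFun f x * e ‖x‖ := by
    filter_upwards [h0, ae_ne_zero_plane] with x hx hx0
    rw [← hx]
    have := doubleWeight_neg_mul hχ γ σ hx0
    simp only [toFun]
    linear_combination (f.1.component χ γ σ (zeroIndex s) x * e ‖x‖) * this
  exact ⟨(MemLp.integrable_mul hK (Lp.memLp (f.1 (zeroIndex s)))).congr key,
    (hℓ₀ _).trans (integral_congr_ae key)⟩

lemma integral_toFun_mul {f : RadialSobolev χ s γ σ} {p : ℝ → ℝ}
    (hp : toFun f =ᵐ[volume] fun x => p ‖x‖) :
    ∫ x, toFun f x * e ‖x‖ = circleLength * ∫ r in Set.Ioi 0, r * e r * p r := by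
  have : ∫ x, toFun f x * e ‖x‖ = ∫ x : Plane, p ‖x‖ * e ‖x‖ :=
    integral_congr_ae (hp.mono fun x hx => by simp only [hx])
  rw [this, integral_norm fun r => p r * e r]
  simp only [mul_comm (p _), mul_assoc]

/-- A nonnegative bump supported away from the origin pairs positively with a positive weight. -/
lemma exists_integral_ne_zero (hχ : IsRadialCutoff χ) (he : ContinuousOn e (Set.Ioi 0))
    (hpos : ∀ r, 0 < e r) :
    ∃ f : RadialSobolev χ s γ σ, ∫ x, toFun f x * e ‖x‖ ≠ 0 := by
  let ζ : ContDiffBump (2 : ℝ) := ⟨1 / 2, 1, by norm_num, by norm_num⟩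
  have hts : tsupport ζ ⊆ Set.Ioi 0 := by
    rw [ζ.tsupport_eq, Real.closedBall_eq_Icc]
    intro r hr
    have h1 : (2 : ℝ) - 1 ≤ r := hr.1
    exact show (0 : ℝ) < r by linarith
  obtain ⟨f, hf⟩ := exists_of_profile (s := s) (γ := γ) (σ := σ) hχ
    (RadialReg.of_contDiff ζ.contDiff ζ.hasCompactSupport hts s)
  refine ⟨f, ?_⟩
  rw [integral_toFun_mul hf]
  refine mul_ne_zero circleLength_pos.ne' (ne_of_gt ?_)
  have hint : IntegrableOn (fun r => r * e r * ζ r) (Set.Ioi 0) := by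
    have hc : ContinuousOn (fun r => r * e r * ζ r) (tsupport ζ) :=
      ((continuousOn_id.mul he).mono hts).mul ζ.continuous.continuousOn
    have h1 : IntegrableOn (fun r => r * e r * ζ r) (tsupport ζ) :=
      hc.integrableOn_compact ζ.hasCompactSupport
    refine IntegrableOn.of_forall_sdiff_eq_zero h1 measurableSet_Ioi fun r hr => ?_
    rw [image_eq_zero_of_notMem_tsupport hr.2, mul_zero]
  rw [setIntegral_pos_iff_support_of_nonneg_ae _ hint]
  · refine (Metric.measure_ball_pos volume (2 : ℝ) one_pos).trans_le (measure_mono fun r hr => ?_)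
    have hr' : r ∈ Function.support ζ := by rwa [ζ.support_eq]
    have hr0 : 0 < r := hts (subset_tsupport _ hr')
    exact ⟨mul_ne_zero (mul_pos hr0 (hpos r)).ne' hr', hr0⟩
  · filter_upwards [ae_restrict_mem measurableSet_Ioi] with r hr
    exact mul_nonneg (mul_pos hr (hpos r)).le ζ.nonneg

section Operator

variable {L : RadialSobolev χ s γ σ →L[ℝ] RadialSobolev χ (s - 1) γ (σ + 1)} {hs : 1 ≤ s}

lemma exists_primitive_profile (hχ : IsRadialCutoff χ) (hψ : PhaseProfile γt k κ φ₀ ψ)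
    (hL : ∀ u, toFun (L u) =ᵐ[volume] phaseOperator hs lam φ₀ u)
    (u : RadialSobolev χ s γ σ) :
    ∃ g f, toFun u =ᵐ[volume] (fun x => g ‖x‖) ∧ toFun (L u) =ᵐ[volume] (fun x => f ‖x‖) ∧
      MemRadialL2 γ σ g ∧ MemRadialL2 γ (σ + 1) f ∧
      IsPrimitive g (fun r => f r - phasePotential lam κ ψ r * g r) := by
  obtain ⟨g, hg, e⟩ := exists_profile hχ u
  obtain ⟨h0, h, hp, -⟩ := hg.of_le hs
  have hf : toFun (L u) =ᵐ[volume] fun x => h ‖x‖ + phasePotential lam κ ψ ‖x‖ * g ‖x‖ :=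
    (hL u).trans (phaseOperator_ae_eq hs hψ e hp)
  refine ⟨g, fun r => h r + phasePotential lam κ ψ r * g r, e, hf, h0,
    (memLp_doubleWeight_norm_iff hχ).1 ((memLp_toFun hχ (L u)).ae_eq ?_), ?_⟩
  · exact hf.mono fun x hx => by simp only [hx]
  · simpa using hp

lemma injective_of_phaseOperator (hχ : IsRadialCutoff χ) (hψ : PhaseProfile γt k κ φ₀ ψ)
    (he : IsDecayingWeight e (phasePotential lam κ ψ))
    (hL : ∀ u, toFun (L u) =ᵐ[volume] phaseOperator hs lam φ₀ u) : Function.Injective L := by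
  rw [injective_iff_map_eq_zero]
  intro u hu
  obtain ⟨g, f, eg, ef, hg, hf, hp⟩ := exists_primitive_profile hχ hψ hL u
  have h0 : toFun (0 : RadialSobolev χ (s - 1) γ (σ + 1)) =ᵐ[volume] 0 :=
    SobolevData.component_zero χ γ (σ + 1) _
  rw [hu] at ef
  have hf0 : f =ᵐ[volume.restrict (Set.Ioi 0)] 0 :=
    ae_norm_iff.1 (ef.symm.trans h0)
  refine toFun_injective hχ (eg.trans (EventuallyEq.trans ?_
    (SobolevData.component_zero χ γ σ (zeroIndex s)).symm))
  filter_upwards [ae_ne_zero_plane] with x hx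
  exact he.eq_zero_of_homogeneous hf0 hg hp (norm_pos_iff.2 hx)

lemma integral_eq_zero_of_mem_range (hχ : IsRadialCutoff χ) (hψ : PhaseProfile γt k κ φ₀ ψ)
    (he : IsDecayingWeight e (phasePotential lam κ ψ)) (hσ : σ < 0)
    (hL : ∀ u, toFun (L u) =ᵐ[volume] phaseOperator hs lam φ₀ u) (u : RadialSobolev χ s γ σ) :
    ∫ x, toFun (L u) x * e ‖x‖ = 0 := by
  obtain ⟨g, f, eg, ef, hg, hf, hp⟩ := exists_primitive_profile hχ hψ hL u
  rw [integral_toFun_mul ef, he.integral_eq_zero hσ hf hg hp, mul_zero]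

/-- The half-line equation is solved in weighted L², and elliptic regularity then places the
solution in the full space. In the case σ < 0 the plane integral is a nonzero multiple of the
half-line integral required by `exists_solution`. -/
lemma mem_range_of_phaseOperator (hχ : IsRadialCutoff χ) (hγt : -(1 / 2) ≤ γt)
    (hψ : PhaseProfile γt k κ φ₀ ψ) (hk : 1 ≤ k) (hsk : s - 1 ≤ k)
    (he : IsDecayingWeight e (phasePotential lam κ ψ))
    (hL : ∀ u, toFun (L u) =ᵐ[volume] phaseOperator hs lam φ₀ u)
    (f : RadialSobolev χ (s - 1) γ (σ + 1))
    (hσ : 0 < σ ∨ σ < 0 ∧ ∫ x, toFun f x * e ‖x‖ = 0) : f ∈ L.range := by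
  obtain ⟨p, hp, ep⟩ := exists_profile hχ f
  rw [integral_toFun_mul ep, mul_eq_zero, or_iff_right circleLength_pos.ne'] at hσ
  obtain ⟨g, hg, hgp⟩ := he.exists_solution
    (locallyIntegrableOn_norm_iff.1 ((hp.puncturedSobolev hχ).locallyIntegrableOn hχ))
    hp.memRadialL2 hσ
  have hreg := RadialReg.of_phase_equation hγt hψ.radialReg hk hsk hp hg hgp
  rw [Nat.sub_add_cancel hs] at hreg
  obtain ⟨u, hu⟩ := exists_of_profile hχ hreg
  refine ⟨u, toFun_injective hχ ?_⟩
  refine (hL u).trans ((phaseOperator_ae_eq hs hψ hu hgp).trans ?_)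
  filter_upwards [ep] with x hx
  rw [hx]
  ring

end Operator

end RadialSobolev

/-! ### The Fredholm theorem -/

theorem mainTheorem8
    (χ : ℝ → ℝ) (hχ : IsRadialCutoff χ)
    (s : ℕ) (hs : 1 ≤ s) (γ σ lam κ γt : ℝ)
    (hσ : σ ≠ 0) (hlam : 0 < lam) (hκ : 0 < κ) (hγt : -(1 / 2) < γt) (hγt' : γt < 1)
    (φ₀ : ℝ → ℝ) (hdiff : ∀ r, 0 < r → DifferentiableAt ℝ φ₀ r)
    (hlim : Tendsto (deriv φ₀) atTop (𝓝 κ))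
    (hO : (fun r => deriv φ₀ r - κ) =O[atTop] (fun r : ℝ => 1 / r))
    (hH : MemWeightedSobolev (max 3 (s - 1)) γt (fun x => deriv φ₀ ‖x‖ - κ)) :
    ∃ L : RadialSobolev χ s γ σ →L[ℝ] RadialSobolev χ (s - 1) γ (σ + 1),
      (∀ u, RadialSobolev.toFun (L u) =ᵐ[volume] RadialSobolev.phaseOperator hs lam φ₀ u) ∧
      L.IsFredholm ∧
      ∀ c : ℝ, Tendsto φ₀ (𝓝[>] 0) (𝓝 c) →
        (σ < 0 →
          fredholmIndex L = -1 ∧ Function.Injective L ∧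
            CokernelSpannedBy L (fun x => Real.exp (-lam * φ₀ ‖x‖))) ∧
        (0 < σ → fredholmIndex L = 0 ∧ L.IsInvertible) := by
  have hk : 1 ≤ max 3 (s - 1) := le_max_of_le_left (by norm_num)
  obtain ⟨ψ, hψ⟩ := exists_phaseProfile hχ hk hdiff hH
  have he := hψ.isDecayingWeight hlam hκ hdiff hlim
  obtain ⟨L, hL⟩ := RadialSobolev.exists_continuousLinearMap (γ := γ) (σ := σ) (lam := lam)
    hχ hs hγt.le hψ hk (le_max_right _ _)
  have := RadialSobolev.completeSpace (s := s) (γ := γ) (σ := σ) hχ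
  have := RadialSobolev.completeSpace (s := s - 1) (γ := γ) (σ := σ + 1) hχ
  have hinj := RadialSobolev.injective_of_phaseOperator hχ hψ he hL
  have hmem := RadialSobolev.mem_range_of_phaseOperator hχ hγt.le hψ hk (le_max_right _ _) he hL
  refine ⟨L, hL, ?_⟩
  rcases lt_or_gt_of_ne hσ with hneg | hpos
  -- Near the origin this asks for r^{-σ-1/2} e in L², which holds exactly because σ < 0; at
  -- infinity the exponential decay beats any power.
  · have hdual : MemRadialL2 (-γ) (-(σ + 1)) (fun r => Real.exp (-lam * φ₀ r)) :=
      ⟨he.memLp_near (by linarith), he.memLp_far _⟩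
    obtain ⟨ℓ, hℓ⟩ := RadialSobolev.exists_pairing (s := s - 1) hχ hdual
    have hℓ0 : ℓ ≠ 0 := by
      obtain ⟨f, hf⟩ := RadialSobolev.exists_integral_ne_zero (s := s - 1) (γ := γ) (σ := σ + 1)
        hχ he.continuousOn he.pos
      rintro rfl
      exact hf ((hℓ f).2.symm)
    have hr : ∀ f, f ∈ L.range ↔ ℓ f = 0 := by
      intro f
      rw [(hℓ f).2]
      refine ⟨?_, fun h => hmem f (Or.inr ⟨hneg, h⟩)⟩
      rintro ⟨u, rfl⟩
      exact RadialSobolev.integral_eq_zero_of_mem_range hχ hψ he hneg hL u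
    obtain ⟨hF, hi⟩ := isFredholm_and_index_of_range_eq_ker hinj hℓ0 hr
    exact ⟨hF, fun c _ => ⟨fun _ => ⟨hi, hinj, ℓ, hℓ, hℓ0,
      comp_eq_zero_iff_of_range_eq_ker hℓ0 hr, hr⟩, fun h => absurd h hneg.not_gt⟩⟩
  · obtain ⟨hF, hi, hI⟩ := isFredholm_and_index_of_bijective
      ⟨hinj, fun f => hmem f (Or.inl hpos)⟩
    exact ⟨hF, fun c _ => ⟨fun h => absurd h hpos.not_gt, fun _ => ⟨hi, hI⟩⟩⟩
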